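/- **Model.** Fix $\lambda,\beta,\mu,\epsilon>0$, $\alpha\in[0,1)$ and an integer $\gamma\ge 1$. For an arrival rate $\Lambda>0$ let $(X,Y,Z)=(X(t),Y(t),Z(t))_{t\ge0}$ be the continuous-time Markov chain with values in $\mathbb{Z}_{\ge0}\times\mathbb{Z}\times\mathbb{Z}_{\ge0}$ ($X$ is the number of pending invited agents, $Y$ the agent queue length minus the customer queue length, $Z$ the number of customers in service) that changes only at events of the following kinds, occurring in state $(X,Y,Z)$ at the indicated rates. - Customer arrival, at rate $\Lambda$: $X\mapsto X+\gamma$, $Y\mapsto Y-1$, and $Z\mapsto Z+1$ if $Y>0$ ($Z$ is unchanged if $Y\le 0$). - Acceptance of an invitation, at rate $\beta X$: $X\mapsto X-\min(\gamma,X)$, $Y\mapsto Y+1$, and $Z\mapsto Z+1$ if $Y<0$ ($Z$ is unchanged if $Y\ge0$). - Additional event, at rate $\epsilon|Y|$: if $X\ge1$, then $X\mapsto X-\operatorname{sgn}(Y)$; if $X=0$, then $X\mapsto 1$ when $Y<0$ and $X$ is unchanged when $Y\ge 0$. - Service completion after which the agent returns, at rate $\alpha\mu Z$: $X\mapsto X-\min(\gamma,X)$,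 $Y\mapsto Y+1$, and $Z\mapsto Z-1$ if $Y\ge0$ ($Z$ is unchanged if $Y<0$). - Service completion after which the agent leaves, at rate $(1-\alpha)\mu Z$: $Z\mapsto Z-1$. Let $W=|Y|+2Z$ be the total number of customers and agents in the system. For a scaling parameter $r>0$ let $(X^r,Y^r,Z^r)$ be this process with $\Lambda=\lambda r$, let $W^r=|Y^r|+2Z^r$, and put $$\bar X^r=\frac1r\Big(X^r-\frac{\lambda r(1-\alpha)}{\beta}\Big),\qquad \bar Y^r=\frac1r Y^r,\qquad \bar W^r=\frac1r\Big(W^r-\frac{2\lambda r}{\mu}\Big).$$ For functions on $[0,\infty)$, u.o.c. means uniformly on compact subsets of $[0,\infty)$. A point $t\ge0$ is *regular* for $(x,y,w)$ if for every non-empty subset of the functions $x,y,w$ the pointwise maximum and the pointwise minimum over that subset are differentiable at $t$ (derivatives at $t=0$ are right derivatives). **Theorem.** Let $r$ run over a sequence of positive reals tending to $\infty$, and for each such $r$ let a deterministic initial state of $(X^r,Y^r,Z^r)$ be given such that $(\bar X^r(0),\bar Y^r(0),\bar W^r(0))\to(x(0),y(0),w(0))$ for some fixed $(x(0),y(0),w(0))\in\mathbb{R}^3$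 with $x(0)\ge-\frac{\lambda(1-\alpha)}{\beta}$. Then the processes $(X^r,Y^r,Z^r)$ can be constructed on a common probability space so that the following holds with probability 1. From any subsequence of $r$ one can choose a further subsequence along which $$(\bar X^r,\bar Y^r,\bar W^r)\to(x,y,w)\quad\text{u.o.c.},$$ where $(x,y,w)$ is a locally Lipschitz trajectory on $[0,\infty)$ starting from $(x(0),y(0),w(0))$, with $x(t)\ge-\frac{\lambda(1-\alpha)}{\beta}$ for all $t\ge 0$, such that at any regular point $t\ge0$ $$x'(t)=\begin{cases}-\gamma y'(t)-\epsilon y(t), & \text{if } x(t)>-\frac{\lambda(1-\alpha)}{\beta},\\ \max\{-\gamma y'(t)-\epsilon y(t),\,0\}, & \text{if } x(t)=-\frac{\lambda(1-\alpha)}{\beta},\end{cases}$$ $$y'(t)=\beta x(t)+\tfrac12\alpha\mu\,(w(t)-|y(t)|),\qquad w'(t)=\beta x(t)+\tfrac12(\alpha-2)\mu\,(w(t)-|y(t)|).$$ -/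

import Mathlib

open Set Filter Topology MeasureTheory

noncomputable section

/-- Parameters of the invitation system: base customer arrival rate `lam`, probability `α` that an
agent returns after a service, acceptance rate `β` of an invitation, service rate `μ`, and the two
parameters `ε`, `γ` of the invitation scheme (`γ` is an integer). -/
structure Params where
  lam : ℝ
  α : ℝ
  β : ℝ
  μ : ℝ
  ε : ℝ
  γ : ℕ

/-- A state of the system: `X` pending invitations, `Y` = agent queue minus customer queue,
`Z` customers in service. -/
@[ext]
structure State where
  X : ℕ
  Y : ℤ
  Z : ℕ

/-- The state space is discrete. -/
instance : MeasurableSpace State := ⊤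

/-- The total number `|Y| + 2 Z` of customers and agents in the system. -/
def State.W (s : State) : ℤ := |s.Y| + 2 * (s.Z : ℤ)

/-- The kinds of events: a customer arrival, the acceptance of an invitation, an additional event of
the feedback scheme, a service completion after which the agent returns to the agent queue, and a
service completion after which the agent leaves. -/
inductive Event where
  | arrival
  | acceptance
  | additional
  | completionReturn
  | completionLeave

instance : MeasurableSpace Event := ⊤

/-- The rate of each kind of event in state `s`, when customers arrive at rate `Λ`. -/
def eventRate (p : Params) (Λ : ℝ) (s : State) : Event → ℝ
  | .arrival => Λ
  | .acceptance => p.β * s.X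
  | .additional => p.ε * |(s.Y : ℝ)|
  | .completionReturn => p.α * (p.μ * s.Z)
  | .completionLeave => (1 - p.α) * (p.μ * s.Z)

/-- The total rate at which events occur in state `s`. -/
def totalRate (p : Params) (Λ : ℝ) (s : State) : ℝ :=
  eventRate p Λ s .arrival + eventRate p Λ s .acceptance + eventRate p Λ s .additional
    + eventRate p Λ s .completionReturn + eventRate p Λ s .completionLeave

/-- The state right after an event that occurs in state `s`. (The truncated subtraction `s.Z - 1` is
only relevant when `s.Z ≥ 1`, since completions have rate zero when `s.Z = 0`.) -/
def nextState (p : Params) (s : State) : Event → State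
  | .arrival =>
      { X := s.X + p.γ, Y := s.Y - 1, Z := if 0 < s.Y then s.Z + 1 else s.Z }
  | .acceptance =>
      { X := s.X - min p.γ s.X, Y := s.Y + 1, Z := if s.Y < 0 then s.Z + 1 else s.Z }
  | .additional =>
      { X := if 1 ≤ s.X then ((s.X : ℤ) - Int.sign s.Y).toNat else if s.Y < 0 then 1 else 0
        Y := s.Y
        Z := s.Z }
  | .completionReturn =>
      { X := s.X - min p.γ s.X, Y := s.Y + 1, Z := if s.Y < 0 then s.Z else s.Z - 1 }
  | .completionLeave =>
      { X := s.X, Y := s.Y, Z := s.Z - 1 }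

/-- The state after the first `n` events of the sequence `e`, starting from `s₀`. -/
def stateAfter (p : Params) (s₀ : State) (e : ℕ → Event) : ℕ → State
  | 0 => s₀
  | n + 1 => nextState p (stateAfter p s₀ e n) (e n)

/-- `S` is (a realization on the probability space `(Ω, P)` of) the continuous-time Markov chain of
the system with customer arrival rate `Λ` and initial state `s₀`, in terms of its embedded chain and
its holding times. Let `e k` be the kind of the `k`-th event and `τ k` the time between the `k`-th
event and the previous one. Given the past, an event of kind `a` is the next one with probability
`eventRate / totalRate`, and, independently of that, the time until the next event is exponential
with parameter `totalRate`; this is the product formula in `law`. There is no explosion. -/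
def IsInvitationProcess {Ω : Type*} [MeasurableSpace Ω] (P : Measure Ω) (p : Params) (Λ : ℝ)
    (s₀ : State) (S : ℝ → Ω → State) : Prop :=
  (∀ t, Measurable (S t)) ∧
  ∃ (e : ℕ → Ω → Event) (τ : ℕ → Ω → ℝ),
    (∀ k, Measurable (e k)) ∧ (∀ k, Measurable (τ k)) ∧
    -- joint law of the kinds of events and of the holding times
    (∀ (n : ℕ) (a : ℕ → Event) (u : ℕ → ℝ), (∀ k, 0 ≤ u k) →
      P {ω | ∀ k < n, e k ω = a k ∧ u k < τ k ω} =
        ENNReal.ofReal (∏ k ∈ Finset.range n,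
          (eventRate p Λ (stateAfter p s₀ a k) (a k) / totalRate p Λ (stateAfter p s₀ a k) *
            Real.exp (-(totalRate p Λ (stateAfter p s₀ a k) * u k))))) ∧
    -- no explosion, and `S` is constant between consecutive events
    (∀ᵐ ω ∂P,
      Tendsto (fun n => ∑ k ∈ Finset.range n, τ k ω) atTop atTop ∧
      ∀ (n : ℕ) (t : ℝ), ∑ k ∈ Finset.range n, τ k ω ≤ t →
        t < ∑ k ∈ Finset.range (n + 1), τ k ω →
        S t ω = stateAfter p s₀ (fun k => e k ω) n)

/-- The centered and fluid-scaled number of pending invitations. -/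
def fluidX (p : Params) (r : ℝ) (s : State) : ℝ :=
  1 / r * ((s.X : ℝ) - p.lam * r * (1 - p.α) / p.β)

/-- The fluid-scaled queue difference. -/
def fluidY (r : ℝ) (s : State) : ℝ := 1 / r * (s.Y : ℝ)

/-- The centered and fluid-scaled total number of customers and agents. -/
def fluidW (p : Params) (r : ℝ) (s : State) : ℝ :=
  1 / r * ((s.W : ℝ) - 2 * p.lam * r / p.μ)

/-- Uniform convergence on the compact subsets of `[0, ∞)`. -/
def TendstoUOC (f : ℕ → ℝ → ℝ) (g : ℝ → ℝ) : Prop :=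
  ∀ K : Set ℝ, IsCompact K → K ⊆ Ici 0 → TendstoUniformlyOn f g atTop K

/-- `t ≥ 0` is a regular point of the finite family `f` of functions on `[0, ∞)`: the maximum and the
minimum over every non-empty subfamily are differentiable at `t`. At `t > 0` this is ordinary
(two-sided) differentiability; at `t = 0` only the right derivative makes sense. -/
def IsRegularPoint {ι : Type*} [Fintype ι] (f : ι → ℝ → ℝ) (t : ℝ) : Prop :=
  0 ≤ t ∧ ∀ (A : Finset ι) (hA : A.Nonempty),
    DifferentiableWithinAt ℝ (fun s => A.sup' hA (fun i => f i s)) (Ici 0) t ∧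
    DifferentiableWithinAt ℝ (fun s => A.inf' hA (fun i => f i s)) (Ici 0) t

/-- The position `-λ(1-α)/β` of the reflecting boundary. -/
def boundary (p : Params) : ℝ := -(p.lam * (1 - p.α) / p.β)

/-- The switched system with reflecting boundary holds for `(x, y, w)` at time `t`. -/
def FluidSystemAt (p : Params) (x y w : ℝ → ℝ) (t : ℝ) : Prop :=
  ∃ x' y' w' : ℝ,
    HasDerivWithinAt x x' (Ici 0) t ∧
    HasDerivWithinAt y y' (Ici 0) t ∧
    HasDerivWithinAt w w' (Ici 0) t ∧
    (boundary p < x t → x' = -p.γ * y' - p.ε * y t) ∧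
    (x t = boundary p → x' = max (-p.γ * y' - p.ε * y t) 0) ∧
    y' = p.β * x t + 1 / 2 * p.α * p.μ * (w t - |y t|) ∧
    w' = p.β * x t + 1 / 2 * (p.α - 2) * p.μ * (w t - |y t|)

end

noncomputable section

/-! ### The unit exponential law -/

/-! The chain is driven by i.i.d. pairs (uniform, unit exponential), one pair per event: the first
coordinate selects the kind of event, the second the holding time. For each mark (a kind of event
together with the truth value of `0 < Y`), the number of marked events minus its integrated rate is
a martingale along the embedded chain. Its increments have second moment at most 6, whatever the
state and the arrival rate, so over `n` events its second moment is at most `6 * n`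
(`lintegral_drivenNoise_sq_le`). A bounded time interval contains `O(r)` events, so this noise has
order `√r` and disappears after division by `r`.

Everything else is deterministic and holds path by path. `Y` and `W` are exact linear combinations
of event counts (`balance_Y`, `balance_W`), and the centering of `X` and `W` turns the corresponding
combinations of rates into the drifts of the limit. For `X`, the change of `X + γ Y`, corrected by
the signed count of additional events, is nondecreasing and grows only at steps that end with `X =
0` (`regulator_succ`). It is a discrete Skorokhod regulator, so `x - freeX` is close to the running
supremum of `max 0 (boundary - freeX)`. Thus the scaled path solves the reflected integral equations
up to a small error (`IsPath.approxSolution`).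

These equations are stable. The drifts are Lipschitz and the running supremum is 1-Lipschitz in the
uniform norm, so an exponentially weighted Gronwall argument makes approximate solutions with close
initial values close (`ApproxSolution.exists_stability`). The scaled paths are therefore uniformly
Cauchy on compacts and the whole sequence converges (`exists_limit`), without any compactness
argument. The limit solves the equations exactly; its Lipschitz property and its derivatives are
read off from them, the regulator being constant away from the boundary.

The probabilities of large noise tend to zero, but need not be summable when `r` is an arbitrary
sequence. The common probability space is therefore chosen so that one uniform variable decides, for
all indices at once, which samples are bad (`exists_coupling`); almost surely only finitely many
are. -/

lemma expMeasure_one_eq : ProbabilityTheory.expMeasure 1 =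
    (volume.restrict (Ioi (0:ℝ))).withDensity (fun x => ENNReal.ofReal (Real.exp (-x))) := by
  have h : ProbabilityTheory.expMeasure 1 = volume.withDensity
      (ProbabilityTheory.exponentialPDF 1) := rfl
  rw [h, ← withDensity_indicator measurableSet_Ioi]
  refine withDensity_congr_ae ?_
  have h0 : ∀ᵐ x : ℝ, x ≠ 0 := by simp [ae_iff]
  filter_upwards [h0] with x hx
  rw [ProbabilityTheory.exponentialPDF_eq]
  by_cases h : 0 < x
  · simp [indicator, h, h.le]
  · have : ¬ 0 ≤ x := fun h' => h (lt_of_le_of_ne h' (Ne.symm hx))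
    simp [indicator, h, this]

instance : IsProbabilityMeasure (ProbabilityTheory.expMeasure 1) :=
  ProbabilityTheory.isProbabilityMeasure_expMeasure one_pos

lemma integrable_expMeasure_one {f : ℝ → ℝ} :
    Integrable f (ProbabilityTheory.expMeasure 1) ↔
      IntegrableOn (fun x => Real.exp (-x) * f x) (Ioi 0) := by
  rw [expMeasure_one_eq, integrable_withDensity_iff_integrable_smul' (by fun_prop) (by simp)]
  simp only [ENNReal.toReal_ofReal (Real.exp_pos _).le, smul_eq_mul, IntegrableOn]

lemma integral_expMeasure_one (f : ℝ → ℝ) :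
    ∫ x, f x ∂(ProbabilityTheory.expMeasure 1) = ∫ x in Ioi 0, Real.exp (-x) * f x := by
  rw [expMeasure_one_eq, integral_withDensity_eq_integral_toReal_smul (by fun_prop) (by simp)]
  simp only [ENNReal.toReal_ofReal (Real.exp_pos _).le, smul_eq_mul]

lemma integrable_id_expMeasure_one : Integrable (fun x : ℝ => x) (ProbabilityTheory.expMeasure 1) := by
  rw [integrable_expMeasure_one]
  have := Real.GammaIntegral_convergent (s := 2) (by norm_num)
  refine this.congr_fun (fun x _ => ?_) measurableSet_Ioi
  simp only
  norm_num

lemma integral_id_expMeasure_one : ∫ x, x ∂(ProbabilityTheory.expMeasure 1) = 1 := by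
  rw [integral_expMeasure_one]
  have := Real.Gamma_eq_integral (s := 2) (by norm_num)
  rw [Real.Gamma_two] at this
  rw [this]
  refine setIntegral_congr_fun measurableSet_Ioi (fun x _ => ?_)
  norm_num

lemma integrable_sq_expMeasure_one :
    Integrable (fun x : ℝ => x ^ 2) (ProbabilityTheory.expMeasure 1) := by
  rw [integrable_expMeasure_one]
  have := Real.GammaIntegral_convergent (s := 3) (by norm_num)
  refine this.congr_fun (fun x _ => ?_) measurableSet_Ioi
  simp only
  rw [show (3 - 1 : ℝ) = (2 : ℕ) by norm_num, Real.rpow_natCast]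

lemma integral_sq_expMeasure_one : ∫ x, x ^ 2 ∂(ProbabilityTheory.expMeasure 1) = 2 := by
  rw [integral_expMeasure_one]
  have := Real.Gamma_eq_integral (s := 3) (by norm_num)
  have h3 : Real.Gamma 3 = 2 := by
    have := Real.Gamma_nat_eq_factorial 2
    rw [show ((2:ℕ):ℝ) + 1 = 3 by norm_num] at this
    rw [this]
    norm_num [Nat.factorial]
  rw [h3] at this
  rw [this]
  refine setIntegral_congr_fun measurableSet_Ioi (fun x _ => ?_)
  rw [show (3 - 1 : ℝ) = (2 : ℕ) by norm_num, Real.rpow_natCast]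

lemma expMeasure_one_Ioi {c : ℝ} (hc : 0 ≤ c) :
    ProbabilityTheory.expMeasure 1 (Ioi c) = ENNReal.ofReal (Real.exp (-c)) := by
  have h := ProbabilityTheory.cdf_expMeasure_eq (r := 1) one_pos c
  rw [if_pos hc, ProbabilityTheory.cdf_eq_real, one_mul] at h
  have h2 := probReal_compl_eq_one_sub (μ := ProbabilityTheory.expMeasure 1) (measurableSet_Iic (a := c))
  rw [h, compl_Iic] at h2
  rw [← ofReal_measureReal, h2]
  congr 1
  ring

/-! ### Rates -/

/-- The standing assumptions on the parameters. -/
structure Params.Admissible (p : Params) : Prop where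
  lam_pos : 0 < p.lam
  α_nonneg : 0 ≤ p.α
  α_lt_one : p.α < 1
  β_pos : 0 < p.β
  μ_pos : 0 < p.μ
  ε_pos : 0 < p.ε
  γ_pos : 0 < p.γ

instance : DiscreteMeasurableSpace State := ⟨fun _ => trivial⟩
instance : DiscreteMeasurableSpace Event := ⟨fun _ => trivial⟩

instance : DecidableEq Event := fun a b => by
  cases a <;> cases b <;> first | exact isTrue rfl | exact isFalse (by simp)

instance : Fintype Event where
  elems := {.arrival, .acceptance, .additional, .completionReturn, .completionLeave}
  complete := fun a => by cases a <;> simp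

instance : Countable State :=
  Function.Injective.countable (f := fun s : State => (s.X, s.Y, s.Z)) (by
    rintro ⟨a, b, c⟩ ⟨a', b', c'⟩ h
    simpa using h)

lemma Event.sum_univ {M : Type*} [AddCommMonoid M] (f : Event → M) :
    ∑ a, f a = f .arrival + (f .acceptance + (f .additional + (f .completionReturn +
      f .completionLeave))) := by
  change ∑ a ∈ {.arrival, .acceptance, .additional, .completionReturn, .completionLeave}, f a = _
  rw [Finset.sum_insert (by simp), Finset.sum_insert (by simp), Finset.sum_insert (by simp),
    Finset.sum_insert (by simp), Finset.sum_singleton]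

lemma eventRate_nonneg {p : Params} (hp : p.Admissible) {Λ : ℝ} (hΛ : 0 < Λ) (s : State)
    (a : Event) : 0 ≤ eventRate p Λ s a := by
  have := hp.β_pos
  have := hp.ε_pos
  have := hp.μ_pos
  have := hp.α_nonneg
  have : 0 ≤ 1 - p.α := by linarith [hp.α_lt_one]
  cases a <;> simp only [eventRate] <;> positivity

lemma totalRate_eq_sum (p : Params) (Λ : ℝ) (s : State) :
    totalRate p Λ s = ∑ a, eventRate p Λ s a := by
  rw [Event.sum_univ, totalRate]
  ring

lemma eventRate_le_totalRate {p : Params} (hp : p.Admissible) {Λ : ℝ} (hΛ : 0 < Λ) (s : State)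
    (a : Event) : eventRate p Λ s a ≤ totalRate p Λ s := by
  rw [totalRate_eq_sum]
  exact Finset.single_le_sum (fun b _ => eventRate_nonneg hp hΛ s b) (Finset.mem_univ a)

lemma totalRate_pos {p : Params} (hp : p.Admissible) {Λ : ℝ} (hΛ : 0 < Λ) (s : State) :
    0 < totalRate p Λ s :=
  lt_of_lt_of_le (by simpa [eventRate] using hΛ) (eventRate_le_totalRate hp hΛ s .arrival)

/-! ### The noise driving one step -/

/-- The kind of event selected by a number `v` in `[0, totalRate)`. -/
def selectEvent (p : Params) (Λ : ℝ) (s : State) (v : ℝ) : Event :=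
  if v ∈ Ico 0 (eventRate p Λ s .acceptance) then .acceptance
  else if v ∈ Ico (eventRate p Λ s .acceptance)
    (eventRate p Λ s .acceptance + eventRate p Λ s .additional) then .additional
  else if v ∈ Ico (eventRate p Λ s .acceptance + eventRate p Λ s .additional)
    (eventRate p Λ s .acceptance + eventRate p Λ s .additional
      + eventRate p Λ s .completionReturn) then .completionReturn
  else if v ∈ Ico (eventRate p Λ s .acceptance + eventRate p Λ s .additional
      + eventRate p Λ s .completionReturn) (eventRate p Λ s .acceptance
      + eventRate p Λ s .additional + eventRate p Λ s .completionReturn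
      + eventRate p Λ s .completionLeave) then .completionLeave
  else .arrival

/-- A nonempty interval has positive length, and the default branch is the arrival, whose rate is
positive. So events of rate zero never occur on any sample, even for `v` outside the range of the
total rate. -/
lemma eventRate_selectEvent_pos {p : Params} {Λ : ℝ} (hΛ : 0 < Λ) (s : State)
    (v : ℝ) : 0 < eventRate p Λ s (selectEvent p Λ s v) := by
  unfold selectEvent
  split_ifs with h1 h2 h3 h4
  · exact h1.1.trans_lt h1.2
  · linarith [h2.1.trans_lt h2.2]
  · linarith [h3.1.trans_lt h3.2]
  · linarith [h4.1.trans_lt h4.2]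
  · exact hΛ

lemma measurable_selectEvent (p : Params) (Λ : ℝ) (s : State) :
    Measurable (selectEvent p Λ s) := by
  unfold selectEvent
  refine Measurable.ite measurableSet_Ico measurable_const ?_
  refine Measurable.ite measurableSet_Ico measurable_const ?_
  refine Measurable.ite measurableSet_Ico measurable_const ?_
  exact Measurable.ite measurableSet_Ico measurable_const measurable_const

/-- The uniform law on the unit interval. -/
def unifLaw : Measure ℝ := volume.restrict (Ico 0 1)

instance : IsProbabilityMeasure unifLaw := ⟨by simp [unifLaw]⟩

/-- Agreement is only asked on `[0, 1)`, so the default branch of `selectEvent` may be treated as an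
interval as well. -/
lemma unifLaw_Ico {R a b : ℝ} (hR : 0 < R) (ha : 0 ≤ a) (hb : b ≤ R) {A : Set ℝ}
    (hA : A ∩ Ico 0 1 = {u | R * u ∈ Ico a b} ∩ Ico 0 1) (hAm : MeasurableSet A) :
    unifLaw A = ENNReal.ofReal ((b - a) / R) := by
  rw [unifLaw, Measure.restrict_apply hAm, hA]
  have : {u | R * u ∈ Ico a b} ∩ Ico 0 1 = Ico (a / R) (b / R) := by
    ext u
    simp only [mem_inter_iff, mem_ofPred_eq, mem_Ico, div_le_iff₀ hR, lt_div_iff₀ hR]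
    constructor
    · rintro ⟨⟨h1, h2⟩, -⟩
      exact ⟨by linarith, by linarith⟩
    · rintro ⟨h1, h2⟩
      refine ⟨⟨by linarith, by linarith⟩, ?_, ?_⟩
      · by_contra h
        nlinarith
      · by_contra h
        nlinarith
  rw [this, Real.volume_Ico]
  congr 1
  ring

lemma unifLaw_selectEvent {p : Params} (hp : p.Admissible) {Λ : ℝ} (hΛ : 0 < Λ) (s : State)
    (a : Event) : unifLaw {u | selectEvent p Λ s (totalRate p Λ s * u) = a} =
      ENNReal.ofReal (eventRate p Λ s a / totalRate p Λ s) := by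
  have hm : MeasurableSet {u | selectEvent p Λ s (totalRate p Λ s * u) = a} :=
    ((measurable_selectEvent p Λ s).comp (measurable_const_mul _)) (measurableSet_singleton a)
  have hR := totalRate_pos hp hΛ s
  have htot : totalRate p Λ s = Λ + eventRate p Λ s .acceptance + eventRate p Λ s .additional
    + eventRate p Λ s .completionReturn + eventRate p Λ s .completionLeave := rfl
  have hn := eventRate_nonneg hp hΛ s
  have h1 := hn .acceptance
  have h2 := hn .additional
  have h3 := hn .completionReturn
  have h4 := hn .completionLeave
  have harr : eventRate p Λ s .arrival = Λ := rfl
  generalize totalRate p Λ s = R at *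
  unfold selectEvent at hm ⊢
  generalize e1 : eventRate p Λ s .acceptance = c1 at *
  generalize e2 : eventRate p Λ s .additional = c2 at *
  generalize e3 : eventRate p Λ s .completionReturn = c3 at *
  generalize e4 : eventRate p Λ s .completionLeave = c4 at *
  cases a
  · refine (unifLaw_Ico (a := c1 + c2 + c3 + c4) (b := R) hR (by linarith) le_rfl ?_ hm).trans
      (by rw [harr, htot]; congr 2; ring)
    ext u; simp only [mem_inter_iff, mem_ofPred_eq, mem_Ico]
    have : u < 1 → R * u < R := fun h => by nlinarith
    have : 0 ≤ u → 0 ≤ R * u := fun h => by positivity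
    grind
  · refine (unifLaw_Ico (a := 0) (b := c1) hR le_rfl (by linarith) ?_ hm).trans (by simp [*])
    ext u; simp only [mem_inter_iff, mem_ofPred_eq, mem_Ico]
    grind
  · refine (unifLaw_Ico (a := c1) (b := c1 + c2) hR h1 (by linarith) ?_ hm).trans (by simp [*])
    ext u; simp only [mem_inter_iff, mem_ofPred_eq, mem_Ico]
    grind
  · refine (unifLaw_Ico (a := c1 + c2) (b := c1 + c2 + c3) hR (by linarith) (by linarith) ?_ hm).trans
      (by simp [*])
    ext u; simp only [mem_inter_iff, mem_ofPred_eq, mem_Ico]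
    grind
  · refine (unifLaw_Ico (a := c1 + c2 + c3) (b := c1 + c2 + c3 + c4) hR (by linarith) (by linarith)
      ?_ hm).trans (by simp [*])
    ext u; simp only [mem_inter_iff, mem_ofPred_eq, mem_Ico]
    grind


/-- The law of the pair of random numbers driving one step. -/
def stepLaw : Measure (ℝ × ℝ) := unifLaw.prod (ProbabilityTheory.expMeasure 1)

instance : IsProbabilityMeasure stepLaw := by unfold stepLaw; infer_instance

/-- The kind of the event selected by the driving noise `x` in state `s`. -/
def stepEvent (p : Params) (Λ : ℝ) (s : State) (x : ℝ × ℝ) : Event :=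
  selectEvent p Λ s (totalRate p Λ s * x.1)

/-- The holding time selected by the driving noise `x` in state `s`. -/
def stepTime (p : Params) (Λ : ℝ) (s : State) (x : ℝ × ℝ) : ℝ := x.2 / totalRate p Λ s

lemma measurable_stepEvent (p : Params) (Λ : ℝ) (s : State) : Measurable (stepEvent p Λ s) :=
  (measurable_selectEvent p Λ s).comp (measurable_fst.const_mul _)

lemma measurable_stepTime (p : Params) (Λ : ℝ) (s : State) : Measurable (stepTime p Λ s) :=
  measurable_snd.div_const _

/-- The event depends on the first coordinate and the time on the second, so the set is a rectangle
and its measure factors. -/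
lemma stepLaw_event_time {p : Params} (hp : p.Admissible) {Λ : ℝ} (hΛ : 0 < Λ) (s : State)
    (a : Event) {u : ℝ} (hu : 0 ≤ u) :
    stepLaw {x | stepEvent p Λ s x = a ∧ u < stepTime p Λ s x} =
      ENNReal.ofReal (eventRate p Λ s a / totalRate p Λ s *
        Real.exp (-(totalRate p Λ s * u))) := by
  have hR := totalRate_pos hp hΛ s
  have : {x | stepEvent p Λ s x = a ∧ u < stepTime p Λ s x} =
      {u | selectEvent p Λ s (totalRate p Λ s * u) = a} ×ˢ Ioi (totalRate p Λ s * u) := by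
    ext x
    simp only [stepEvent, stepTime, mem_ofPred_eq, mem_prod, mem_Ioi, lt_div_iff₀ hR, mul_comm u]
  rw [this, stepLaw, Measure.prod_prod, unifLaw_selectEvent hp hΛ,
    expMeasure_one_Ioi (by positivity), ← ENNReal.ofReal_mul]
  exact div_nonneg (eventRate_nonneg hp hΛ s a) hR.le

lemma measurePreserving_snd_stepLaw :
    MeasurePreserving Prod.snd stepLaw (ProbabilityTheory.expMeasure 1) :=
  measurePreserving_snd

lemma measurePreserving_fst_stepLaw : MeasurePreserving Prod.fst stepLaw unifLaw :=
  measurePreserving_fst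

lemma stepLaw_snd_pos : ∀ᵐ x ∂stepLaw, 0 < x.2 := by
  have h : ∀ᵐ x ∂(ProbabilityTheory.expMeasure 1), 0 < x := by
    rw [expMeasure_one_eq]
    refine (withDensity_absolutelyContinuous _ _).ae_le ?_
    exact ae_restrict_mem measurableSet_Ioi
  exact measurePreserving_snd_stepLaw.quasiMeasurePreserving.ae h

/-! ### Compensated counting of events -/

/-- Indicator that an event `e` in state `s` carries the mark `c`, which records the kind of the
event and whether `Y > 0`. -/
def mark (c : Event × Bool) (s : State) (e : Event) : ℝ :=
  if e = c.1 ∧ decide (0 < s.Y) = c.2 then 1 else 0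

/-- The rate of the events that carry the mark `c`. -/
def markRate (p : Params) (Λ : ℝ) (c : Event × Bool) (s : State) : ℝ :=
  if decide (0 < s.Y) = c.2 then eventRate p Λ s c.1 else 0

lemma mark_nonneg (c : Event × Bool) (s : State) (e : Event) : 0 ≤ mark c s e := by
  unfold mark; split_ifs <;> norm_num

lemma mark_le_one (c : Event × Bool) (s : State) (e : Event) : mark c s e ≤ 1 := by
  unfold mark; split_ifs <;> norm_num

lemma markRate_nonneg {p : Params} (hp : p.Admissible) {Λ : ℝ} (hΛ : 0 < Λ) (c : Event × Bool)
    (s : State) : 0 ≤ markRate p Λ c s := by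
  unfold markRate
  split_ifs
  · exact eventRate_nonneg hp hΛ s _
  · exact le_rfl

lemma markRate_le {p : Params} (hp : p.Admissible) {Λ : ℝ} (hΛ : 0 < Λ) (c : Event × Bool)
    (s : State) : markRate p Λ c s ≤ totalRate p Λ s := by
  unfold markRate
  split_ifs
  · exact eventRate_le_totalRate hp hΛ s _
  · exact (totalRate_pos hp hΛ s).le

/-- The increment of the compensated number of events with mark `c` in one step. -/
def noiseIncr (p : Params) (Λ : ℝ) (c : Event × Bool) (s : State) (x : ℝ × ℝ) : ℝ :=
  mark c s (stepEvent p Λ s x) - markRate p Λ c s * stepTime p Λ s x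

lemma measurable_noiseIncr (p : Params) (Λ : ℝ) (c : Event × Bool) (s : State) :
    Measurable (noiseIncr p Λ c s) :=
  ((measurable_of_countable (f := mark c s)).comp (measurable_stepEvent p Λ s)).sub
    ((measurable_stepTime p Λ s).const_mul _)

lemma integral_mark {p : Params} (hp : p.Admissible) {Λ : ℝ} (hΛ : 0 < Λ) (c : Event × Bool)
    (s : State) : ∫ x, mark c s (stepEvent p Λ s x) ∂stepLaw =
      markRate p Λ c s / totalRate p Λ s := by
  have hm : MeasurableSet {x | stepEvent p Λ s x = c.1} :=
    measurable_stepEvent p Λ s (measurableSet_singleton c.1)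
  by_cases h : decide (0 < s.Y) = c.2
  · have : (fun x => mark c s (stepEvent p Λ s x)) =
        indicator {x | stepEvent p Λ s x = c.1} (fun _ => (1:ℝ)) := by
      ext x
      simp [mark, h, indicator]
    rw [this, integral_indicator_const _ hm, markRate, if_pos h, smul_eq_mul, mul_one,
      measureReal_def]
    have h2 : stepLaw {x | stepEvent p Λ s x = c.1} =
        unifLaw {u | selectEvent p Λ s (totalRate p Λ s * u) = c.1} :=
      measurePreserving_fst_stepLaw.measure_preimage
        (((measurable_selectEvent p Λ s).comp (measurable_const_mul _))
          (measurableSet_singleton c.1)).nullMeasurableSet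
    rw [h2, unifLaw_selectEvent hp hΛ, ENNReal.toReal_ofReal]
    exact div_nonneg (eventRate_nonneg hp hΛ s _) (totalRate_pos hp hΛ s).le
  · simp [mark, markRate, h]

lemma integrable_mark (p : Params) (Λ : ℝ) (c : Event × Bool) (s : State) :
    Integrable (fun x => mark c s (stepEvent p Λ s x)) stepLaw := by
  refine Integrable.of_bound ((measurable_of_countable (f := mark c s)).comp
    (measurable_stepEvent p Λ s)).aestronglyMeasurable 1 (ae_of_all _ fun x => ?_)
  rw [Real.norm_eq_abs, abs_of_nonneg (mark_nonneg _ _ _)]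
  exact mark_le_one _ _ _

lemma integrable_stepTime (p : Params) (Λ : ℝ) (s : State) :
    Integrable (stepTime p Λ s) stepLaw :=
  (measurePreserving_snd_stepLaw.integrable_comp_of_integrable
    integrable_id_expMeasure_one).div_const _

lemma integral_snd_stepLaw : ∫ x, x.2 ∂stepLaw = 1 := by
  rw [← integral_id_expMeasure_one, ← measurePreserving_snd_stepLaw.map_eq,
    integral_map measurable_snd.aemeasurable (by fun_prop)]

lemma integral_snd_sq_stepLaw : ∫ x, x.2 ^ 2 ∂stepLaw = 2 := by
  rw [← integral_sq_expMeasure_one, ← measurePreserving_snd_stepLaw.map_eq,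
    integral_map measurable_snd.aemeasurable (by fun_prop)]

lemma integrable_snd_sq_stepLaw : Integrable (fun x => x.2 ^ 2) stepLaw :=
  measurePreserving_snd_stepLaw.integrable_comp_of_integrable integrable_sq_expMeasure_one

lemma integrable_noiseIncr (p : Params) (Λ : ℝ) (c : Event × Bool) (s : State) :
    Integrable (noiseIncr p Λ c s) stepLaw :=
  (integrable_mark p Λ c s).sub ((integrable_stepTime p Λ s).const_mul _)

/-- The martingale property: the mark has mean `markRate / totalRate` and the holding time has mean
`1 / totalRate`. -/
lemma integral_noiseIncr {p : Params} (hp : p.Admissible) {Λ : ℝ} (hΛ : 0 < Λ) (c : Event × Bool)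
    (s : State) : ∫ x, noiseIncr p Λ c s x ∂stepLaw = 0 := by
  unfold noiseIncr
  rw [integral_sub (integrable_mark p Λ c s) ((integrable_stepTime p Λ s).const_mul _),
    integral_mark hp hΛ, integral_const_mul]
  simp only [stepTime]
  rw [integral_div, integral_snd_stepLaw]
  ring

/-- The compensator is `q * x.2` with `q = markRate / totalRate ≤ 1`, which makes the bound uniform
in the state and in `Λ`. -/
lemma noiseIncr_sq_le {p : Params} (hp : p.Admissible) {Λ : ℝ} (hΛ : 0 < Λ) (c : Event × Bool)
    (s : State) (x : ℝ × ℝ) : noiseIncr p Λ c s x ^ 2 ≤ 2 + 2 * x.2 ^ 2 := by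
  have hR := totalRate_pos hp hΛ s
  have e : markRate p Λ c s * stepTime p Λ s x = (markRate p Λ c s / totalRate p Λ s) * x.2 := by
    simp only [stepTime]; ring
  have h1 : (markRate p Λ c s / totalRate p Λ s) ^ 2 ≤ 1 :=
    pow_le_one₀ (div_nonneg (markRate_nonneg hp hΛ c s) hR.le)
      ((div_le_one hR).2 (markRate_le hp hΛ c s))
  have h2 : mark c s (stepEvent p Λ s x) ^ 2 ≤ 1 :=
    pow_le_one₀ (mark_nonneg _ _ _) (mark_le_one _ _ _)
  unfold noiseIncr
  rw [e]
  generalize mark c s (stepEvent p Λ s x) = a at *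
  generalize markRate p Λ c s / totalRate p Λ s = q at *
  nlinarith [sq_nonneg (a + q * x.2), mul_le_mul_of_nonneg_right h1 (sq_nonneg x.2)]

lemma integrable_noiseIncr_sq {p : Params} (hp : p.Admissible) {Λ : ℝ} (hΛ : 0 < Λ)
    (c : Event × Bool) (s : State) : Integrable (fun x => noiseIncr p Λ c s x ^ 2) stepLaw := by
  refine ((integrable_const (2:ℝ)).add (integrable_snd_sq_stepLaw.const_mul 2)).mono'
    ((measurable_noiseIncr p Λ c s).pow_const 2).aestronglyMeasurable (ae_of_all _ fun x => ?_)
  rw [Real.norm_eq_abs, abs_of_nonneg (sq_nonneg _)]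
  exact noiseIncr_sq_le hp hΛ c s x

/-- The cross term vanishes because the increment has mean zero, and `6 = 2 + 2 * 2` since a unit
exponential variable has second moment 2. -/
lemma lintegral_add_noiseIncr_sq_le {p : Params} (hp : p.Admissible) {Λ : ℝ} (hΛ : 0 < Λ)
    (c : Event × Bool) (s : State) (m : ℝ) :
    ∫⁻ x, ENNReal.ofReal ((m + noiseIncr p Λ c s x) ^ 2) ∂stepLaw ≤
      ENNReal.ofReal (m ^ 2) + 6 := by
  have h1 := integrable_noiseIncr p Λ c s
  have h2 := integrable_noiseIncr_sq hp hΛ c s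
  have e : (fun x => (m + noiseIncr p Λ c s x) ^ 2) =
      fun x => (m ^ 2 + 2 * m * noiseIncr p Λ c s x) + noiseIncr p Λ c s x ^ 2 := by
    ext x; ring
  have h3 : Integrable (fun x => m ^ 2 + 2 * m * noiseIncr p Λ c s x) stepLaw :=
    (integrable_const _).add (h1.const_mul _)
  rw [← ofReal_integral_eq_lintegral_ofReal (by rw [e]; exact h3.add h2)
    (ae_of_all _ fun x => sq_nonneg _), e, integral_add h3 h2,
    integral_add (integrable_const _) (h1.const_mul _), integral_const_mul,
    integral_noiseIncr hp hΛ]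
  have h6 : ∫ x, noiseIncr p Λ c s x ^ 2 ∂stepLaw ≤ 6 := by
    refine (integral_mono h2 ((integrable_const (2:ℝ)).add (integrable_snd_sq_stepLaw.const_mul 2))
      (noiseIncr_sq_le hp hΛ c s)).trans ?_
    simp only [Pi.add_apply]
    rw [integral_add (integrable_const _) (integrable_snd_sq_stepLaw.const_mul 2),
      integral_const_mul, integral_snd_sq_stepLaw]
    norm_num
  rw [← ENNReal.ofReal_ofNat 6, ← ENNReal.ofReal_add (sq_nonneg _) (by norm_num)]
  apply ENNReal.ofReal_le_ofReal
  simpa using h6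

/-! ### Sample paths of the embedded chain -/

/-- `S` is a sample path started in `s₀`, with kinds of events `e` and holding times `τ`. -/
structure IsPath (p : Params) (Λ : ℝ) (s₀ : State) (e : ℕ → Event) (τ : ℕ → ℝ) (S : ℝ → State) :
    Prop where
  time_pos : ∀ k, 0 < τ k
  rate_pos : ∀ k, 0 < eventRate p Λ (stateAfter p s₀ e k) (e k)
  tendsto : Tendsto (fun n => ∑ k ∈ Finset.range n, τ k) atTop atTop
  eq : ∀ (n : ℕ) (t : ℝ), ∑ k ∈ Finset.range n, τ k ≤ t → t < ∑ k ∈ Finset.range (n + 1), τ k →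
    S t = stateAfter p s₀ e n

/-- The compensated number of events with mark `c` among the first `n` events. -/
def pathNoise (p : Params) (Λ : ℝ) (s₀ : State) (e : ℕ → Event) (τ : ℕ → ℝ) (c : Event × Bool)
    (n : ℕ) : ℝ :=
  ∑ i ∈ Finset.range n, (mark c (stateAfter p s₀ e i) (e i)
    - markRate p Λ c (stateAfter p s₀ e i) * τ i)

lemma nextState_bounds {p : Params} (hp : p.Admissible) (s : State) (a : Event) :
    (nextState p s a).X ≤ s.X + p.γ ∧ |(nextState p s a).Y| ≤ |s.Y| + 1 ∧
      (nextState p s a).Z ≤ s.Z + 1 := by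
  have hγ : 1 ≤ p.γ := hp.γ_pos
  cases a <;> simp only [nextState]
  · refine ⟨le_rfl, by grind, by grind⟩
  · refine ⟨by omega, by grind, by grind⟩
  · refine ⟨?_, by omega, by omega⟩
    split_ifs with h1 h2
    · have : (-1 : ℤ) ≤ Int.sign s.Y := by
        rcases lt_trichotomy s.Y 0 with h | h | h
        · rw [Int.sign_eq_neg_one_of_neg h]
        · rw [h]; simp
        · rw [Int.sign_eq_one_of_pos h]; norm_num
      omega
    · omega
    · omega
  · refine ⟨by omega, by grind, by grind⟩
  · refine ⟨by omega, by omega, by omega⟩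

lemma stateAfter_bounds {p : Params} (hp : p.Admissible) (s₀ : State) (e : ℕ → Event) (k : ℕ) :
    (stateAfter p s₀ e k).X ≤ s₀.X + p.γ * k ∧ |(stateAfter p s₀ e k).Y| ≤ |s₀.Y| + k ∧
      (stateAfter p s₀ e k).Z ≤ s₀.Z + k := by
  induction k with
  | zero => simp [stateAfter]
  | succ k ih =>
    have h := nextState_bounds hp (stateAfter p s₀ e k) (e k)
    simp only [stateAfter]
    refine ⟨?_, ?_, ?_⟩
    · have := h.1.trans (Nat.add_le_add_right ih.1 _)
      rw [Nat.mul_succ]; omega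
    · push_cast; linarith [h.2.1, ih.2.1]
    · omega

/-- A bound for the total rate after `k` events. -/
lemma totalRate_stateAfter_le {p : Params} (hp : p.Admissible) {Λ : ℝ} (s₀ : State)
    (e : ℕ → Event) (k : ℕ) : totalRate p Λ (stateAfter p s₀ e k) ≤
      (Λ + p.β * s₀.X + p.ε * |(s₀.Y : ℝ)| + p.μ * s₀.Z) + (p.β * p.γ + p.ε + p.μ) * k := by
  obtain ⟨h1, h2, h3⟩ := stateAfter_bounds hp s₀ e k
  generalize stateAfter p s₀ e k = s at *
  have h1' : (s.X : ℝ) ≤ s₀.X + p.γ * k := by exact_mod_cast h1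
  have h2' : |(s.Y : ℝ)| ≤ |(s₀.Y : ℝ)| + k := by exact_mod_cast h2
  have h3' : (s.Z : ℝ) ≤ s₀.Z + k := by exact_mod_cast h3
  have := mul_le_mul_of_nonneg_left h1' hp.β_pos.le
  have := mul_le_mul_of_nonneg_left h2' hp.ε_pos.le
  have := mul_le_mul_of_nonneg_left h3' hp.μ_pos.le
  simp only [totalRate, eventRate]
  linarith

/-! ### The space of driving noises -/

/-- The law of the sequence of random numbers driving all steps. -/
def pathLaw : Measure (ℕ → ℝ × ℝ) := Measure.infinitePi (fun _ => stepLaw)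

instance : IsProbabilityMeasure pathLaw := by unfold pathLaw; infer_instance

/-- The state after `k` steps driven by `ω`. -/
def drivenState (p : Params) (Λ : ℝ) (s₀ : State) (ω : ℕ → ℝ × ℝ) : ℕ → State
  | 0 => s₀
  | k + 1 => nextState p (drivenState p Λ s₀ ω k) (stepEvent p Λ (drivenState p Λ s₀ ω k) (ω k))

/-- The kind of the `k`-th event driven by `ω`. -/
def drivenEvent (p : Params) (Λ : ℝ) (s₀ : State) (k : ℕ) (ω : ℕ → ℝ × ℝ) : Event :=
  stepEvent p Λ (drivenState p Λ s₀ ω k) (ω k)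

/-- The `k`-th holding time driven by `ω`. -/
def drivenTime (p : Params) (Λ : ℝ) (s₀ : State) (k : ℕ) (ω : ℕ → ℝ × ℝ) : ℝ :=
  stepTime p Λ (drivenState p Λ s₀ ω k) (ω k)

lemma stateAfter_drivenEvent (p : Params) (Λ : ℝ) (s₀ : State) (ω : ℕ → ℝ × ℝ) (k : ℕ) :
    stateAfter p s₀ (fun i => drivenEvent p Λ s₀ i ω) k = drivenState p Λ s₀ ω k := by
  induction k with
  | zero => rfl
  | succ k ih =>
    simp only [stateAfter, drivenState, ih]
    rfl

/-- Adaptedness: resampling coordinate `k` leaves the state before that step unchanged. It replaces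
conditioning on the past. -/
lemma drivenState_congr (p : Params) (Λ : ℝ) (s₀ : State) {ω ω' : ℕ → ℝ × ℝ} {k : ℕ}
    (h : ∀ i < k, ω i = ω' i) : drivenState p Λ s₀ ω k = drivenState p Λ s₀ ω' k := by
  induction k with
  | zero => rfl
  | succ k ih =>
    simp only [drivenState, ih (fun i hi => h i (hi.trans (Nat.lt_succ_self k))),
      h k (Nat.lt_succ_self k)]

lemma Measurable.comp_countable_left {Ω A B C : Type*} [MeasurableSpace Ω] [MeasurableSpace A]
    [Countable A] [MeasurableSingletonClass A] [MeasurableSpace B] [MeasurableSpace C]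
    {F : A → B → C} (hF : ∀ a, Measurable (F a)) {f : Ω → A} {g : Ω → B} (hf : Measurable f)
    (hg : Measurable g) : Measurable (fun ω => F (f ω) (g ω)) :=
  (measurable_from_prod_countable_right (f := fun z : A × B => F z.1 z.2) hF).comp (hf.prodMk hg)

lemma measurable_drivenState (p : Params) (Λ : ℝ) (s₀ : State) (k : ℕ) :
    Measurable (fun ω => drivenState p Λ s₀ ω k) := by
  induction k with
  | zero => exact measurable_const
  | succ k ih =>
    exact Measurable.comp_countable_left (F := fun s x => nextState p s (stepEvent p Λ s x))
      (fun s => (measurable_of_countable (nextState p s)).comp (measurable_stepEvent p Λ s)) ih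
      (measurable_pi_apply k)

lemma measurable_drivenEvent (p : Params) (Λ : ℝ) (s₀ : State) (k : ℕ) :
    Measurable (drivenEvent p Λ s₀ k) :=
  Measurable.comp_countable_left (measurable_stepEvent p Λ) (measurable_drivenState p Λ s₀ k)
    (measurable_pi_apply k)

lemma measurable_drivenTime (p : Params) (Λ : ℝ) (s₀ : State) (k : ℕ) :
    Measurable (drivenTime p Λ s₀ k) :=
  Measurable.comp_countable_left (measurable_stepTime p Λ) (measurable_drivenState p Λ s₀ k)
    (measurable_pi_apply k)

lemma pathLaw_event_time {p : Params} (hp : p.Admissible) {Λ : ℝ} (hΛ : 0 < Λ) (s₀ : State)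
    (n : ℕ) (a : ℕ → Event) (u : ℕ → ℝ) (hu : ∀ k, 0 ≤ u k) :
    pathLaw {ω | ∀ k < n, drivenEvent p Λ s₀ k ω = a k ∧ u k < drivenTime p Λ s₀ k ω} =
      ENNReal.ofReal (∏ k ∈ Finset.range n,
        (eventRate p Λ (stateAfter p s₀ a k) (a k) / totalRate p Λ (stateAfter p s₀ a k) *
          Real.exp (-(totalRate p Λ (stateAfter p s₀ a k) * u k)))) := by
  -- Once the earlier events are prescribed the state is deterministic, so each condition constrains
  -- a single coordinate by a fixed set and the event is a cylinder.
  have hset : {ω | ∀ k < n, drivenEvent p Λ s₀ k ω = a k ∧ u k < drivenTime p Λ s₀ k ω} =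
      Set.pi (Finset.range n : Set ℕ) (fun k => {x | stepEvent p Λ (stateAfter p s₀ a k) x = a k ∧
        u k < stepTime p Λ (stateAfter p s₀ a k) x}) := by
    ext ω
    simp only [mem_ofPred_eq, Set.mem_pi, Finset.coe_range, mem_Iio]
    have key : ∀ k, (∀ i < k, drivenEvent p Λ s₀ i ω = a i) →
        drivenState p Λ s₀ ω k = stateAfter p s₀ a k := by
      intro k
      induction k with
      | zero => intro _; rfl
      | succ k ih =>
        intro h
        have h1 := ih (fun i hi => h i (by omega))
        have h2 := h k (by omega)
        simp only [drivenEvent, h1] at h2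
        simp only [drivenState, stateAfter, h1, h2]
    constructor
    · intro h k hk
      have hk' := key k (fun i hi => (h i (hi.trans hk)).1)
      have := h k hk
      simpa only [drivenEvent, drivenTime, hk'] using this
    · intro h k
      induction k using Nat.strong_induction_on with
      | _ k ih =>
        intro hk
        have hk' := key k (fun i hi => (ih i hi (hi.trans hk)).1)
        have := h k hk
        simpa only [drivenEvent, drivenTime, hk'] using this
  rw [hset, pathLaw, Measure.infinitePi_pi]
  · rw [ENNReal.ofReal_prod_of_nonneg]
    · exact Finset.prod_congr rfl fun k _ => stepLaw_event_time hp hΛ _ _ (hu k)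
    · intro k _
      exact mul_nonneg (div_nonneg (eventRate_nonneg hp hΛ _ _) (totalRate_pos hp hΛ _).le)
        (Real.exp_pos _).le
  · intro k _
    exact ((measurable_stepEvent p Λ _) (measurableSet_singleton (a k))).inter
      (measurableSet_lt measurable_const (measurable_stepTime p Λ _))

/-- Resampling one coordinate does not change the law. -/
lemma measurePreserving_update (k : ℕ) :
    MeasurePreserving (fun z : (ℕ → ℝ × ℝ) × (ℝ × ℝ) => Function.update z.1 k z.2)
      (pathLaw.prod stepLaw) pathLaw := by
  have hm : Measurable (fun z : (ℕ → ℝ × ℝ) × (ℝ × ℝ) => Function.update z.1 k z.2) := by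
    rw [measurable_pi_iff]
    intro i
    by_cases h : i = k
    · subst h; simpa using measurable_snd
    · simp only [Function.update_of_ne h]
      exact (measurable_pi_apply i).comp measurable_fst
  refine ⟨hm, ?_⟩
  refine Measure.eq_infinitePi _ fun s t ht => ?_
  have hs : MeasurableSet (Set.pi (s : Set ℕ) t) := MeasurableSet.pi s.countable_toSet fun i _ => ht i
  rw [Measure.map_apply hm hs]
  by_cases hk : k ∈ s
  · have : (fun z : (ℕ → ℝ × ℝ) × (ℝ × ℝ) => Function.update z.1 k z.2) ⁻¹' (Set.pi (s : Set ℕ) t)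
        = (Set.pi ((s.erase k : Finset ℕ) : Set ℕ) t) ×ˢ t k := by
      ext z
      simp only [mem_preimage, Set.mem_pi, mem_prod, Finset.mem_coe, Finset.mem_erase]
      constructor
      · intro h
        refine ⟨fun i hi => ?_, ?_⟩
        · simpa [Function.update_of_ne hi.1] using h i hi.2
        · simpa using h k hk
      · rintro ⟨h1, h2⟩ i hi
        by_cases hik : i = k
        · subst hik; simpa using h2
        · simpa [Function.update_of_ne hik] using h1 i ⟨hik, hi⟩
    rw [this, Measure.prod_prod, pathLaw, Measure.infinitePi_pi _ (fun i _ => ht i),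
      Finset.prod_erase_mul s (fun i => stepLaw (t i)) hk]
  · have : (fun z : (ℕ → ℝ × ℝ) × (ℝ × ℝ) => Function.update z.1 k z.2) ⁻¹' (Set.pi (s : Set ℕ) t)
        = (Set.pi (s : Set ℕ) t) ×ˢ univ := by
      ext z
      simp only [mem_preimage, Set.mem_pi, mem_prod, Finset.mem_coe, mem_univ, and_true]
      refine forall₂_congr fun i hi => ?_
      have : i ≠ k := fun h => hk (h ▸ hi)
      simp [Function.update_of_ne this]
    rw [this, Measure.prod_prod, pathLaw, Measure.infinitePi_pi _ (fun i _ => ht i)]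
    simp

/-- Integrating out one coordinate. -/
lemma lintegral_pathLaw_le (k : ℕ) {H H' : (ℕ → ℝ × ℝ) → ENNReal} (hH : Measurable H)
    (h : ∀ ω, ∫⁻ x, H (Function.update ω k x) ∂stepLaw ≤ H' ω) :
    ∫⁻ ω, H ω ∂pathLaw ≤ ∫⁻ ω, H' ω ∂pathLaw := by
  have hmp := measurePreserving_update k
  rw [← hmp.lintegral_comp hH, lintegral_prod (fun z => H (Function.update z.1 k z.2))
    (hH.comp hmp.measurable).aemeasurable]
  exact lintegral_mono h

/-- The compensated number of events with mark `c` among the first `n` events driven by `ω`. -/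
def drivenNoise (p : Params) (Λ : ℝ) (s₀ : State) (c : Event × Bool) (n : ℕ) (ω : ℕ → ℝ × ℝ) : ℝ :=
  ∑ i ∈ Finset.range n, noiseIncr p Λ c (drivenState p Λ s₀ ω i) (ω i)

lemma drivenNoise_eq (p : Params) (Λ : ℝ) (s₀ : State) (c : Event × Bool) (n : ℕ)
    (ω : ℕ → ℝ × ℝ) : drivenNoise p Λ s₀ c n ω =
      pathNoise p Λ s₀ (fun k => drivenEvent p Λ s₀ k ω) (fun k => drivenTime p Λ s₀ k ω) c n := by
  simp only [drivenNoise, pathNoise, stateAfter_drivenEvent]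
  rfl

lemma measurable_drivenNoise (p : Params) (Λ : ℝ) (s₀ : State) (c : Event × Bool) (n : ℕ) :
    Measurable (drivenNoise p Λ s₀ c n) :=
  Finset.measurable_fun_sum _ fun i _ => Measurable.comp_countable_left (measurable_noiseIncr p Λ c)
    (measurable_drivenState p Λ s₀ i) (measurable_pi_apply i)

lemma drivenNoise_update_succ (p : Params) (Λ : ℝ) (s₀ : State) (c : Event × Bool) (n : ℕ)
    (ω : ℕ → ℝ × ℝ) (x : ℝ × ℝ) : drivenNoise p Λ s₀ c (n + 1) (Function.update ω n x) =
      drivenNoise p Λ s₀ c n ω + noiseIncr p Λ c (drivenState p Λ s₀ ω n) x := by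
  have h : ∀ i ≤ n, drivenState p Λ s₀ (Function.update ω n x) i = drivenState p Λ s₀ ω i :=
    fun i hi => drivenState_congr p Λ s₀ fun j hj => Function.update_of_ne (by omega) _ _
  rw [drivenNoise, Finset.sum_range_succ, h n le_rfl, Function.update_self, drivenNoise]
  congr 1
  refine Finset.sum_congr rfl fun i hi => ?_
  have hi := Finset.mem_range.1 hi
  rw [h i hi.le, Function.update_of_ne hi.ne]

/-- Orthogonality of martingale increments: integrating out the last coordinate adds at most 6 to
the second moment. -/
lemma lintegral_drivenNoise_sq_le {p : Params} (hp : p.Admissible) {Λ : ℝ} (hΛ : 0 < Λ)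
    (s₀ : State) (c : Event × Bool) (n : ℕ) :
    ∫⁻ ω, ENNReal.ofReal (drivenNoise p Λ s₀ c n ω ^ 2) ∂pathLaw ≤ 6 * n := by
  induction n with
  | zero => simp [drivenNoise]
  | succ n ih =>
    refine (lintegral_pathLaw_le n (H' := fun ω => ENNReal.ofReal (drivenNoise p Λ s₀ c n ω ^ 2) + 6)
      ((measurable_drivenNoise p Λ s₀ c (n+1)).pow_const 2).ennreal_ofReal fun ω => ?_).trans ?_
    · simp only [drivenNoise_update_succ]
      exact lintegral_add_noiseIncr_sq_le hp hΛ c _ _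
    · rw [lintegral_add_right _ measurable_const, lintegral_const, measure_univ, mul_one]
      push_cast
      rw [mul_add, mul_one]
      gcongr

lemma pathLaw_drivenNoise_le {p : Params} (hp : p.Admissible) {Λ : ℝ} (hΛ : 0 < Λ)
    (s₀ : State) (c : Event × Bool) (n : ℕ) {d : ℝ} (hd : 0 < d) :
    pathLaw {ω | d < |drivenNoise p Λ s₀ c n ω|} ≤ ENNReal.ofReal (6 * n / d ^ 2) := by
  have hm : Measurable fun ω => ENNReal.ofReal (drivenNoise p Λ s₀ c n ω ^ 2) :=
    ((measurable_drivenNoise p Λ s₀ c n).pow_const 2).ennreal_ofReal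
  have h := meas_ge_le_lintegral_div (μ := pathLaw) hm.aemeasurable
    (ε := ENNReal.ofReal (d ^ 2)) (by simp; positivity) (by simp)
  refine (measure_mono ?_).trans (h.trans ((ENNReal.div_le_div_right
    (lintegral_drivenNoise_sq_le hp hΛ s₀ c n) _).trans (le_of_eq ?_)))
  · intro ω hω
    apply ENNReal.ofReal_le_ofReal
    rw [← sq_abs (drivenNoise p Λ s₀ c n ω)]
    have : d < |drivenNoise p Λ s₀ c n ω| := hω
    gcongr
  · rw [ENNReal.ofReal_div_of_pos (by positivity), ENNReal.ofReal_mul (by norm_num)]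
    simp

/-! ### No explosion -/

/-- For total rate `R` the left side equals `R / (R + 1) = 1 - 1 / (R + 1)`, and `1 - z ≤ exp (-z)`.
-/
lemma lintegral_exp_neg_stepTime {p : Params} (hp : p.Admissible) {Λ : ℝ} (hΛ : 0 < Λ) (s : State) :
    ∫⁻ x, ENNReal.ofReal (Real.exp (-stepTime p Λ s x)) ∂stepLaw ≤
      ENNReal.ofReal (Real.exp (-(1 / (totalRate p Λ s + 1)))) := by
  have hR := totalRate_pos hp hΛ s
  set R := totalRate p Λ s with hRdef
  have h0 : ∫⁻ x, ENNReal.ofReal (Real.exp (-stepTime p Λ s x)) ∂stepLaw =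
      ∫⁻ y, ENNReal.ofReal (Real.exp (-(y / R))) ∂(ProbabilityTheory.expMeasure 1) :=
    measurePreserving_snd_stepLaw.lintegral_comp
      (f := fun y => ENNReal.ofReal (Real.exp (-(y / R)))) (by fun_prop)
  have ha : -(1 + 1 / R) < 0 := by
    have : 0 < 1 / R := by positivity
    linarith
  have e : ∀ y : ℝ, Real.exp (-y) * Real.exp (-(y / R)) = Real.exp (-(1 + 1 / R) * y) := by
    intro y
    rw [← Real.exp_add]
    congr 1
    ring
  have hint : Integrable (fun y => Real.exp (-(y / R))) (ProbabilityTheory.expMeasure 1) := by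
    rw [integrable_expMeasure_one]
    simp only [e]
    exact integrableOn_exp_mul_Ioi ha 0
  rw [h0, ← ofReal_integral_eq_lintegral_ofReal hint (ae_of_all _ fun y => (Real.exp_pos _).le),
    integral_expMeasure_one]
  simp only [e]
  rw [integral_exp_mul_Ioi ha]
  apply ENNReal.ofReal_le_ofReal
  have h2 : -Real.exp (-(1 + 1 / R) * 0) / -(1 + 1 / R) = 1 - 1 / (R + 1) := by
    rw [mul_zero, Real.exp_zero]
    field_simp
    ring
  rw [h2]
  linarith [Real.add_one_le_exp (-(1 / (R + 1)))]

/-- The time of the `n`-th event driven by `ω`. -/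
def drivenJumpTime (p : Params) (Λ : ℝ) (s₀ : State) (n : ℕ) (ω : ℕ → ℝ × ℝ) : ℝ :=
  ∑ k ∈ Finset.range n, drivenTime p Λ s₀ k ω

lemma measurable_drivenJumpTime (p : Params) (Λ : ℝ) (s₀ : State) (n : ℕ) :
    Measurable (drivenJumpTime p Λ s₀ n) :=
  Finset.measurable_fun_sum _ fun i _ => measurable_drivenTime p Λ s₀ i

lemma drivenJumpTime_update_succ (p : Params) (Λ : ℝ) (s₀ : State) (n : ℕ)
    (ω : ℕ → ℝ × ℝ) (x : ℝ × ℝ) : drivenJumpTime p Λ s₀ (n + 1) (Function.update ω n x) =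
      drivenJumpTime p Λ s₀ n ω + stepTime p Λ (drivenState p Λ s₀ ω n) x := by
  have h : ∀ i ≤ n, drivenState p Λ s₀ (Function.update ω n x) i = drivenState p Λ s₀ ω i :=
    fun i hi => drivenState_congr p Λ s₀ fun j hj => Function.update_of_ne (by omega) _ _
  simp only [drivenJumpTime, drivenTime]
  rw [Finset.sum_range_succ, h n le_rfl, Function.update_self]
  congr 1
  refine Finset.sum_congr rfl fun i hi => ?_
  have hi := Finset.mem_range.1 hi
  rw [h i hi.le, Function.update_of_ne hi.ne]

/-- Every event changes the state by a bounded amount, so rates grow at most linearly with the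
number of events. The added 1 matches the `R + 1` in `lintegral_exp_neg_stepTime`. -/
lemma exists_totalRate_drivenState_le {p : Params} (hp : p.Admissible) {Λ : ℝ}
    (s₀ : State) : ∃ C : ℝ, 0 < C ∧ ∀ ω k, totalRate p Λ (drivenState p Λ s₀ ω k) + 1 ≤ C * (k + 1) := by
  have := hp.β_pos
  have := hp.ε_pos
  have := hp.μ_pos
  refine ⟨1 + |Λ + p.β * s₀.X + p.ε * |(s₀.Y : ℝ)| + p.μ * s₀.Z| + (p.β * p.γ + p.ε + p.μ),
    by positivity, fun ω k => ?_⟩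
  rw [← stateAfter_drivenEvent]
  refine (add_le_add_left (totalRate_stateAfter_le hp s₀ _ k) 1).trans ?_
  have h1 := le_abs_self (Λ + p.β * s₀.X + p.ε * |(s₀.Y : ℝ)| + p.μ * s₀.Z)
  generalize Λ + p.β * s₀.X + p.ε * |(s₀.Y : ℝ)| + p.μ * s₀.Z = A at *
  have h2 : 0 ≤ |A| * k := by positivity
  have h3 : 0 ≤ p.β * p.γ + p.ε + p.μ := by positivity
  have h4 : (0:ℝ) ≤ k := by positivity
  nlinarith

lemma lintegral_exp_neg_drivenJumpTime {p : Params} (hp : p.Admissible) {Λ : ℝ} (hΛ : 0 < Λ)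
    (s₀ : State) {C : ℝ}
    (hC : ∀ ω k, totalRate p Λ (drivenState p Λ s₀ ω k) + 1 ≤ C * (k + 1)) (n : ℕ) :
    ∫⁻ ω, ENNReal.ofReal (Real.exp (-drivenJumpTime p Λ s₀ n ω)) ∂pathLaw ≤
      ENNReal.ofReal (Real.exp (-(1 / C * ∑ k ∈ Finset.range n, 1 / ((k:ℝ) + 1)))) := by
  have hm : ∀ n, Measurable fun ω => ENNReal.ofReal (Real.exp (-drivenJumpTime p Λ s₀ n ω)) :=
    fun n => (measurable_drivenJumpTime p Λ s₀ n).neg.exp.ennreal_ofReal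
  induction n with
  | zero => simp [drivenJumpTime]
  | succ n ih =>
    set q := ENNReal.ofReal (Real.exp (-(1 / C * (1 / ((n:ℝ) + 1))))) with hq
    refine (lintegral_pathLaw_le n
      (H' := fun ω => ENNReal.ofReal (Real.exp (-drivenJumpTime p Λ s₀ n ω)) * q)
      (hm (n + 1)) fun ω => ?_).trans ?_
    · simp only [drivenJumpTime_update_succ, neg_add, Real.exp_add,
        ENNReal.ofReal_mul (Real.exp_pos _).le]
      have hm' : Measurable fun x => ENNReal.ofReal
          (Real.exp (-stepTime p Λ (drivenState p Λ s₀ ω n) x)) :=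
        (measurable_stepTime p Λ _).neg.exp.ennreal_ofReal
      rw [lintegral_const_mul _ hm']
      refine mul_le_mul_right ((lintegral_exp_neg_stepTime hp hΛ _).trans ?_) _
      apply ENNReal.ofReal_le_ofReal
      apply Real.exp_le_exp.2
      rw [neg_le_neg_iff, one_div_mul_one_div]
      exact one_div_le_one_div_of_le (by linarith [totalRate_pos hp hΛ (drivenState p Λ s₀ ω n)])
        (hC ω n)
    · rw [lintegral_mul_const _ (hm n)]
      refine (mul_le_mul_left ih q).trans (le_of_eq ?_)
      rw [hq, ← ENNReal.ofReal_mul (Real.exp_pos _).le, ← Real.exp_add, Finset.sum_range_succ]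
      congr 2
      ring

lemma drivenTime_pos {p : Params} (hp : p.Admissible) {Λ : ℝ} (hΛ : 0 < Λ) (s₀ : State) :
    ∀ᵐ ω ∂pathLaw, ∀ k, 0 < drivenTime p Λ s₀ k ω := by
  rw [ae_all_iff]
  intro k
  have := (measurePreserving_eval_infinitePi (fun _ : ℕ => stepLaw) k).quasiMeasurePreserving.ae
    stepLaw_snd_pos
  filter_upwards [this] with ω hω
  exact div_pos hω (totalRate_pos hp hΛ _)

/-- The mean of `exp (-drivenJumpTime)` is at most the exponential of minus a multiple of the
harmonic sum, hence tends to zero. By Markov's inequality the jump times are almost surely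
unbounded, and they increase. -/
lemma drivenJumpTime_tendsto {p : Params} (hp : p.Admissible) {Λ : ℝ} (hΛ : 0 < Λ) (s₀ : State) :
    ∀ᵐ ω ∂pathLaw, Tendsto (fun n => drivenJumpTime p Λ s₀ n ω) atTop atTop := by
  obtain ⟨C, hC0, hC⟩ := exists_totalRate_drivenState_le hp (Λ := Λ) s₀
  have hlim : Tendsto (fun n => ENNReal.ofReal
      (Real.exp (-(1 / C * ∑ k ∈ Finset.range n, 1 / ((k:ℝ) + 1))))) atTop (𝓝 0) := by
    rw [← ENNReal.ofReal_zero]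
    refine ENNReal.tendsto_ofReal (Real.tendsto_exp_neg_atTop_nhds_zero.comp ?_)
    exact Real.tendsto_sum_range_one_div_nat_succ_atTop.const_mul_atTop (by positivity)
  have hbdd : ∀ᵐ ω ∂pathLaw, ∀ m : ℕ, ∃ n, (m:ℝ) < drivenJumpTime p Λ s₀ n ω := by
    rw [ae_all_iff]
    intro m
    rw [ae_iff]
    have hle : ∀ n, pathLaw {ω | ¬ ∃ n, (m:ℝ) < drivenJumpTime p Λ s₀ n ω} ≤
        ENNReal.ofReal (Real.exp (-(1 / C * ∑ k ∈ Finset.range n, 1 / ((k:ℝ) + 1)))) /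
          ENNReal.ofReal (Real.exp (-m)) := by
      intro n
      refine (measure_mono ?_).trans ((meas_ge_le_lintegral_div (μ := pathLaw)
        ((measurable_drivenJumpTime p Λ s₀ n).neg.exp).ennreal_ofReal.aemeasurable
        (ε := ENNReal.ofReal (Real.exp (-m))) (by simp [Real.exp_pos]) (by simp)).trans
        (ENNReal.div_le_div_right (lintegral_exp_neg_drivenJumpTime hp hΛ s₀ hC n) _))
      intro ω hω
      have : ∀ n, drivenJumpTime p Λ s₀ n ω ≤ m := by simpa using hω
      apply ENNReal.ofReal_le_ofReal
      exact Real.exp_le_exp.2 (neg_le_neg (this n))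
    have := ENNReal.Tendsto.div_const hlim (b := ENNReal.ofReal (Real.exp (-m)))
      (Or.inr (by simp [Real.exp_pos]))
    rw [ENNReal.zero_div] at this
    exact le_antisymm (ge_of_tendsto' this hle) (zero_le)
  filter_upwards [hbdd, drivenTime_pos hp hΛ s₀] with ω h1 h2
  refine tendsto_atTop_atTop_of_monotone ?_ ?_
  · exact monotone_nat_of_le_succ fun n => by
      simp only [drivenJumpTime, Finset.sum_range_succ]
      linarith [h2 n]
  · intro b
    obtain ⟨m, hm⟩ := exists_nat_ge b
    obtain ⟨n, hn⟩ := h1 m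
    exact ⟨n, by linarith⟩

/-! ### The process driven by the noise -/

/-- The state at time `t` of the process driven by `ω`. -/
def drivenProcess (p : Params) (Λ : ℝ) (s₀ : State) (t : ℝ) (ω : ℕ → ℝ × ℝ) : State :=
  drivenState p Λ s₀ ω (sInf {n | t < drivenJumpTime p Λ s₀ (n + 1) ω})

lemma measurable_drivenProcess (p : Params) (Λ : ℝ) (s₀ : State) (t : ℝ) :
    Measurable (drivenProcess p Λ s₀ t) := by
  have hlt : ∀ n, MeasurableSet {ω | t < drivenJumpTime p Λ s₀ n ω} := fun n =>
    measurableSet_lt measurable_const (measurable_drivenJumpTime p Λ s₀ n)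
  have hidx : Measurable fun ω => sInf {n | t < drivenJumpTime p Λ s₀ (n + 1) ω} := by
    refine measurable_to_countable' fun n => ?_
    have : (fun ω => sInf {n | t < drivenJumpTime p Λ s₀ (n + 1) ω}) ⁻¹' {n} =
        ({ω | t < drivenJumpTime p Λ s₀ (n + 1) ω} ∩
          ⋂ m ∈ Finset.range n, {ω | t < drivenJumpTime p Λ s₀ (m + 1) ω}ᶜ) ∪
        -- Since `sInf ∅ = 0`, the samples whose jump times never exceed `t` are assigned the index
        -- 0.
        (if n = 0 then ⋂ m : ℕ, {ω | t < drivenJumpTime p Λ s₀ (m + 1) ω}ᶜ else ∅) := by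
      ext ω
      simp only [mem_preimage, mem_singleton_iff, mem_union, mem_inter_iff, mem_ofPred_eq,
        mem_iInter, Finset.mem_range, mem_compl_iff]
      by_cases hne : {n | t < drivenJumpTime p Λ s₀ (n + 1) ω}.Nonempty
      · constructor
        · rintro rfl
          exact Or.inl ⟨Nat.sInf_mem hne, fun m hm => Nat.notMem_of_lt_sInf hm⟩
        · rintro (⟨h1, h2⟩ | h)
          · refine le_antisymm (Nat.sInf_le h1) ?_
            by_contra hlt
            exact h2 _ (not_le.1 hlt) (Nat.sInf_mem hne)
          · obtain ⟨k, hk⟩ := hne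
            split_ifs at h with h0
            · simp only [mem_iInter] at h
              exact absurd hk (h k)
            · exact absurd h (notMem_empty _)
      · rw [not_nonempty_iff_eq_empty] at hne
        have hall : ∀ m, ¬ t < drivenJumpTime p Λ s₀ (m + 1) ω := fun m hm => by
          have : m ∈ {n | t < drivenJumpTime p Λ s₀ (n + 1) ω} := hm
          rw [hne] at this
          exact this
        rw [hne, Nat.sInf_empty]
        by_cases h0 : n = 0
        · subst h0
          simp [hall]
        · simp [h0, hall, Ne.symm h0]
    rw [this]
    refine ((hlt _).inter (MeasurableSet.biInter (Finset.countable_toSet _) fun m _ =>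
      (hlt _).compl)).union ?_
    split_ifs
    · exact MeasurableSet.iInter fun m => (hlt _).compl
    · exact MeasurableSet.empty
  exact Measurable.comp_countable_left (F := fun k ω => drivenState p Λ s₀ ω k)
    (fun k => measurable_drivenState p Λ s₀ k) hidx measurable_id

lemma isPath_drivenProcess {p : Params} (hp : p.Admissible) {Λ : ℝ} (hΛ : 0 < Λ) (s₀ : State) :
    ∀ᵐ ω ∂pathLaw, IsPath p Λ s₀ (fun k => drivenEvent p Λ s₀ k ω)
      (fun k => drivenTime p Λ s₀ k ω) (fun t => drivenProcess p Λ s₀ t ω) := by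
  filter_upwards [drivenTime_pos hp hΛ s₀, drivenJumpTime_tendsto hp hΛ s₀] with ω h1 h2
  refine ⟨h1, fun k => ?_, h2, fun n t hn ht => ?_⟩
  · rw [stateAfter_drivenEvent]
    exact eventRate_selectEvent_pos hΛ _ _
  · rw [stateAfter_drivenEvent, drivenProcess]
    congr 1
    have hmono : Monotone fun n => drivenJumpTime p Λ s₀ n ω :=
      monotone_nat_of_le_succ fun n => by
        simp only [drivenJumpTime, Finset.sum_range_succ]
        linarith [h1 n]
    refine le_antisymm (Nat.sInf_le ht) ?_
    refine le_csInf ⟨n, ht⟩ fun m hm => ?_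
    by_contra hlt
    have h3 : drivenJumpTime p Λ s₀ (m + 1) ω ≤ drivenJumpTime p Λ s₀ n ω :=
      hmono (by omega)
    have h4 : t < drivenJumpTime p Λ s₀ (m + 1) ω := hm
    have h5 : drivenJumpTime p Λ s₀ n ω ≤ t := hn
    linarith

lemma isInvitationProcess_comp {Ω : Type*} [MeasurableSpace Ω] {P : Measure Ω} {p : Params}
    (hp : p.Admissible) {Λ : ℝ} (hΛ : 0 < Λ) (s₀ : State) {θ : Ω → ℕ → ℝ × ℝ}
    (hθ : MeasurePreserving θ P pathLaw) :
    IsInvitationProcess P p Λ s₀ (fun t ω => drivenProcess p Λ s₀ t (θ ω)) := by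
  refine ⟨fun t => (measurable_drivenProcess p Λ s₀ t).comp hθ.measurable,
    fun k ω => drivenEvent p Λ s₀ k (θ ω), fun k ω => drivenTime p Λ s₀ k (θ ω),
    fun k => (measurable_drivenEvent p Λ s₀ k).comp hθ.measurable,
    fun k => (measurable_drivenTime p Λ s₀ k).comp hθ.measurable, fun n a u hu => ?_, ?_⟩
  · rw [← pathLaw_event_time hp hΛ s₀ n a u hu]
    refine hθ.measure_preimage (s := {ω | ∀ k < n, drivenEvent p Λ s₀ k ω = a k ∧
      u k < drivenTime p Λ s₀ k ω}) (MeasurableSet.nullMeasurableSet ?_)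
    have : {ω | ∀ k < n, drivenEvent p Λ s₀ k ω = a k ∧ u k < drivenTime p Λ s₀ k ω} =
        ⋂ k ∈ Finset.range n, {ω | drivenEvent p Λ s₀ k ω = a k ∧ u k < drivenTime p Λ s₀ k ω} := by
      ext ω; simp
    rw [this]
    exact MeasurableSet.biInter (Finset.countable_toSet _) fun k _ =>
      ((measurable_drivenEvent p Λ s₀ k) (measurableSet_singleton _)).inter
        (measurableSet_lt measurable_const (measurable_drivenTime p Λ s₀ k))
  · filter_upwards [hθ.quasiMeasurePreserving.ae (isPath_drivenProcess hp hΛ s₀)] with ω h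
    exact ⟨h.tendsto, h.eq⟩

/-! ### Coupling along a sequence of asymptotically null sets -/

/-- The conditional law given `B`, or the law itself if `B` is null. -/
def condOrSelf {X : Type*} [MeasurableSpace X] (Q : Measure X) (B : Set X) : Measure X :=
  open Classical in if Q B = 0 then Q else ProbabilityTheory.cond Q B

instance {X : Type*} [MeasurableSpace X] (Q : Measure X) [IsProbabilityMeasure Q] (B : Set X) :
    IsProbabilityMeasure (condOrSelf Q B) := by
  unfold condOrSelf
  split_ifs with h
  · infer_instance
  · exact ProbabilityTheory.cond_isProbabilityMeasure h

lemma mul_condOrSelf {X : Type*} [MeasurableSpace X] (Q : Measure X) [IsProbabilityMeasure Q]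
    {B : Set X} (hB : MeasurableSet B) (A : Set X) : Q B * condOrSelf Q B A = Q (B ∩ A) := by
  unfold condOrSelf
  split_ifs with h
  · rw [h, zero_mul, measure_mono_null inter_subset_left h]
  · rw [mul_comm, ProbabilityTheory.cond_mul_eq_inter hB]

lemma condOrSelf_mem {X : Type*} [MeasurableSpace X] (Q : Measure X) [IsProbabilityMeasure Q]
    {B : Set X} (hB : MeasurableSet B) (h : Q B ≠ 0) : ∀ᵐ x ∂(condOrSelf Q B), x ∈ B := by
  rw [condOrSelf, if_neg h]
  exact ProbabilityTheory.ae_cond_mem hB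

/-- If the probabilities of the sets `B n` tend to zero, there are variables with the given law
which almost surely belong to `B n` only finitely often. -/
theorem exists_coupling {X : Type} [MeasurableSpace X] (Q : Measure X) [IsProbabilityMeasure Q]
    (B : ℕ → Set X) (hB : ∀ n, MeasurableSet (B n)) (hlim : Tendsto (fun n => Q (B n)) atTop (𝓝 0)) :
    ∃ (Ω : Type) (_ : MeasurableSpace Ω) (P : Measure Ω) (θ : ℕ → Ω → X),
      IsProbabilityMeasure P ∧ (∀ n, MeasurePreserving (θ n) P Q) ∧
      ∀ᵐ ω ∂P, ∀ᶠ n in atTop, θ n ω ∉ B n := by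
  set Pb := Measure.infinitePi (fun n => condOrSelf Q (B n)) with hPb
  set Pg := Measure.infinitePi (fun n => condOrSelf Q (B n)ᶜ) with hPg
  -- One uniform variable serves all `n`: the sample comes from the law conditioned on `B n` exactly
  -- when the variable is below `Q (B n)`. Mixing the two conditional laws restores `Q`. As the
  -- variable is almost surely positive and `Q (B n)` tends to zero, the bad choice is eventually
  -- never made.
  set θ : ℕ → ℝ × (ℕ → X) × (ℕ → X) → X :=
    fun n ω => open Classical in if ω.1 < (Q (B n)).toReal then ω.2.1 n else ω.2.2 n with hθ
  have hθm : ∀ n, Measurable (θ n) := fun n =>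
    Measurable.ite (measurableSet_lt measurable_fst measurable_const)
      ((measurable_pi_apply n).comp (measurable_fst.comp measurable_snd))
      ((measurable_pi_apply n).comp (measurable_snd.comp measurable_snd))
  refine ⟨ℝ × (ℕ → X) × (ℕ → X), inferInstance, unifLaw.prod (Pb.prod Pg), θ, inferInstance,
    fun n => ⟨hθm n, ?_⟩, ?_⟩
  · ext A hA
    rw [Measure.map_apply (hθm n) hA]
    set q := (Q (B n)).toReal with hq
    have hq0 : 0 ≤ q := ENNReal.toReal_nonneg
    have hq1 : q ≤ 1 := by
      have := measureReal_le_one (μ := Q) (s := B n)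
      exact this
    have hset : θ n ⁻¹' A = (Iio q ×ˢ ((Function.eval n ⁻¹' A) ×ˢ univ)) ∪
        (Ici q ×ˢ (univ ×ˢ (Function.eval n ⁻¹' A))) := by
      ext ω
      simp only [hθ, mem_preimage, mem_union, mem_prod, mem_Iio, mem_Ici, mem_univ, and_true,
        true_and, Function.eval]
      by_cases h : ω.1 < q
      · simp [← hq, h, not_le.2 h]
      · simp [← hq, h, not_lt.1 h]
    have hdisj : Disjoint (Iio q ×ˢ ((Function.eval n ⁻¹' A) ×ˢ (univ : Set (ℕ → X))))
        (Ici q ×ˢ ((univ : Set (ℕ → X)) ×ˢ (Function.eval n ⁻¹' A))) := by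
      rw [Set.disjoint_left]
      rintro ω ⟨h1, -⟩ ⟨h2, -⟩
      exact absurd (mem_Ici.1 h2) (not_le.2 h1)
    have hev : MeasurableSet ((Function.eval n : (ℕ → X) → X) ⁻¹' A) := (measurable_pi_apply n) hA
    rw [hset, measure_union hdisj (measurableSet_Ici.prod (MeasurableSet.univ.prod hev)),
      Measure.prod_prod, Measure.prod_prod, Measure.prod_prod, Measure.prod_prod, measure_univ,
      measure_univ, mul_one, one_mul,
      (measurePreserving_eval_infinitePi _ n).measure_preimage hA.nullMeasurableSet,
      (measurePreserving_eval_infinitePi _ n).measure_preimage hA.nullMeasurableSet]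
    have h1 : unifLaw (Iio q) = Q (B n) := by
      rw [unifLaw, Measure.restrict_apply measurableSet_Iio]
      have : Iio q ∩ Ico 0 1 = Ico 0 q := by
        ext u; simp only [mem_inter_iff, mem_Iio, mem_Ico]
        constructor
        · rintro ⟨h1, h2, -⟩; exact ⟨h2, h1⟩
        · rintro ⟨h1, h2⟩; exact ⟨h2, h1, h2.trans_le hq1⟩
      rw [this, Real.volume_Ico, sub_zero, hq, ENNReal.ofReal_toReal (measure_ne_top _ _)]
    have h2 : unifLaw (Ici q) = Q (B n)ᶜ := by
      rw [← compl_Iio, measure_compl measurableSet_Iio (measure_ne_top _ _), h1,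
        measure_compl (hB n) (measure_ne_top _ _), measure_univ, measure_univ]
    rw [h1, h2, mul_condOrSelf Q (hB n), mul_condOrSelf Q (hB n).compl, inter_comm, inter_comm _ A,
      ← Set.sdiff_eq, measure_inter_add_sdiff A (hB n)]
  · have hu : ∀ᵐ u ∂unifLaw, 0 < u := by
      have h0 : ∀ᵐ u : ℝ ∂unifLaw, u ≠ 0 := by
        refine ae_restrict_of_ae ?_
        simp [ae_iff]
      have h1 : ∀ᵐ u : ℝ ∂unifLaw, u ∈ Ico (0:ℝ) 1 := ae_restrict_mem measurableSet_Ico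
      filter_upwards [h0, h1] with u h0 h1
      exact lt_of_le_of_ne h1.1 (Ne.symm h0)
    have hg : ∀ᵐ g ∂Pg, ∀ n, Q (B n)ᶜ ≠ 0 → g n ∈ (B n)ᶜ := by
      rw [ae_all_iff]
      intro n
      by_cases h : Q (B n)ᶜ = 0
      · exact ae_of_all _ fun g hg => absurd h hg
      · filter_upwards [(measurePreserving_eval_infinitePi (fun n => condOrSelf Q (B n)ᶜ)
          n).quasiMeasurePreserving.ae (condOrSelf_mem Q (hB n).compl h)] with g hg _
        exact hg
    have hmpu : MeasurePreserving (Prod.fst : ℝ × (ℕ → X) × (ℕ → X) → ℝ)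
        (unifLaw.prod (Pb.prod Pg)) unifLaw := measurePreserving_fst
    have hmpg : MeasurePreserving (fun ω : ℝ × (ℕ → X) × (ℕ → X) => ω.2.2)
        (unifLaw.prod (Pb.prod Pg)) Pg :=
      (measurePreserving_snd (μ := Pb) (ν := Pg)).comp measurePreserving_snd
    filter_upwards [hmpu.quasiMeasurePreserving.ae hu, hmpg.quasiMeasurePreserving.ae hg]
      with ω h1 h2
    -- The bound `1/2` keeps the complement of `B n` non-null, so that `condOrSelf` really is the
    -- conditional law there.
    have h3 : ∀ᶠ n in atTop, Q (B n) < ENNReal.ofReal (min ω.1 (1/2)) :=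
      hlim.eventually_lt_const (by simpa using h1)
    filter_upwards [h3] with n hn
    have hn1 : (Q (B n)).toReal < min ω.1 (1/2) := by
      rw [← ENNReal.toReal_ofReal (r := min ω.1 (1/2)) (le_min h1.le (by norm_num))]
      exact (ENNReal.toReal_lt_toReal (measure_ne_top _ _) ENNReal.ofReal_ne_top).2 hn
    have hn2 : ¬ ω.1 < (Q (B n)).toReal := not_lt.2 (hn1.le.trans (min_le_left _ _))
    have hn3 : Q (B n)ᶜ ≠ 0 := by
      intro h0
      have : Q (B n) = 1 := (prob_compl_eq_zero_iff (hB n)).1 h0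
      rw [this] at hn1
      have := hn1.trans_le (min_le_right _ _)
      norm_num at this
    simp only [hθ, if_neg hn2]
    exact h2 n hn3

/-! ### Control of the compensated counts -/

/-- The compensator only decreases the noise and a mark adds at most 1. This one-sided bound
suffices to interpolate between grid points, so no maximal inequality is needed. -/
lemma pathNoise_sub_le {p : Params} (hp : p.Admissible) {Λ : ℝ} (hΛ : 0 < Λ) (s₀ : State)
    (e : ℕ → Event) {τ : ℕ → ℝ} (hτ : ∀ k, 0 ≤ τ k) (c : Event × Bool) {k l : ℕ} (hkl : k ≤ l) :
    pathNoise p Λ s₀ e τ c l ≤ pathNoise p Λ s₀ e τ c k + ((l:ℝ) - k) := by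
  induction l, hkl using Nat.le_induction with
  | base => simp
  | succ l _ ih =>
    have h1 := mark_le_one c (stateAfter p s₀ e l) (e l)
    have h2 := mul_nonneg (markRate_nonneg hp hΛ c (stateAfter p s₀ e l)) (hτ l)
    rw [pathNoise, Finset.sum_range_succ, ← pathNoise]
    push_cast
    linarith

/-- Control of the noise on a grid gives control everywhere. -/
lemma abs_pathNoise_le_of_grid {p : Params} (hp : p.Admissible) {Λ : ℝ} (hΛ : 0 < Λ) (s₀ : State)
    (e : ℕ → Event) {τ : ℕ → ℝ} (hτ : ∀ k, 0 ≤ τ k) (c : Event × Bool) {r : ℝ} (hr : 0 < r)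
    {m : ℕ} (hm : 0 < m)
    (h : ∀ j < m ^ 2 + 2, |pathNoise p Λ s₀ e τ c ⌊(j:ℝ) * (r / m)⌋₊| ≤ r / m) {k : ℕ}
    (hk : (k:ℝ) ≤ m * r) : |pathNoise p Λ s₀ e τ c k| ≤ 2 * (r / m) + 1 := by
  have hm' : (0:ℝ) < m := by exact_mod_cast hm
  set d := r / m with hd
  have hd0 : 0 < d := by positivity
  -- The index `k` lies between the grid points of `j` and `j + 1`: the left one bounds the noise
  -- from above, the right one from below. As `k ≤ m * r = m ^ 2 * d`, both belong to the `m ^ 2 +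
  -- 2` grid points.
  set j := ⌊(k:ℝ) / d⌋₊ with hj
  have hj1 : (j:ℝ) ≤ k / d := Nat.floor_le (by positivity)
  have hj2 : (k:ℝ) / d < j + 1 := Nat.lt_floor_add_one _
  have hjm : j ≤ m ^ 2 := by
    have : (j:ℝ) ≤ (m:ℝ) ^ 2 := hj1.trans (by
      rw [div_le_iff₀ hd0, hd]
      calc (k:ℝ) ≤ m * r := hk
        _ = _ := by field_simp)
    exact_mod_cast this
  rw [le_div_iff₀ hd0] at hj1
  rw [div_lt_iff₀ hd0] at hj2
  have h1 := h j (by omega)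
  have h2 := h (j + 1) (by omega)
  have hlow : ⌊(j:ℝ) * d⌋₊ ≤ k := by
    have := Nat.floor_mono hj1
    rwa [Nat.floor_natCast] at this
  have hup : k ≤ ⌊((j+1:ℕ):ℝ) * d⌋₊ := Nat.le_floor (by push_cast; exact hj2.le)
  have hf1 : (j:ℝ) * d < ⌊(j:ℝ) * d⌋₊ + 1 := Nat.lt_floor_add_one _
  have hf2 : (⌊((j+1:ℕ):ℝ) * d⌋₊ : ℝ) ≤ ((j+1:ℕ):ℝ) * d := Nat.floor_le (by positivity)
  have h3 := pathNoise_sub_le hp hΛ s₀ e hτ c hlow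
  have h4 := pathNoise_sub_le hp hΛ s₀ e hτ c hup
  rw [abs_le] at h1 h2 ⊢
  push_cast at *
  constructor
  · linarith [h2.1]
  · linarith [h1.2]

/-- The event that the compensated counts are not small on a grid of mesh `r / m`. -/
def badSet (p : Params) (Λ : ℝ) (s₀ : State) (r : ℝ) (m : ℕ) : Set (ℕ → ℝ × ℝ) :=
  ⋃ z ∈ (Finset.univ : Finset (Event × Bool)) ×ˢ Finset.range (m ^ 2 + 2),
    {ω | r / m < |drivenNoise p Λ s₀ z.1 ⌊(z.2:ℝ) * (r / m)⌋₊ ω|}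

lemma measurableSet_badSet (p : Params) (Λ : ℝ) (s₀ : State) (r : ℝ) (m : ℕ) :
    MeasurableSet (badSet p Λ s₀ r m) := by
  refine MeasurableSet.biUnion (Finset.countable_toSet _) fun z _ => ?_
  have := measurable_drivenNoise p Λ s₀ z.1 ⌊(z.2:ℝ) * (r / m)⌋₊
  exact measurableSet_lt measurable_const (by simpa [Real.norm_eq_abs] using this.norm)

/-- A union bound over 10 marks and at most `3 * m ^ 2` grid points, each costing `12 / m ^ 5` by
Chebyshev's inequality and `m ^ 8 ≤ r`. -/
lemma pathLaw_badSet_le {p : Params} (hp : p.Admissible) {Λ : ℝ} (hΛ : 0 < Λ) (s₀ : State) {r : ℝ}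
    (hr : 0 < r) {m : ℕ} (hm : 0 < m) (hmr : (m:ℝ) ^ 8 ≤ r) :
    pathLaw (badSet p Λ s₀ r m) ≤ ENNReal.ofReal (360 / (m:ℝ) ^ 3) := by
  have hm1 : (1:ℝ) ≤ m := by exact_mod_cast hm
  have hm' : (0:ℝ) < m := by linarith
  have hd0 : 0 < r / m := by positivity
  have hcard : Fintype.card (Event × Bool) = 10 := by
    rw [Fintype.card_prod, Fintype.card_bool]; rfl
  have hterm : ∀ z ∈ (Finset.univ : Finset (Event × Bool)) ×ˢ Finset.range (m ^ 2 + 2),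
      pathLaw {ω | r / m < |drivenNoise p Λ s₀ z.1 ⌊(z.2:ℝ) * (r / m)⌋₊ ω|} ≤
        ENNReal.ofReal (12 / (m:ℝ) ^ 5) := by
    intro z hz
    simp only [Finset.mem_product, Finset.mem_univ, Finset.mem_range, true_and] at hz
    refine (pathLaw_drivenNoise_le hp hΛ s₀ z.1 _ hd0).trans (ENNReal.ofReal_le_ofReal ?_)
    have hf : (⌊(z.2:ℝ) * (r / m)⌋₊ : ℝ) ≤ z.2 * (r / m) := Nat.floor_le (by positivity)
    have hz' : (z.2:ℝ) ≤ m ^ 2 + 1 := by exact_mod_cast Nat.lt_succ_iff.1 hz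
    have hz2 : (z.2:ℝ) ≤ 2 * m ^ 2 := by nlinarith
    calc 6 * (⌊(z.2:ℝ) * (r / m)⌋₊ : ℝ) / (r / m) ^ 2
        ≤ 6 * (2 * m ^ 2 * (r / m)) / (r / m) ^ 2 := by
          gcongr
          exact hf.trans (by gcongr)
      _ = 12 * m ^ 3 / r := by field_simp; ring
      _ ≤ 12 * m ^ 3 / m ^ 8 := by gcongr
      _ = 12 / m ^ 5 := by field_simp
  refine (measure_biUnion_finset_le _ _).trans ((Finset.sum_le_sum hterm).trans ?_)
  rw [Finset.sum_const, Finset.card_product, Finset.card_univ, hcard, Finset.card_range,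
    nsmul_eq_mul, ← ENNReal.ofReal_natCast, ← ENNReal.ofReal_mul (by positivity)]
  apply ENNReal.ofReal_le_ofReal
  push_cast
  rw [← mul_div_assoc, div_le_div_iff₀ (by positivity) (by positivity)]
  have : (m:ℝ) ^ 2 + 2 ≤ 3 * m ^ 2 := by nlinarith
  calc 10 * ((m:ℝ) ^ 2 + 2) * 12 * (m:ℝ) ^ 3 ≤ 10 * (3 * (m:ℝ) ^ 2) * 12 * (m:ℝ) ^ 3 := by gcongr
    _ = 360 * (m:ℝ) ^ 5 := by ring

/-- All processes can be constructed on a common probability space so that almost surely the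
compensated counts of events are asymptotically negligible. -/
theorem exists_coupled_processes {p : Params} (hp : p.Admissible) (r : ℕ → ℝ) (hr : ∀ n, 0 < r n)
    (hr_tendsto : Tendsto r atTop atTop) (s₀ : ℕ → State) :
    ∃ (Ω : Type) (_ : MeasurableSpace Ω) (P : Measure Ω) (S : ℕ → ℝ → Ω → State) (m : ℕ → ℕ),
      IsProbabilityMeasure P ∧ Tendsto m atTop atTop ∧
      (∀ n, IsInvitationProcess P p (p.lam * r n) (s₀ n) (S n)) ∧
      ∀ᵐ ω ∂P, ∃ (e : ℕ → ℕ → Event) (τ : ℕ → ℕ → ℝ),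
        (∀ n, IsPath p (p.lam * r n) (s₀ n) (e n) (τ n) (fun t => S n t ω)) ∧
        ∀ᶠ n in atTop, ∀ (c : Event × Bool) (k : ℕ), (k:ℝ) ≤ m n * r n →
          |pathNoise p (p.lam * r n) (s₀ n) (e n) (τ n) c k| ≤ 2 * (r n / m n) + 1 := by
  -- Slow enough that `m ^ 8 ≤ r`, yet `m → ∞`: the noise level `r / m` is then `o(r)`, while the
  -- controlled range `m * r` exceeds any multiple of `r`.
  set m : ℕ → ℕ := fun n => ⌊r n ^ (1 / 8 : ℝ)⌋₊ with hmdef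
  have hΛ : ∀ n, 0 < p.lam * r n := fun n => mul_pos hp.lam_pos (hr n)
  have hm : Tendsto m atTop atTop :=
    tendsto_nat_floor_atTop.comp ((tendsto_rpow_atTop (by norm_num)).comp hr_tendsto)
  have hmr : ∀ n, (m n : ℝ) ^ 8 ≤ r n := fun n => by
    have h1 : (m n : ℝ) ≤ r n ^ (1 / 8 : ℝ) := Nat.floor_le (Real.rpow_nonneg (hr n).le _)
    calc (m n : ℝ) ^ 8 ≤ (r n ^ (1 / 8 : ℝ)) ^ 8 := by gcongr
      _ = r n := by
        rw [← Real.rpow_natCast, ← Real.rpow_mul (hr n).le]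
        norm_num
  have hlim : Tendsto (fun n => pathLaw (badSet p (p.lam * r n) (s₀ n) (r n) (m n))) atTop (𝓝 0) := by
    have h1 : Tendsto (fun n => ENNReal.ofReal (360 / (m n : ℝ) ^ 3)) atTop (𝓝 0) := by
      rw [← ENNReal.ofReal_zero]
      refine ENNReal.tendsto_ofReal ?_
      refine Tendsto.const_div_atTop ?_ _
      exact (tendsto_pow_atTop (by norm_num)).comp (tendsto_natCast_atTop_atTop.comp hm)
    refine tendsto_of_tendsto_of_tendsto_of_le_of_le' tendsto_const_nhds h1
      (Eventually.of_forall fun n => zero_le) ?_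
    filter_upwards [hm.eventually_gt_atTop 0] with n hn
    exact pathLaw_badSet_le hp (hΛ n) (s₀ n) (hr n) hn (hmr n)
  obtain ⟨Ω, hΩ, P, θ, hP, hθ, hbad⟩ := exists_coupling pathLaw
    (fun n => badSet p (p.lam * r n) (s₀ n) (r n) (m n))
    (fun n => measurableSet_badSet _ _ _ _ _) hlim
  refine ⟨Ω, hΩ, P, fun n t ω => drivenProcess p (p.lam * r n) (s₀ n) t (θ n ω), m, hP, hm,
    fun n => isInvitationProcess_comp hp (hΛ n) (s₀ n) (hθ n), ?_⟩
  have hpath : ∀ᵐ ω ∂P, ∀ n, IsPath p (p.lam * r n) (s₀ n)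
      (fun k => drivenEvent p (p.lam * r n) (s₀ n) k (θ n ω))
      (fun k => drivenTime p (p.lam * r n) (s₀ n) k (θ n ω))
      (fun t => drivenProcess p (p.lam * r n) (s₀ n) t (θ n ω)) :=
    ae_all_iff.2 fun n => (hθ n).quasiMeasurePreserving.ae (isPath_drivenProcess hp (hΛ n) (s₀ n))
  filter_upwards [hbad, hpath] with ω h1 h2
  refine ⟨_, _, h2, ?_⟩
  filter_upwards [h1, hm.eventually_gt_atTop 0] with n hn hmn c k hk
  refine abs_pathNoise_le_of_grid hp (hΛ n) (s₀ n) _ (fun k => ((h2 n).time_pos k).le) c (hr n) hmn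
    (fun j hj => ?_) hk
  rw [← drivenNoise_eq]
  by_contra hlt
  refine hn (mem_biUnion (x := (c, j)) ?_ (not_le.1 hlt))
  simpa using hj

/-! ### Approximate solutions of the reflected integral equations -/

/-- The drift of `y`. -/
def driftY (p : Params) (x y w : ℝ → ℝ) (s : ℝ) : ℝ :=
  p.β * x s + 1 / 2 * p.α * p.μ * (w s - |y s|)

/-- The drift of `w`. -/
def driftW (p : Params) (x y w : ℝ → ℝ) (s : ℝ) : ℝ :=
  p.β * x s + 1 / 2 * (p.α - 2) * p.μ * (w s - |y s|)

/-- The path of `x` before reflection. -/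
def freeX (p : Params) (x y : ℝ → ℝ) (t : ℝ) : ℝ :=
  x 0 - p.γ * (y t - y 0) - p.ε * ∫ s in (0:ℝ)..t, y s

/-- The reflected integral equations hold on `[0, T]` up to an error `δ`. The last two fields
say that `x - freeX` is close to the running supremum of `max 0 (boundary - freeX)`. -/
structure ApproxSolution (p : Params) (T δ : ℝ) (x y w : ℝ → ℝ) : Prop where
  int_x : IntervalIntegrable x volume 0 T
  int_y : IntervalIntegrable y volume 0 T
  int_w : IntervalIntegrable w volume 0 T
  bdd : ∃ C, ∀ t ∈ Icc 0 T, |x t| ≤ C ∧ |y t| ≤ C ∧ |w t| ≤ C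
  y_eq : ∀ t ∈ Icc 0 T, |y t - y 0 - ∫ s in (0:ℝ)..t, driftY p x y w s| ≤ δ
  w_eq : ∀ t ∈ Icc 0 T, |w t - w 0 - ∫ s in (0:ℝ)..t, driftW p x y w s| ≤ δ
  x_ge : ∀ t ∈ Icc 0 T, boundary p ≤ x t
  reg_ge : ∀ t ∈ Icc 0 T, ∀ s ∈ Icc 0 t, max 0 (boundary p - freeX p x y s) ≤ x t - freeX p x y t + δ
  reg_le : ∀ t ∈ Icc 0 T, ∃ s ∈ Icc 0 t, x t - freeX p x y t ≤ max 0 (boundary p - freeX p x y s) + δ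

lemma IntervalIntegrable.mono_Icc {f : ℝ → ℝ} {T t : ℝ} (h : IntervalIntegrable f volume 0 T)
    (ht : t ∈ Icc 0 T) : IntervalIntegrable f volume 0 t :=
  h.mono_set (by rw [uIcc_of_le ht.1, uIcc_of_le (ht.1.trans ht.2)]; exact Icc_subset_Icc_right ht.2)

lemma intervalIntegrable_driftY {p : Params} {x y w : ℝ → ℝ} {t : ℝ}
    (hx : IntervalIntegrable x volume 0 t) (hy : IntervalIntegrable y volume 0 t)
    (hw : IntervalIntegrable w volume 0 t) : IntervalIntegrable (driftY p x y w) volume 0 t :=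
  (hx.const_mul _).add ((hw.sub hy.abs).const_mul _)

lemma intervalIntegrable_driftW {p : Params} {x y w : ℝ → ℝ} {t : ℝ}
    (hx : IntervalIntegrable x volume 0 t) (hy : IntervalIntegrable y volume 0 t)
    (hw : IntervalIntegrable w volume 0 t) : IntervalIntegrable (driftW p x y w) volume 0 t :=
  (hx.const_mul _).add ((hw.sub hy.abs).const_mul _)

lemma abs_driftY_sub_le {p : Params} (hp : p.Admissible) (x y w x' y' w' : ℝ → ℝ) (s : ℝ) :
    |driftY p x y w s - driftY p x' y' w' s| ≤
      (p.β + p.μ) * (|x s - x' s| + |y s - y' s| + |w s - w' s|) := by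
  have h1 := abs_abs_sub_abs_le_abs_sub (y s) (y' s)
  have hβ := hp.β_pos
  have hμ := hp.μ_pos
  have e : driftY p x y w s - driftY p x' y' w' s =
      p.β * (x s - x' s) + (1 / 2 * p.α * p.μ) * ((w s - w' s) - (|y s| - |y' s|)) := by
    unfold driftY; ring
  have hc : |1 / 2 * p.α * p.μ| ≤ p.μ := by
    rw [abs_of_nonneg (by have := hp.α_nonneg; positivity)]
    nlinarith [hp.α_lt_one]
  rw [e]
  refine (abs_add_le _ _).trans ?_
  rw [abs_mul, abs_mul, abs_of_pos hβ]
  have h2 : |(w s - w' s) - (|y s| - |y' s|)| ≤ |w s - w' s| + |y s - y' s| :=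
    (abs_sub _ _).trans (by linarith)
  have h3 := mul_le_mul hc h2 (abs_nonneg _) hμ.le
  nlinarith [abs_nonneg (x s - x' s), abs_nonneg (y s - y' s), abs_nonneg (w s - w' s)]

lemma abs_driftW_sub_le {p : Params} (hp : p.Admissible) (x y w x' y' w' : ℝ → ℝ) (s : ℝ) :
    |driftW p x y w s - driftW p x' y' w' s| ≤
      (p.β + p.μ) * (|x s - x' s| + |y s - y' s| + |w s - w' s|) := by
  have h1 := abs_abs_sub_abs_le_abs_sub (y s) (y' s)
  have hβ := hp.β_pos
  have hμ := hp.μ_pos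
  have e : driftW p x y w s - driftW p x' y' w' s =
      p.β * (x s - x' s) + (1 / 2 * (p.α - 2) * p.μ) * ((w s - w' s) - (|y s| - |y' s|)) := by
    unfold driftW; ring
  have hc : |1 / 2 * (p.α - 2) * p.μ| ≤ p.μ := by
    rw [abs_le]
    constructor <;> nlinarith [hp.α_lt_one, hp.α_nonneg]
  rw [e]
  refine (abs_add_le _ _).trans ?_
  rw [abs_mul, abs_mul, abs_of_pos hβ]
  have h2 : |(w s - w' s) - (|y s| - |y' s|)| ≤ |w s - w' s| + |y s - y' s| :=
    (abs_sub _ _).trans (by linarith)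
  have h3 := mul_le_mul hc h2 (abs_nonneg _) hμ.le
  nlinarith [abs_nonneg (x s - x' s), abs_nonneg (y s - y' s), abs_nonneg (w s - w' s)]

/-! ### Gronwall-type estimates -/

/-- A Gronwall inequality in exponentially weighted supremum norm. -/
lemma le_of_weighted_contraction {D : ℝ → ℝ} {T κ a : ℝ} (ha : 0 ≤ a) (hκ : 0 ≤ κ)
    (hbdd : ∃ A, ∀ t ∈ Icc 0 T, D t ≤ A)
    (h : ∀ A, 0 ≤ A → (∀ s ∈ Icc 0 T, D s ≤ A * Real.exp (κ * s)) →
      ∀ t ∈ Icc 0 T, D t ≤ (a + A / 2) * Real.exp (κ * t)) :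
    ∀ t ∈ Icc 0 T, D t ≤ 2 * a * Real.exp (κ * t) := by
  obtain ⟨A, hA⟩ := hbdd
  -- Each application of `h` halves the excess over the fixed point `2 * a` of `A ↦ a + A / 2`. Only
  -- boundedness of `D` starts the iteration; neither continuity nor measurability is involved.
  have key : ∀ n : ℕ, ∀ t ∈ Icc 0 T, D t ≤ (2 * a + |A| * (1 / 2) ^ n) * Real.exp (κ * t) := by
    intro n
    induction n with
    | zero =>
      intro t ht
      have h1 : 1 ≤ Real.exp (κ * t) := Real.one_le_exp (mul_nonneg hκ ht.1)
      have h2 := hA t ht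
      have h3 := le_abs_self A
      have h4 := abs_nonneg A
      rw [pow_zero, mul_one]
      nlinarith
    | succ n ih =>
      intro t ht
      refine (h _ (by positivity) ih t ht).trans (le_of_eq ?_)
      rw [pow_succ]
      ring
  intro t ht
  have hlim : Tendsto (fun n : ℕ => (2 * a + |A| * (1 / 2) ^ n) * Real.exp (κ * t)) atTop
      (𝓝 ((2 * a + |A| * 0) * Real.exp (κ * t))) :=
    (((tendsto_pow_atTop_nhds_zero_of_lt_one (by norm_num) (by norm_num)).const_mul _).const_add
      _).mul_const _
  rw [mul_zero, add_zero] at hlim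
  exact ge_of_tendsto' hlim fun n => key n t ht

lemma integral_le_of_le_exp {f : ℝ → ℝ} {t B κ : ℝ} (ht : 0 ≤ t) (hκ : 0 < κ) (hB : 0 ≤ B)
    (h : ∀ s ∈ Icc 0 t, |f s| ≤ B * Real.exp (κ * s)) :
    |∫ s in (0:ℝ)..t, f s| ≤ B / κ * Real.exp (κ * t) := by
  have hi : IntervalIntegrable (fun s => B * Real.exp (κ * s)) volume 0 t :=
    (by fun_prop : Continuous fun s => B * Real.exp (κ * s)).intervalIntegrable _ _
  have h1 := intervalIntegral.norm_integral_le_of_norm_le (f := f) ht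
    (ae_of_all _ fun s hs => by simpa using h s (Ioc_subset_Icc_self hs)) hi
  rw [Real.norm_eq_abs] at h1
  refine h1.trans ?_
  have h2 : ∫ s in (0:ℝ)..t, B * Real.exp (κ * s) = B / κ * Real.exp (κ * t) - B / κ := by
    have hd : ∀ s ∈ uIcc 0 t, HasDerivAt (fun s => B / κ * Real.exp (κ * s))
        (B * Real.exp (κ * s)) s := by
      intro s _
      have := (((hasDerivAt_id s).const_mul κ).exp.const_mul (B / κ))
      convert! this using 1
      simp only [id]
      field_simp
    rw [intervalIntegral.integral_eq_sub_of_hasDerivAt hd hi]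
    simp
  rw [h2]
  have : 0 ≤ B / κ := by positivity
  linarith

lemma abs_integral_sub_le_exp {f g : ℝ → ℝ} {t B κ : ℝ} (ht : 0 ≤ t) (hκ : 0 < κ) (hB : 0 ≤ B)
    (hf : IntervalIntegrable f volume 0 t) (hg : IntervalIntegrable g volume 0 t)
    (h : ∀ s ∈ Icc 0 t, |f s - g s| ≤ B * Real.exp (κ * s)) :
    |(∫ s in (0:ℝ)..t, f s) - ∫ s in (0:ℝ)..t, g s| ≤ B / κ * Real.exp (κ * t) := by
  rw [← intervalIntegral.integral_sub hf hg]
  exact integral_le_of_le_exp ht hκ hB h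

lemma abs_integral_sub_le_const {f g : ℝ → ℝ} {t B : ℝ} (ht : 0 ≤ t)
    (hf : IntervalIntegrable f volume 0 t) (hg : IntervalIntegrable g volume 0 t)
    (h : ∀ s ∈ Icc 0 t, |f s - g s| ≤ B) :
    |(∫ s in (0:ℝ)..t, f s) - ∫ s in (0:ℝ)..t, g s| ≤ B * t := by
  rw [← intervalIntegral.integral_sub hf hg]
  have := intervalIntegral.norm_integral_le_of_norm_le_const (f := fun s => f s - g s) (C := B)
    (a := 0) (b := t) (fun s hs => by
      rw [uIoc_of_le ht] at hs
      exact h s (Ioc_subset_Icc_self hs))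
  rwa [Real.norm_eq_abs, sub_zero, abs_of_nonneg ht] at this

/-- This makes the Skorokhod regulator, a supremum of such terms, 1-Lipschitz in the free path. -/
lemma abs_max_sub_max_le (b u v : ℝ) : max 0 (b - u) ≤ max 0 (b - v) + |u - v| := by
  have h1 := neg_abs_le (u - v)
  have h2 := le_max_left 0 (b - v)
  have h3 := le_max_right 0 (b - v)
  have h4 := abs_nonneg (u - v)
  exact max_le (by linarith) (by linarith)

/-- Approximate solutions with close initial values are close. -/
lemma ApproxSolution.exists_stability {p : Params} (hp : p.Admissible) (T : ℝ) :
    ∃ C, 0 < C ∧ ∀ (δ : ℝ) (x y w x' y' w' : ℝ → ℝ), 0 ≤ δ →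
      ApproxSolution p T δ x y w → ApproxSolution p T δ x' y' w' →
      |x 0 - x' 0| ≤ δ → |y 0 - y' 0| ≤ δ → |w 0 - w' 0| ≤ δ →
      ∀ t ∈ Icc 0 T, |x t - x' t| + |y t - y' t| + |w t - w' t| ≤ C * δ := by
  have hβ := hp.β_pos
  have hμ := hp.μ_pos
  have hε := hp.ε_pos
  set c := p.β + p.μ with hc
  have hc0 : 0 < c := by positivity
  set γ : ℝ := (p.γ : ℝ) with hγ
  have hγ0 : 0 ≤ γ := by positivity
  -- Integration against the weight gains a factor `1 / κ`. The bracket collects the resulting terms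
  -- for `x`, `y` and `w`, so this `κ` makes their total at most `A / 2`; the remaining errors add
  -- up to `(10 + 8 * γ) * δ`.
  set κ := 2 * (2 * γ * c + 2 * p.ε + 2 * c) with hκ
  have hκ0 : 0 < κ := by positivity
  refine ⟨2 * (10 + 8 * γ) * Real.exp (κ * T), by positivity, ?_⟩
  intro δ x y w x' y' w' hδ h h' hx0 hy0 hw0
  have hmain := le_of_weighted_contraction
    (D := fun t => |x t - x' t| + |y t - y' t| + |w t - w' t|) (T := T) (κ := κ)
    (a := (10 + 8 * γ) * δ) (by positivity) hκ0.le ?_ ?_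
  · intro t ht
    refine (hmain t ht).trans ?_
    have : Real.exp (κ * t) ≤ Real.exp (κ * T) :=
      Real.exp_le_exp.2 (mul_le_mul_of_nonneg_left ht.2 hκ0.le)
    calc 2 * ((10 + 8 * γ) * δ) * Real.exp (κ * t) ≤ 2 * ((10 + 8 * γ) * δ) * Real.exp (κ * T) := by
          gcongr
      _ = _ := by ring
  · obtain ⟨C1, hC1⟩ := h.bdd
    obtain ⟨C2, hC2⟩ := h'.bdd
    refine ⟨3 * (C1 + C2), fun t ht => ?_⟩
    obtain ⟨a1, a2, a3⟩ := hC1 t ht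
    obtain ⟨b1, b2, b3⟩ := hC2 t ht
    have := abs_sub (x t) (x' t)
    have := abs_sub (y t) (y' t)
    have := abs_sub (w t) (w' t)
    linarith
  · intro A hA hD
    have hmono : ∀ {s t : ℝ}, s ≤ t → A * Real.exp (κ * s) / κ ≤ A * Real.exp (κ * t) / κ := by
      intro s t hst
      gcongr
    have hy : ∀ t ∈ Icc 0 T, |y t - y' t| ≤ 3 * δ + c * (A * Real.exp (κ * t) / κ) := by
      intro t ht
      have h1 := abs_le.1 (h.y_eq t ht)
      have h2 := abs_le.1 (h'.y_eq t ht)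
      have h3 := abs_integral_sub_le_exp (f := driftY p x y w) (g := driftY p x' y' w') ht.1 hκ0
        (B := c * A) (by positivity)
        (intervalIntegrable_driftY (h.int_x.mono_Icc ht) (h.int_y.mono_Icc ht) (h.int_w.mono_Icc ht))
        (intervalIntegrable_driftY (h'.int_x.mono_Icc ht) (h'.int_y.mono_Icc ht)
          (h'.int_w.mono_Icc ht))
        (fun s hs => (abs_driftY_sub_le hp x y w x' y' w' s).trans (by
          rw [mul_assoc]
          exact mul_le_mul_of_nonneg_left (hD s ⟨hs.1, hs.2.trans ht.2⟩) hc0.le))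
      have h4 := abs_le.1 h3
      have h5 := abs_le.1 hy0
      have e : c * A / κ * Real.exp (κ * t) = c * (A * Real.exp (κ * t) / κ) := by ring
      rw [e] at h4
      rw [abs_le]
      constructor <;> linarith [h1.1, h1.2, h2.1, h2.2, h4.1, h4.2, h5.1, h5.2]
    have hw : ∀ t ∈ Icc 0 T, |w t - w' t| ≤ 3 * δ + c * (A * Real.exp (κ * t) / κ) := by
      intro t ht
      have h1 := abs_le.1 (h.w_eq t ht)
      have h2 := abs_le.1 (h'.w_eq t ht)
      have h3 := abs_integral_sub_le_exp (f := driftW p x y w) (g := driftW p x' y' w') ht.1 hκ0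
        (B := c * A) (by positivity)
        (intervalIntegrable_driftW (h.int_x.mono_Icc ht) (h.int_y.mono_Icc ht) (h.int_w.mono_Icc ht))
        (intervalIntegrable_driftW (h'.int_x.mono_Icc ht) (h'.int_y.mono_Icc ht)
          (h'.int_w.mono_Icc ht))
        (fun s hs => (abs_driftW_sub_le hp x y w x' y' w' s).trans (by
          rw [mul_assoc]
          exact mul_le_mul_of_nonneg_left (hD s ⟨hs.1, hs.2.trans ht.2⟩) hc0.le))
      have h4 := abs_le.1 h3
      have h5 := abs_le.1 hw0
      have e : c * A / κ * Real.exp (κ * t) = c * (A * Real.exp (κ * t) / κ) := by ring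
      rw [e] at h4
      rw [abs_le]
      constructor <;> linarith [h1.1, h1.2, h2.1, h2.2, h4.1, h4.2, h5.1, h5.2]
    have hu : ∀ t ∈ Icc 0 T, |freeX p x y t - freeX p x' y' t| ≤
        δ + γ * (4 * δ + c * (A * Real.exp (κ * t) / κ)) + p.ε * (A * Real.exp (κ * t) / κ) := by
      intro t ht
      have h3 := abs_integral_sub_le_exp (f := y) (g := y') ht.1 hκ0 hA
        (h.int_y.mono_Icc ht) (h'.int_y.mono_Icc ht)
        (fun s hs => by
          have := hD s ⟨hs.1, hs.2.trans ht.2⟩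
          linarith [abs_nonneg (x s - x' s), abs_nonneg (w s - w' s)])
      rw [show A / κ * Real.exp (κ * t) = A * Real.exp (κ * t) / κ by ring] at h3
      have e : freeX p x y t - freeX p x' y' t = (x 0 - x' 0)
          - γ * ((y t - y' t) - (y 0 - y' 0))
          - p.ε * ((∫ s in (0:ℝ)..t, y s) - ∫ s in (0:ℝ)..t, y' s) := by
        unfold freeX; ring
      rw [e]
      have h4 : |(y t - y' t) - (y 0 - y' 0)| ≤ 4 * δ + c * (A * Real.exp (κ * t) / κ) :=
        (abs_sub _ _).trans (by linarith [hy t ht])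
      refine (abs_sub _ _).trans (add_le_add ((abs_sub _ _).trans (add_le_add hx0 ?_)) ?_)
      · rw [abs_mul, abs_of_nonneg hγ0]
        exact mul_le_mul_of_nonneg_left h4 hγ0
      · rw [abs_mul, abs_of_pos hε]
        exact mul_le_mul_of_nonneg_left h3 hε.le
    intro t ht
    set E := A * Real.exp (κ * t) / κ with hE
    set G := δ + γ * (4 * δ + c * E) + p.ε * E with hG
    have huG : ∀ s ∈ Icc 0 t, |freeX p x y s - freeX p x' y' s| ≤ G := by
      intro s hs
      refine (hu s ⟨hs.1, hs.2.trans ht.2⟩).trans ?_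
      have := hmono hs.2
      rw [hG]
      gcongr
    have huG' : |freeX p x y t - freeX p x' y' t| ≤ G := huG t ⟨ht.1, le_rfl⟩
    -- The near-maximiser of one regulator is a competitor for the other. One `G` comes from the
    -- free paths at `t`, one from the free paths at that competitor.
    have hxt : |x t - x' t| ≤ 2 * G + 2 * δ := by
      obtain ⟨s, hs, hs1⟩ := h.reg_le t ht
      obtain ⟨s', hs', hs1'⟩ := h'.reg_le t ht
      have h1 := h'.reg_ge t ht s hs
      have h2 := h.reg_ge t ht s' hs'
      have h3 := abs_max_sub_max_le (boundary p) (freeX p x y s) (freeX p x' y' s)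
      have h4 := abs_max_sub_max_le (boundary p) (freeX p x' y' s') (freeX p x y s')
      rw [abs_sub_comm] at h4
      have h5 := huG s hs
      have h6 := huG s' hs'
      have h7 := abs_le.1 huG'
      rw [abs_le]
      constructor <;> linarith [h7.1, h7.2]
    have h1 := hy t ht
    have h2 := hw t ht
    have hE2 : (2 * γ * c + 2 * p.ε + 2 * c) * E = A / 2 * Real.exp (κ * t) := by
      rw [hE]
      have : 2 * γ * c + 2 * p.ε + 2 * c = κ / 2 := by rw [hκ]; ring
      rw [this]
      field_simp
    have h3 : 1 ≤ Real.exp (κ * t) := Real.one_le_exp (mul_nonneg hκ0.le ht.1)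
    have h4 : (10 + 8 * γ) * δ ≤ (10 + 8 * γ) * δ * Real.exp (κ * t) :=
      le_mul_of_one_le_right (by positivity) h3
    rw [add_mul, ← hE2]
    nlinarith

/-! ### Passing to the limit -/

/-- Each defining inequality is Lipschitz in the uniform norm on `[0, T]`. The integral equations
cost `3 + 3 * (p.β + p.μ) * T` times `δ` and the regulator conditions `4 + 4 * p.γ + 2 * p.ε * T`
times `δ`; the stated constant dominates both. -/
lemma ApproxSolution.of_close {p : Params} (hp : p.Admissible) {T δ : ℝ} (hT : 0 ≤ T)
    {x y w x' y' w' : ℝ → ℝ} (h : ApproxSolution p T δ x y w)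
    (hx' : IntervalIntegrable x' volume 0 T) (hy' : IntervalIntegrable y' volume 0 T)
    (hw' : IntervalIntegrable w' volume 0 T) (hge : ∀ t ∈ Icc 0 T, boundary p ≤ x' t)
    (hx : ∀ t ∈ Icc 0 T, |x t - x' t| ≤ δ) (hy : ∀ t ∈ Icc 0 T, |y t - y' t| ≤ δ)
    (hw : ∀ t ∈ Icc 0 T, |w t - w' t| ≤ δ) :
    ApproxSolution p T ((5 + 3 * (p.β + p.μ) * T + 4 * p.γ + 2 * p.ε * T) * δ) x' y' w' := by
  have hβ := hp.β_pos
  have hμ := hp.μ_pos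
  have hε := hp.ε_pos
  have hδ : 0 ≤ δ := (abs_nonneg _).trans (hx 0 ⟨le_rfl, hT⟩)
  set c := p.β + p.μ with hc
  have hc0 : 0 < c := by positivity
  set γ : ℝ := (p.γ : ℝ) with hγ
  have hγ0 : 0 ≤ γ := by positivity
  have hcT : 0 ≤ c * T * δ := by positivity
  have hγδ : 0 ≤ γ * δ := by positivity
  have hεδ : 0 ≤ p.ε * T * δ := by positivity
  have h0 : (0:ℝ) ∈ Icc 0 T := ⟨le_rfl, hT⟩
  have hu : ∀ t ∈ Icc 0 T, |freeX p x y t - freeX p x' y' t| ≤ (1 + 2 * γ + p.ε * T) * δ := by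
    intro t ht
    have h3 := abs_integral_sub_le_const (f := y) (g := y') ht.1 (B := δ)
      (h.int_y.mono_Icc ht) (hy'.mono_Icc ht) (fun s hs => hy s ⟨hs.1, hs.2.trans ht.2⟩)
    have e : freeX p x y t - freeX p x' y' t = (x 0 - x' 0)
        - γ * ((y t - y' t) - (y 0 - y' 0))
        - p.ε * ((∫ s in (0:ℝ)..t, y s) - ∫ s in (0:ℝ)..t, y' s) := by
      unfold freeX; ring
    have h4 : |(y t - y' t) - (y 0 - y' 0)| ≤ 2 * δ :=
      (abs_sub _ _).trans (by linarith [hy t ht, hy 0 h0])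
    have h5 : δ * t ≤ δ * T := mul_le_mul_of_nonneg_left ht.2 hδ
    rw [e]
    have : |(x 0 - x' 0) - γ * ((y t - y' t) - (y 0 - y' 0))
        - p.ε * ((∫ s in (0:ℝ)..t, y s) - ∫ s in (0:ℝ)..t, y' s)| ≤
        δ + γ * (2 * δ) + p.ε * (δ * T) := by
      refine (abs_sub _ _).trans (add_le_add ((abs_sub _ _).trans (add_le_add (hx 0 h0) ?_)) ?_)
      · rw [abs_mul, abs_of_nonneg hγ0]
        exact mul_le_mul_of_nonneg_left h4 hγ0
      · rw [abs_mul, abs_of_pos hε]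
        exact mul_le_mul_of_nonneg_left (h3.trans h5) hε.le
    linarith
  refine ⟨hx', hy', hw', ?_, ?_, ?_, hge, ?_, ?_⟩
  · obtain ⟨C, hC⟩ := h.bdd
    refine ⟨C + δ, fun t ht => ?_⟩
    obtain ⟨a1, a2, a3⟩ := hC t ht
    have key : ∀ a b : ℝ, |a| ≤ C → |a - b| ≤ δ → |b| ≤ C + δ := by
      intro a b h1 h2
      rw [abs_le] at *
      constructor <;> linarith [h1.1, h1.2, h2.1, h2.2]
    exact ⟨key _ _ a1 (hx t ht), key _ _ a2 (hy t ht), key _ _ a3 (hw t ht)⟩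
  · intro t ht
    have h1 := abs_le.1 (h.y_eq t ht)
    have h3 := abs_le.1 (abs_integral_sub_le_const (f := driftY p x y w) (g := driftY p x' y' w')
      ht.1 (B := c * (3 * δ))
      (intervalIntegrable_driftY (h.int_x.mono_Icc ht) (h.int_y.mono_Icc ht) (h.int_w.mono_Icc ht))
      (intervalIntegrable_driftY (hx'.mono_Icc ht) (hy'.mono_Icc ht) (hw'.mono_Icc ht))
      (fun s hs => (abs_driftY_sub_le hp x y w x' y' w' s).trans (by
        have hs' : s ∈ Icc 0 T := ⟨hs.1, hs.2.trans ht.2⟩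
        refine mul_le_mul_of_nonneg_left ?_ hc0.le
        linarith [hx s hs', hy s hs', hw s hs'])))
    have h4 := abs_le.1 (hy t ht)
    have h5 := abs_le.1 (hy 0 h0)
    have h6 : c * (3 * δ) * t ≤ c * (3 * δ) * T := mul_le_mul_of_nonneg_left ht.2 (by positivity)
    rw [abs_le]
    constructor <;> linarith [h1.1, h1.2, h3.1, h3.2, h4.1, h4.2, h5.1, h5.2]
  · intro t ht
    have h1 := abs_le.1 (h.w_eq t ht)
    have h3 := abs_le.1 (abs_integral_sub_le_const (f := driftW p x y w) (g := driftW p x' y' w')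
      ht.1 (B := c * (3 * δ))
      (intervalIntegrable_driftW (h.int_x.mono_Icc ht) (h.int_y.mono_Icc ht) (h.int_w.mono_Icc ht))
      (intervalIntegrable_driftW (hx'.mono_Icc ht) (hy'.mono_Icc ht) (hw'.mono_Icc ht))
      (fun s hs => (abs_driftW_sub_le hp x y w x' y' w' s).trans (by
        have hs' : s ∈ Icc 0 T := ⟨hs.1, hs.2.trans ht.2⟩
        refine mul_le_mul_of_nonneg_left ?_ hc0.le
        linarith [hx s hs', hy s hs', hw s hs'])))
    have h4 := abs_le.1 (hw t ht)
    have h5 := abs_le.1 (hw 0 h0)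
    have h6 : c * (3 * δ) * t ≤ c * (3 * δ) * T := mul_le_mul_of_nonneg_left ht.2 (by positivity)
    rw [abs_le]
    constructor <;> linarith [h1.1, h1.2, h3.1, h3.2, h4.1, h4.2, h5.1, h5.2]
  · intro t ht s hs
    have h1 := h.reg_ge t ht s hs
    have h2 := abs_max_sub_max_le (boundary p) (freeX p x' y' s) (freeX p x y s)
    rw [abs_sub_comm] at h2
    have h3 := hu s ⟨hs.1, hs.2.trans ht.2⟩
    have h4 := abs_le.1 (hu t ht)
    have h5 := abs_le.1 (hx t ht)
    linarith [h4.1, h4.2, h5.1, h5.2]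
  · intro t ht
    obtain ⟨s, hs, h1⟩ := h.reg_le t ht
    refine ⟨s, hs, ?_⟩
    have h2 := abs_max_sub_max_le (boundary p) (freeX p x y s) (freeX p x' y' s)
    have h3 := hu s ⟨hs.1, hs.2.trans ht.2⟩
    have h4 := abs_le.1 (hu t ht)
    have h5 := abs_le.1 (hx t ht)
    linarith [h4.1, h4.2, h5.1, h5.2]

/-- The limit is measurable as a pointwise limit and differs from one integrable member by less than
1 on a set of finite measure. -/
lemma intervalIntegrable_of_uniform_limit {f : ℕ → ℝ → ℝ} {g : ℝ → ℝ} {T : ℝ} (hT : 0 ≤ T)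
    (hf : ∀ᶠ n in atTop, IntervalIntegrable (f n) volume 0 T)
    (h : TendstoUniformlyOn f g atTop (Icc 0 T)) : IntervalIntegrable g volume 0 T := by
  have h1 := Metric.tendstoUniformlyOn_iff.1 h 1 one_pos
  obtain ⟨N, hN⟩ := eventually_atTop.1 (hf.and h1)
  rw [intervalIntegrable_iff_integrableOn_Ioc_of_le hT]
  have hmeas : AEStronglyMeasurable g (volume.restrict (Ioc 0 T)) := by
    refine aestronglyMeasurable_of_tendsto_ae atTop (f := fun n => f (n + N)) (fun n => ?_) ?_
    · have := (hN (n + N) (by omega)).1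
      rw [intervalIntegrable_iff_integrableOn_Ioc_of_le hT] at this
      exact this.aestronglyMeasurable
    · filter_upwards [ae_restrict_mem measurableSet_Ioc] with t ht
      exact ((h.tendsto_at (Ioc_subset_Icc_self ht)).comp (tendsto_add_atTop_nat N))
  have hi := (hN N le_rfl).1
  rw [intervalIntegrable_iff_integrableOn_Ioc_of_le hT] at hi
  have hd : IntegrableOn (fun t => g t - f N t) (Ioc 0 T) := by
    have : IsFiniteMeasure (volume.restrict (Ioc 0 T)) := ⟨by simp⟩
    refine Integrable.of_bound (hmeas.sub hi.aestronglyMeasurable) 1 ?_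
    filter_upwards [ae_restrict_mem measurableSet_Ioc] with t ht
    have := (hN N le_rfl).2 t (Ioc_subset_Icc_self ht)
    rw [Real.dist_eq] at this
    exact this.le
  have := hd.add hi
  refine this.congr_fun (fun t _ => ?_) measurableSet_Ioc
  simp

/-- Asymptotic solutions with convergent initial values converge to an exact solution. -/
theorem exists_limit {p : Params} (hp : p.Admissible) {x y w : ℕ → ℝ → ℝ} {x₀ y₀ w₀ : ℝ}
    (h : ∀ T, 0 ≤ T → ∀ δ, 0 < δ → ∀ᶠ n in atTop, ApproxSolution p T δ (x n) (y n) (w n))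
    (hx0 : Tendsto (fun n => x n 0) atTop (𝓝 x₀)) (hy0 : Tendsto (fun n => y n 0) atTop (𝓝 y₀))
    (hw0 : Tendsto (fun n => w n 0) atTop (𝓝 w₀)) :
    ∃ x' y' w' : ℝ → ℝ, TendstoUOC x x' ∧ TendstoUOC y y' ∧ TendstoUOC w w' ∧
      x' 0 = x₀ ∧ y' 0 = y₀ ∧ w' 0 = w₀ ∧
      ∀ T, 0 ≤ T → ∀ δ, 0 < δ → ApproxSolution p T δ x' y' w' := by
  -- Stability compares two members of the sequence with each other, so no solution has to be known
  -- in advance: existence of the limit comes from completeness.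
  have hcauchy : ∀ T, 0 ≤ T → ∀ η, 0 < η → ∃ N, ∀ m, N ≤ m → ∀ n, N ≤ n → ∀ t ∈ Icc 0 T,
      |x m t - x n t| + |y m t - y n t| + |w m t - w n t| < η := by
    intro T hT η hη
    obtain ⟨C, hC0, hC⟩ := ApproxSolution.exists_stability hp T
    set δ := η / (2 * C) with hδ
    have hδ0 : 0 < δ := by positivity
    have hinit : ∀ {f : ℕ → ℝ → ℝ} {a : ℝ}, Tendsto (fun n => f n 0) atTop (𝓝 a) →
        ∀ᶠ n in atTop, |f n 0 - a| < δ / 2 := fun hf => by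
      have := Metric.tendsto_nhds.1 hf (δ / 2) (by positivity)
      simpa [Real.dist_eq] using this
    obtain ⟨N, hN⟩ := eventually_atTop.1
      ((h T hT δ hδ0).and ((hinit hx0).and ((hinit hy0).and (hinit hw0))))
    refine ⟨N, fun m hm n hn t ht => ?_⟩
    obtain ⟨a1, a2, a3, a4⟩ := hN m hm
    obtain ⟨b1, b2, b3, b4⟩ := hN n hn
    have key : ∀ a b c : ℝ, |a - c| < δ / 2 → |b - c| < δ / 2 → |a - b| ≤ δ := by
      intro a b c h1 h2
      rw [abs_lt] at h1 h2
      rw [abs_le]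
      constructor <;> linarith [h1.1, h1.2, h2.1, h2.2]
    refine (hC δ _ _ _ _ _ _ hδ0.le a1 b1 (key _ _ _ a2 b2) (key _ _ _ a3 b3)
      (key _ _ _ a4 b4) t ht).trans_lt ?_
    have : C * δ = η / 2 := by rw [hδ]; field_simp
    linarith
  have hUC : ∀ f : ℕ → ℝ → ℝ, (∀ m n t, |f m t - f n t| ≤
      |x m t - x n t| + |y m t - y n t| + |w m t - w n t|) →
      ∃ g : ℝ → ℝ, ∀ T, 0 ≤ T → TendstoUniformlyOn f g atTop (Icc 0 T) := by
    intro f hf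
    have hu : ∀ T, 0 ≤ T → UniformCauchySeqOn f atTop (Icc 0 T) := by
      intro T hT
      rw [Metric.uniformCauchySeqOn_iff]
      intro η hη
      obtain ⟨N, hN⟩ := hcauchy T hT η hη
      exact ⟨N, fun m hm n hn t ht => by
        rw [Real.dist_eq]; exact (hf m n t).trans_lt (hN m hm n hn t ht)⟩
    have hpt : ∀ t : ℝ, ∃ l, 0 ≤ t → Tendsto (fun n => f n t) atTop (𝓝 l) := by
      intro t
      by_cases ht : 0 ≤ t
      · obtain ⟨l, hl⟩ := cauchySeq_tendsto_of_complete ((hu t ht).cauchySeq ⟨ht, le_rfl⟩)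
        exact ⟨l, fun _ => hl⟩
      · exact ⟨0, fun h => absurd h ht⟩
    choose g hg using hpt
    exact ⟨g, fun T hT => (hu T hT).tendstoUniformlyOn_of_tendsto fun t ht => hg t ht.1⟩
  obtain ⟨x', hx'⟩ := hUC x fun m n t => by
    linarith [abs_nonneg (y m t - y n t), abs_nonneg (w m t - w n t)]
  obtain ⟨y', hy'⟩ := hUC y fun m n t => by
    linarith [abs_nonneg (x m t - x n t), abs_nonneg (w m t - w n t)]
  obtain ⟨w', hw'⟩ := hUC w fun m n t => by
    linarith [abs_nonneg (x m t - x n t), abs_nonneg (y m t - y n t)]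
  have huoc : ∀ {f : ℕ → ℝ → ℝ} {g : ℝ → ℝ}, (∀ T, 0 ≤ T → TendstoUniformlyOn f g atTop (Icc 0 T)) →
      TendstoUOC f g := by
    intro f g hfg K hK hK0
    obtain ⟨M, hM⟩ := hK.bddAbove
    exact (hfg (max M 0) (le_max_right _ _)).mono fun t ht =>
      ⟨hK0 ht, (hM ht).trans (le_max_left _ _)⟩
  have h0 : (0:ℝ) ∈ Icc (0:ℝ) 0 := ⟨le_rfl, le_rfl⟩
  refine ⟨x', y', w', huoc hx', huoc hy', huoc hw',
    tendsto_nhds_unique ((hx' 0 le_rfl).tendsto_at h0) hx0,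
    tendsto_nhds_unique ((hy' 0 le_rfl).tendsto_at h0) hy0,
    tendsto_nhds_unique ((hw' 0 le_rfl).tendsto_at h0) hw0, ?_⟩
  intro T hT δ hδ
  have hT1 := h T hT 1 one_pos
  have ix := intervalIntegrable_of_uniform_limit hT (hT1.mono fun n h => h.int_x) (hx' T hT)
  have iy := intervalIntegrable_of_uniform_limit hT (hT1.mono fun n h => h.int_y) (hy' T hT)
  have iw := intervalIntegrable_of_uniform_limit hT (hT1.mono fun n h => h.int_w) (hw' T hT)
  set K := 5 + 3 * (p.β + p.μ) * T + 4 * p.γ + 2 * p.ε * T with hK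
  have hK0 : 0 < K := by
    have := hp.β_pos
    have := hp.μ_pos
    have := hp.ε_pos
    positivity
  have hδK : 0 < δ / K := by positivity
  have hclose : ∀ {f : ℕ → ℝ → ℝ} {g : ℝ → ℝ}, TendstoUniformlyOn f g atTop (Icc 0 T) →
      ∀ᶠ n in atTop, ∀ t ∈ Icc 0 T, |f n t - g t| ≤ δ / K := by
    intro f g hfg
    filter_upwards [Metric.tendstoUniformlyOn_iff.1 hfg (δ / K) hδK] with n hn t ht
    have := hn t ht
    rw [Real.dist_eq, abs_sub_comm] at this
    exact this.le
  obtain ⟨n, hn, h1, h2, h3⟩ := ((h T hT (δ / K) hδK).and ((hclose (hx' T hT)).and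
    ((hclose (hy' T hT)).and (hclose (hw' T hT))))).exists
  have hge : ∀ t ∈ Icc 0 T, boundary p ≤ x' t := fun t ht =>
    ge_of_tendsto ((hx' T hT).tendsto_at ht) (hT1.mono fun n h => h.x_ge t ht)
  have := hn.of_close hp hT ix iy iw hge h1 h2 h3
  rwa [← hK, mul_div_cancel₀ _ hK0.ne'] at this

/-! ### Exact solutions -/

/-- `(x, y, w)` solves the reflected integral equations on `[0, ∞)`. -/
def IsExactSolution (p : Params) (x y w : ℝ → ℝ) : Prop :=
  ∀ T, 0 ≤ T → ∀ δ, 0 < δ → ApproxSolution p T δ x y w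

lemma eq_of_forall_abs_sub_le {a b : ℝ} (h : ∀ δ, 0 < δ → |a - b| ≤ δ) : a = b := by
  have : |a - b| ≤ 0 := le_of_forall_pos_le_add fun δ hδ => by simpa using h δ hδ
  exact sub_eq_zero.1 (abs_nonpos_iff.1 this)

/-- A function on `[0, ∞)` which is Lipschitz on every `[0, T]`. -/
def LipschitzOnCompacts (f : ℝ → ℝ) : Prop :=
  ∀ T, 0 ≤ T → ∃ K, 0 ≤ K ∧ ∀ s t, 0 ≤ s → s ≤ t → t ≤ T → |f t - f s| ≤ K * (t - s)

lemma LipschitzOnCompacts.locallyLipschitzOn {f : ℝ → ℝ} (h : LipschitzOnCompacts f) :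
    LocallyLipschitzOn (Ici 0) f := by
  intro t ht
  have ht : 0 ≤ t := ht
  obtain ⟨K, hK0, hK⟩ := h (t + 1) (by linarith)
  refine ⟨⟨K, hK0⟩, Ici 0 ∩ Iio (t + 1), inter_mem_nhdsWithin _ (Iio_mem_nhds (by linarith)), ?_⟩
  refine LipschitzOnWith.of_dist_le_mul fun a ha b hb => ?_
  rw [Real.dist_eq, Real.dist_eq]
  change _ ≤ K * _
  rcases le_total a b with hab | hab
  · rw [abs_sub_comm, abs_sub_comm a b, abs_of_nonneg (sub_nonneg.2 hab)]
    exact hK a b ha.1 hab (le_of_lt hb.2)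
  · rw [abs_of_nonneg (sub_nonneg.2 hab)]
    exact hK b a hb.1 hab (le_of_lt ha.2)

lemma LipschitzOnCompacts.continuousOn {f : ℝ → ℝ} (h : LipschitzOnCompacts f) :
    ContinuousOn f (Ici 0) := h.locallyLipschitzOn.continuousOn

lemma LipschitzOnCompacts.add {f g : ℝ → ℝ} (hf : LipschitzOnCompacts f)
    (hg : LipschitzOnCompacts g) : LipschitzOnCompacts (fun t => f t + g t) := by
  intro T hT
  obtain ⟨K, hK0, hK⟩ := hf T hT
  obtain ⟨K', hK0', hK'⟩ := hg T hT
  refine ⟨K + K', by positivity, fun s t h0 hst htT => ?_⟩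
  have e : f t + g t - (f s + g s) = (f t - f s) + (g t - g s) := by ring
  rw [e, add_mul]
  exact (abs_add_le _ _).trans (add_le_add (hK s t h0 hst htT) (hK' s t h0 hst htT))

lemma LipschitzOnCompacts.const_mul {f : ℝ → ℝ} (hf : LipschitzOnCompacts f) (c : ℝ) :
    LipschitzOnCompacts (fun t => c * f t) := by
  intro T hT
  obtain ⟨K, hK0, hK⟩ := hf T hT
  refine ⟨|c| * K, by positivity, fun s t h0 hst htT => ?_⟩
  rw [← mul_sub, abs_mul, mul_assoc]
  exact mul_le_mul_of_nonneg_left (hK s t h0 hst htT) (abs_nonneg c)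

lemma lipschitzOnCompacts_const (c : ℝ) : LipschitzOnCompacts (fun _ => c) :=
  fun _ _ => ⟨0, le_rfl, fun s t _ _ _ => by simp⟩

lemma lipschitzOnCompacts_integral {g : ℝ → ℝ}
    (hi : ∀ T, 0 ≤ T → IntervalIntegrable g volume 0 T)
    (hb : ∀ T, 0 ≤ T → ∃ C, ∀ t ∈ Icc 0 T, |g t| ≤ C) :
    LipschitzOnCompacts (fun t => ∫ s in (0:ℝ)..t, g s) := by
  intro T hT
  obtain ⟨C, hC⟩ := hb T hT
  refine ⟨C, (abs_nonneg _).trans (hC 0 ⟨le_rfl, hT⟩), fun s t h0 hst htT => ?_⟩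
  rw [intervalIntegral.integral_interval_sub_left (hi t (h0.trans hst)) (hi s h0)]
  have := intervalIntegral.norm_integral_le_of_norm_le_const (f := g) (C := C)
    (a := s) (b := t) (fun v hv => by
      rw [uIoc_of_le hst] at hv
      exact hC v ⟨h0.trans hv.1.le, hv.2.trans htT⟩)
  rwa [Real.norm_eq_abs, abs_of_nonneg (sub_nonneg.2 hst)] at this

/-- Replacing `g s` by `g (max s 0)` gives a continuous function on the line with the same integrals
from 0, so the fundamental theorem applies at `t = 0` too. -/
lemma hasDerivWithinAt_of_integral {f g : ℝ → ℝ} {c : ℝ} (hg : ContinuousOn g (Ici 0))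
    (h : ∀ t, 0 ≤ t → f t = c + ∫ s in (0:ℝ)..t, g s) {t : ℝ} (ht : 0 ≤ t) :
    HasDerivWithinAt f (g t) (Ici 0) t := by
  have hG : Continuous fun s => g (max s 0) :=
    hg.comp_continuous (by fun_prop) fun s => mem_Ici.2 (le_max_right _ _)
  have h1 : HasDerivWithinAt (fun t => c + ∫ s in (0:ℝ)..t, g (max s 0)) (g (max t 0)) (Ici 0) t :=
    ((hG.integral_hasStrictDerivAt 0 t).hasDerivAt.const_add c).hasDerivWithinAt
  rw [max_eq_left ht] at h1
  have heq : ∀ t, 0 ≤ t → f t = c + ∫ s in (0:ℝ)..t, g (max s 0) := by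
    intro t ht
    rw [h t ht]
    congr 1
    refine intervalIntegral.integral_congr fun s hs => ?_
    rw [uIcc_of_le ht] at hs
    simp only [max_eq_left hs.1]
  exact h1.congr (fun s hs => heq s hs) (heq t ht)

/-! ### Regularity and derivatives of exact solutions -/

namespace IsExactSolution

variable {p : Params} {x y w : ℝ → ℝ}

lemma y_eq (h : IsExactSolution p x y w) {t : ℝ} (ht : 0 ≤ t) :
    y t = y 0 + ∫ s in (0:ℝ)..t, driftY p x y w s := by
  have : y t - y 0 = ∫ s in (0:ℝ)..t, driftY p x y w s :=
    eq_of_forall_abs_sub_le fun δ hδ => (h t ht δ hδ).y_eq t ⟨ht, le_rfl⟩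
  linarith

lemma w_eq (h : IsExactSolution p x y w) {t : ℝ} (ht : 0 ≤ t) :
    w t = w 0 + ∫ s in (0:ℝ)..t, driftW p x y w s := by
  have : w t - w 0 = ∫ s in (0:ℝ)..t, driftW p x y w s :=
    eq_of_forall_abs_sub_le fun δ hδ => (h t ht δ hδ).w_eq t ⟨ht, le_rfl⟩
  linarith

lemma x_ge (h : IsExactSolution p x y w) {t : ℝ} (ht : 0 ≤ t) : boundary p ≤ x t :=
  (h t ht 1 one_pos).x_ge t ⟨ht, le_rfl⟩

lemma reg_ge (h : IsExactSolution p x y w) {s t : ℝ} (hs : 0 ≤ s) (hst : s ≤ t) :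
    max 0 (boundary p - freeX p x y s) ≤ x t - freeX p x y t :=
  le_of_forall_pos_le_add fun δ hδ =>
    (h t (hs.trans hst) δ hδ).reg_ge t ⟨hs.trans hst, le_rfl⟩ s ⟨hs, hst⟩

lemma reg_le (h : IsExactSolution p x y w) {t : ℝ} (ht : 0 ≤ t) {δ : ℝ} (hδ : 0 < δ) :
    ∃ s ∈ Icc 0 t, x t - freeX p x y t ≤ max 0 (boundary p - freeX p x y s) + δ :=
  (h t ht δ hδ).reg_le t ⟨ht, le_rfl⟩

lemma reg_mono (h : IsExactSolution p x y w) {s t : ℝ} (hs : 0 ≤ s) (hst : s ≤ t) :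
    x s - freeX p x y s ≤ x t - freeX p x y t := by
  refine le_of_forall_pos_le_add fun δ hδ => ?_
  obtain ⟨v, hv, h1⟩ := h.reg_le hs hδ
  exact h1.trans (by linarith [h.reg_ge hv.1 (hv.2.trans hst)])

lemma abs_driftY_le (hp : p.Admissible) (h : IsExactSolution p x y w) (T : ℝ) (hT : 0 ≤ T) :
    ∃ C, ∀ t ∈ Icc 0 T, |driftY p x y w t| ≤ C := by
  obtain ⟨C, hC⟩ := (h T hT 1 one_pos).bdd
  refine ⟨(p.β + p.μ) * (3 * C), fun t ht => ?_⟩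
  have h1 := abs_driftY_sub_le hp x y w 0 0 0 t
  obtain ⟨a1, a2, a3⟩ := hC t ht
  have e : driftY p 0 0 0 t = 0 := by simp [driftY]
  simp only [e, sub_zero, Pi.zero_apply] at h1
  refine h1.trans (mul_le_mul_of_nonneg_left (by linarith) ?_)
  linarith [hp.β_pos, hp.μ_pos]

lemma abs_driftW_le (hp : p.Admissible) (h : IsExactSolution p x y w) (T : ℝ) (hT : 0 ≤ T) :
    ∃ C, ∀ t ∈ Icc 0 T, |driftW p x y w t| ≤ C := by
  obtain ⟨C, hC⟩ := (h T hT 1 one_pos).bdd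
  refine ⟨(p.β + p.μ) * (3 * C), fun t ht => ?_⟩
  have h1 := abs_driftW_sub_le hp x y w 0 0 0 t
  obtain ⟨a1, a2, a3⟩ := hC t ht
  have e : driftW p 0 0 0 t = 0 := by simp [driftW]
  simp only [e, sub_zero, Pi.zero_apply] at h1
  refine h1.trans (mul_le_mul_of_nonneg_left (by linarith) ?_)
  linarith [hp.β_pos, hp.μ_pos]

lemma lipschitz_y (hp : p.Admissible) (h : IsExactSolution p x y w) : LipschitzOnCompacts y := by
  have h1 := lipschitzOnCompacts_integral (g := driftY p x y w) (fun T hT =>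
    intervalIntegrable_driftY (h T hT 1 one_pos).int_x (h T hT 1 one_pos).int_y
      (h T hT 1 one_pos).int_w) (h.abs_driftY_le hp)
  intro T hT
  obtain ⟨K, hK0, hK⟩ := h1 T hT
  refine ⟨K, hK0, fun s t h0 hst htT => ?_⟩
  rw [h.y_eq h0, h.y_eq (h0.trans hst), add_sub_add_left_eq_sub]
  exact hK s t h0 hst htT

lemma lipschitz_w (hp : p.Admissible) (h : IsExactSolution p x y w) : LipschitzOnCompacts w := by
  have h1 := lipschitzOnCompacts_integral (g := driftW p x y w) (fun T hT =>
    intervalIntegrable_driftW (h T hT 1 one_pos).int_x (h T hT 1 one_pos).int_y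
      (h T hT 1 one_pos).int_w) (h.abs_driftW_le hp)
  intro T hT
  obtain ⟨K, hK0, hK⟩ := h1 T hT
  refine ⟨K, hK0, fun s t h0 hst htT => ?_⟩
  rw [h.w_eq h0, h.w_eq (h0.trans hst), add_sub_add_left_eq_sub]
  exact hK s t h0 hst htT

lemma lipschitz_freeX (hp : p.Admissible) (h : IsExactSolution p x y w) :
    LipschitzOnCompacts (freeX p x y) := by
  have h1 := lipschitzOnCompacts_integral (g := y) (fun T hT => (h T hT 1 one_pos).int_y)
    (fun T hT => by
      obtain ⟨C, hC⟩ := (h T hT 1 one_pos).bdd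
      exact ⟨C, fun t ht => (hC t ht).2.1⟩)
  have h2 := ((lipschitzOnCompacts_const (x 0 + p.γ * y 0)).add
    ((h.lipschitz_y hp).const_mul (-p.γ))).add (h1.const_mul (-p.ε))
  have e : freeX p x y = fun t => x 0 + p.γ * y 0 + -p.γ * y t + -p.ε * ∫ s in (0:ℝ)..t, y s := by
    ext t; unfold freeX; ring
  rw [e]
  exact h2

/-- The regulator inherits the Lipschitz constant of `freeX`: if the supremum up to `t` is nearly
attained at `v ≤ s`, there is essentially no increase after `s`; otherwise the increase is at most
the variation of `freeX` between `s` and `v`. -/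
lemma lipschitz_x (hp : p.Admissible) (h : IsExactSolution p x y w) : LipschitzOnCompacts x := by
  have h1 : LipschitzOnCompacts (fun t => x t - freeX p x y t) := by
    intro T hT
    obtain ⟨K, hK0, hK⟩ := h.lipschitz_freeX hp T hT
    refine ⟨K, hK0, fun s t h0 hst htT => ?_⟩
    rw [abs_of_nonneg (sub_nonneg.2 (h.reg_mono h0 hst)), sub_le_iff_le_add]
    refine le_of_forall_pos_le_add fun δ hδ => ?_
    obtain ⟨v, hv, h1⟩ := h.reg_le (h0.trans hst) hδ
    refine h1.trans (add_le_add_left ?_ δ)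
    rcases le_total v s with hvs | hvs
    · have := h.reg_ge hv.1 hvs
      have := mul_nonneg hK0 (sub_nonneg.2 hst)
      linarith
    · have h2 := h.reg_ge h0 le_rfl
      have h3 := abs_max_sub_max_le (boundary p) (freeX p x y v) (freeX p x y s)
      have h4 := hK s v h0 hvs (hv.2.trans htT)
      have h5 : K * (v - s) ≤ K * (t - s) :=
        mul_le_mul_of_nonneg_left (by linarith [hv.2]) hK0
      linarith
  have h2 := h1.add (h.lipschitz_freeX hp)
  simpa using h2

lemma continuousOn_driftY (hp : p.Admissible) (h : IsExactSolution p x y w) :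
    ContinuousOn (driftY p x y w) (Ici 0) :=
  ((h.lipschitz_x hp).continuousOn.const_mul _).add
    (((h.lipschitz_w hp).continuousOn.sub (h.lipschitz_y hp).continuousOn.abs).const_mul _)

lemma continuousOn_driftW (hp : p.Admissible) (h : IsExactSolution p x y w) :
    ContinuousOn (driftW p x y w) (Ici 0) :=
  ((h.lipschitz_x hp).continuousOn.const_mul _).add
    (((h.lipschitz_w hp).continuousOn.sub (h.lipschitz_y hp).continuousOn.abs).const_mul _)

lemma hasDeriv_y (hp : p.Admissible) (h : IsExactSolution p x y w) {t : ℝ} (ht : 0 ≤ t) :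
    HasDerivWithinAt y (driftY p x y w t) (Ici 0) t :=
  hasDerivWithinAt_of_integral (h.continuousOn_driftY hp) (fun _ => h.y_eq) ht

lemma hasDeriv_w (hp : p.Admissible) (h : IsExactSolution p x y w) {t : ℝ} (ht : 0 ≤ t) :
    HasDerivWithinAt w (driftW p x y w t) (Ici 0) t :=
  hasDerivWithinAt_of_integral (h.continuousOn_driftW hp) (fun _ => h.w_eq) ht

lemma hasDeriv_freeX (hp : p.Admissible) (h : IsExactSolution p x y w) {t : ℝ} (ht : 0 ≤ t) :
    HasDerivWithinAt (freeX p x y) (-p.γ * driftY p x y w t - p.ε * y t) (Ici 0) t := by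
  have h1 : HasDerivWithinAt (fun t => ∫ s in (0:ℝ)..t, y s) (y t) (Ici 0) t :=
    hasDerivWithinAt_of_integral (c := 0) (h.lipschitz_y hp).continuousOn (fun t _ => by simp) ht
  have h2 := ((((h.hasDeriv_y hp ht).sub_const (y 0)).const_mul (p.γ : ℝ)).const_sub (x 0)).sub
    (h1.const_mul p.ε)
  rw [← neg_mul] at h2
  exact h2

/-- The regulator is constant while `x` stays away from the boundary. -/
lemma reg_eq_of_boundary_lt (hp : p.Admissible) (h : IsExactSolution p x y w) {s t : ℝ}
    (hs : 0 ≤ s) (hst : s ≤ t) (hx : ∀ v ∈ Icc s t, boundary p < x v) :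
    x s - freeX p x y s = x t - freeX p x y t := by
  have hc : ContinuousOn x (Icc s t) :=
    (h.lipschitz_x hp).continuousOn.mono fun v hv => hs.trans hv.1
  obtain ⟨v₀, hv₀, hmin⟩ := isCompact_Icc.exists_isMinOn (nonempty_Icc.2 hst) hc
  refine le_antisymm (h.reg_mono hs hst) ?_
  by_contra hlt
  rw [not_le] at hlt
  set L := fun t => x t - freeX p x y t with hL
  -- The two bounds on `δ` exclude every position of the near-maximiser `v`: for `v ≤ s` the
  -- regulator would not have grown enough, and for `v ≥ s` either the same happens or `x v ≤
  -- boundary p + δ`, below the minimum `x v₀`.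
  obtain ⟨v, hv, h1⟩ := h.reg_le (hs.trans hst)
    (δ := min ((x v₀ - boundary p) / 2) ((L t - L s) / 2))
    (lt_min (by linarith [hx v₀ hv₀]) (by simp only [hL]; linarith))
  have hm1 := min_le_left ((x v₀ - boundary p) / 2) ((L t - L s) / 2)
  have hm2 := min_le_right ((x v₀ - boundary p) / 2) ((L t - L s) / 2)
  set δ := min ((x v₀ - boundary p) / 2) ((L t - L s) / 2)
  rcases le_total v s with hvs | hvs
  · have := h.reg_ge hv.1 hvs
    simp only [hL] at hm2
    linarith
  · have h2 := h.reg_mono (hs.trans hvs) hv.2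
    have h3 : x v₀ ≤ x v := hmin ⟨hvs, hv.2⟩
    have h5 := h.reg_ge hs le_rfl
    have h6 := le_max_left 0 (boundary p - freeX p x y s)
    have h7 := hx v ⟨hvs, hv.2⟩
    have h8 := hx v₀ hv₀
    simp only [hL] at hm2
    rcases max_cases 0 (boundary p - freeX p x y v) with ⟨h9, -⟩ | ⟨h9, -⟩
    · rw [h9] at h1
      linarith
    · rw [h9] at h1
      linarith

lemma hasDeriv_x_of_boundary_lt (hp : p.Admissible) (h : IsExactSolution p x y w) {t : ℝ}
    (ht : 0 ≤ t) (hx : boundary p < x t) :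
    HasDerivWithinAt x (-p.γ * driftY p x y w t - p.ε * y t) (Ici 0) t := by
  have hev : ∀ᶠ s in 𝓝[Ici 0] t, boundary p < x s :=
    ((h.lipschitz_x hp).continuousOn t ht).eventually_const_lt hx
  obtain ⟨ρ, hρ, hball⟩ := Metric.mem_nhdsWithin_iff.1 hev
  have h1 : HasDerivWithinAt (fun s => freeX p x y s + (x t - freeX p x y t))
      (-p.γ * driftY p x y w t - p.ε * y t) (Ici 0) t := (h.hasDeriv_freeX hp ht).add_const _
  refine h1.congr_of_eventuallyEq ?_ (by ring)
  filter_upwards [inter_mem_nhdsWithin (Ici 0) (Metric.ball_mem_nhds t hρ)] with s hs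
  have hs0 : 0 ≤ s := hs.1
  have hs1 := hs.2
  rw [Metric.mem_ball, Real.dist_eq, abs_lt] at hs1
  have hin : ∀ v, 0 ≤ v → -ρ < v - t → v - t < ρ → boundary p < x v := fun v hv h1 h2 =>
    hball ⟨by rw [Metric.mem_ball, Real.dist_eq, abs_lt]; exact ⟨h1, h2⟩, hv⟩
  rcases le_total s t with hst | hst
  · have := h.reg_eq_of_boundary_lt hp hs0 hst fun v hv =>
      hin v (hs0.trans hv.1) (by linarith [hv.1, hs1.1]) (by linarith [hv.2])
    linarith
  · have := h.reg_eq_of_boundary_lt hp ht hst fun v hv =>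
      hin v (ht.trans hv.1) (by linarith [hv.1]) (by linarith [hv.2, hs1.2])
    linarith

/-- Right slopes suffice. `d ≥ 0` because `x` starts at its lower bound, and `d ≥ u'` because the
regulator is nondecreasing. If `d > 0`, then `x` exceeds the boundary just after `t`, the regulator
is constant there, and `d = u'`. -/
lemma deriv_x_of_eq_boundary (hp : p.Admissible) (h : IsExactSolution p x y w) {t d : ℝ}
    (ht : 0 ≤ t) (hx : x t = boundary p) (hd : HasDerivWithinAt x d (Ici 0) t) :
    d = max (-p.γ * driftY p x y w t - p.ε * y t) 0 := by
  set u' := -p.γ * driftY p x y w t - p.ε * y t with hu'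
  have hsub : Ioi t ⊆ Ici 0 := fun s hs => ht.trans (le_of_lt hs)
  have hdx : Tendsto (slope x t) (𝓝[>] t) (𝓝 d) :=
    (hasDerivWithinAt_iff_tendsto_slope' (by simp)).1 (hd.mono hsub)
  have hdu : Tendsto (slope (freeX p x y) t) (𝓝[>] t) (𝓝 u') :=
    (hasDerivWithinAt_iff_tendsto_slope' (by simp)).1 ((h.hasDeriv_freeX hp ht).mono hsub)
  have hgt : ∀ᶠ s in 𝓝[>] t, t < s := self_mem_nhdsWithin
  have hd0 : 0 ≤ d := by
    refine ge_of_tendsto hdx (hgt.mono fun s hs => ?_)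
    rw [slope_def_field]
    exact div_nonneg (by rw [hx]; linarith [h.x_ge (ht.trans hs.le)]) (by linarith)
  have hdu' : u' ≤ d := by
    refine le_of_tendsto_of_tendsto hdu hdx (hgt.mono fun s hs => ?_)
    simp only [slope_def_field]
    have := h.reg_mono ht hs.le
    exact div_le_div_of_nonneg_right (by linarith) (by linarith)
  rcases hd0.eq_or_lt with h0 | h0
  · rw [← h0] at hdu' ⊢
    exact (max_eq_right hdu').symm
  · have hpos : ∀ᶠ s in 𝓝[>] t, 0 < slope x t s := hdx.eventually_const_lt h0
    obtain ⟨b, hb, hball⟩ := mem_nhdsGT_iff_exists_Ioo_subset.1 (hpos.and hgt)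
    have hb : t < b := hb
    have hxpos : ∀ s ∈ Ioo t b, boundary p < x s := by
      intro s hs
      have h1 : 0 < slope x t s := (hball hs).1
      rw [slope_def_field, hx] at h1
      have := (div_pos_iff_of_pos_right (sub_pos.2 hs.1)).1 h1
      linarith
    have hconst : ∀ s ∈ Ioo t b, x t - freeX p x y t = x s - freeX p x y s := by
      intro s hs
      have hcont : Tendsto (fun v => x v - freeX p x y v) (𝓝[>] t) (𝓝 (x t - freeX p x y t)) :=
        (((h.lipschitz_x hp).continuousOn t ht).sub
          ((h.lipschitz_freeX hp).continuousOn t ht)).mono_left (nhdsWithin_mono t hsub)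
      refine tendsto_nhds_unique hcont (tendsto_const_nhds.congr' ?_)
      filter_upwards [Ioo_mem_nhdsGT hs.1] with v hv
      exact (h.reg_eq_of_boundary_lt hp (ht.trans hv.1.le) hv.2.le fun z hz =>
        hxpos z ⟨hv.1.trans_le hz.1, hz.2.trans_lt hs.2⟩).symm
    have heq : d = u' := by
      refine tendsto_nhds_unique hdx (hdu.congr' ?_)
      filter_upwards [Ioo_mem_nhdsGT hb] with s hs
      rw [slope_def_field, slope_def_field]
      have := hconst s hs
      congr 1
      linarith
    rw [← heq, max_eq_left hd0]

/-- Continuous drifts make `y` and `w` differentiable everywhere, so regularity enters only through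
the singleton family `{x}`. -/
lemma fluidSystemAt (hp : p.Admissible) (h : IsExactSolution p x y w) {t : ℝ}
    (ht : IsRegularPoint ![x, y, w] t) : FluidSystemAt p x y w t := by
  obtain ⟨ht0, hreg⟩ := ht
  have hdx : DifferentiableWithinAt ℝ x (Ici 0) t := by
    simpa using (hreg {0} (by simp)).1
  refine ⟨derivWithin x (Ici 0) t, driftY p x y w t, driftW p x y w t, hdx.hasDerivWithinAt,
    h.hasDeriv_y hp ht0, h.hasDeriv_w hp ht0, fun hlt => ?_, fun heq => ?_, rfl, rfl⟩
  · exact (h.hasDeriv_x_of_boundary_lt hp ht0 hlt).derivWithin (uniqueDiffOn_Ici 0 t ht0)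
  · exact h.deriv_x_of_eq_boundary hp ht0 heq hdx.hasDerivWithinAt

end IsExactSolution

/-! ### Balance equations along a sample path -/

/-- The number of events with mark `c` among the first `n` events. -/
def markCount (p : Params) (s₀ : State) (e : ℕ → Event) (c : Event × Bool) (n : ℕ) : ℝ :=
  ∑ i ∈ Finset.range n, mark c (stateAfter p s₀ e i) (e i)

/-- The number of events of kind `a` among the first `n` events. -/
def eventCount (p : Params) (s₀ : State) (e : ℕ → Event) (a : Event) (n : ℕ) : ℝ :=
  markCount p s₀ e (a, true) n + markCount p s₀ e (a, false) n

lemma mark_add_mark (a : Event) (s : State) (e : Event) :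
    mark (a, true) s e + mark (a, false) s e = if e = a then 1 else 0 := by
  unfold mark
  by_cases h : e = a <;> by_cases h2 : 0 < s.Y <;> simp [h, h2]

lemma markRate_add_markRate (p : Params) (Λ : ℝ) (a : Event) (s : State) :
    markRate p Λ (a, true) s + markRate p Λ (a, false) s = eventRate p Λ s a := by
  unfold markRate
  by_cases h2 : 0 < s.Y <;> simp [h2]

lemma sum_mark (s : State) (e : Event) : ∑ c, mark c s e = 1 := by
  rw [Fintype.sum_prod_type]
  simp only [Fintype.sum_bool, mark_add_mark]
  simp

lemma sum_markRate (p : Params) (Λ : ℝ) (s : State) :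
    ∑ c, markRate p Λ c s = totalRate p Λ s := by
  rw [Fintype.sum_prod_type, totalRate_eq_sum]
  simp only [Fintype.sum_bool, markRate_add_markRate]

lemma sum_markCount (p : Params) (s₀ : State) (e : ℕ → Event) (n : ℕ) :
    ∑ c, markCount p s₀ e c n = n := by
  simp only [markCount]
  rw [Finset.sum_comm]
  simp [sum_mark]

lemma eventCount_zero (p : Params) (s₀ : State) (e : ℕ → Event) (a : Event) :
    eventCount p s₀ e a 0 = 0 := by
  simp [eventCount, markCount]

lemma eventCount_succ (p : Params) (s₀ : State) (e : ℕ → Event) (a : Event) (n : ℕ) :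
    eventCount p s₀ e a (n + 1) = eventCount p s₀ e a n + if e n = a then 1 else 0 := by
  rw [← mark_add_mark a (stateAfter p s₀ e n)]
  simp only [eventCount, markCount, Finset.sum_range_succ]
  ring

lemma cast_W (s : State) : (s.W : ℝ) = |(s.Y : ℝ)| + 2 * s.Z := by
  unfold State.W
  push_cast
  ring

/-- Rules out truncation in `s.Z - 1`, which would break the balance of `W`. -/
lemma one_le_Z_of_rate_pos {p : Params} {Λ : ℝ} {s : State}
    (h : 0 < eventRate p Λ s .completionReturn ∨ 0 < eventRate p Λ s .completionLeave) :
    1 ≤ s.Z := by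
  by_contra h0
  have : s.Z = 0 := by omega
  simp [eventRate, this] at h

lemma balance_Y (p : Params) (s₀ : State) (e : ℕ → Event) (n : ℕ) :
    ((stateAfter p s₀ e n).Y : ℝ) = s₀.Y - eventCount p s₀ e .arrival n
      + eventCount p s₀ e .acceptance n + eventCount p s₀ e .completionReturn n := by
  induction n with
  | zero => simp [eventCount_zero, stateAfter]
  | succ n ih =>
    simp only [eventCount_succ, stateAfter]
    generalize stateAfter p s₀ e n = s at *
    cases e n <;> simp [nextState, ih] <;> ring

/-- Matching does not change `W`: a waiting customer or agent who enters service moves from `|Y|`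
into a pair counted by `2 * Z`. So each kind of event changes `W` by a constant, whatever the sign
of `Y`. -/
lemma balance_W {p : Params} {Λ : ℝ} {s₀ : State} {e : ℕ → Event}
    (he : ∀ k, 0 < eventRate p Λ (stateAfter p s₀ e k) (e k)) (n : ℕ) :
    ((stateAfter p s₀ e n).W : ℝ) = s₀.W + eventCount p s₀ e .arrival n
      + eventCount p s₀ e .acceptance n - eventCount p s₀ e .completionReturn n
      - 2 * eventCount p s₀ e .completionLeave n := by
  induction n with
  | zero => simp [eventCount_zero, stateAfter]
  | succ n ih =>
    simp only [eventCount_succ, stateAfter]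
    have hrate := he n
    generalize stateAfter p s₀ e n = s at *
    generalize e n = a at *
    have key : (nextState p s a).W = s.W + (if a = .arrival then 1 else 0)
        + (if a = .acceptance then 1 else 0) - (if a = .completionReturn then 1 else 0)
        - 2 * (if a = .completionLeave then 1 else 0) := by
      cases a
      · simp only [nextState, State.W]
        simp
        split_ifs with h
        · rw [abs_of_pos h, abs_of_nonneg (by omega)]; ring
        · rw [abs_of_nonpos (by omega), abs_of_nonpos (by omega)]; ring
      · simp only [nextState, State.W]
        simp
        split_ifs with h
        · rw [abs_of_neg h, abs_of_nonpos (by omega)]; ring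
        · rw [abs_of_nonneg (by omega), abs_of_nonneg (by omega)]; ring
      · simp [nextState, State.W]
      · have hZ := one_le_Z_of_rate_pos (Or.inl hrate)
        simp only [nextState, State.W]
        simp
        split_ifs with h
        · rw [abs_of_neg h, abs_of_nonpos (by omega)]; ring
        · rw [abs_of_nonneg (by omega), abs_of_nonneg (by omega)]
          push_cast [Nat.cast_sub hZ]; ring
      · have hZ := one_le_Z_of_rate_pos (Or.inr hrate)
        simp only [nextState, State.W]
        simp
        push_cast [Nat.cast_sub hZ]; ring
    rw [key]
    push_cast
    rw [ih]
    ring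

/-- The cumulative regulation of the number of pending invitations at zero. -/
def regulator (p : Params) (s₀ : State) (e : ℕ → Event) (n : ℕ) : ℝ :=
  (stateAfter p s₀ e n).X - s₀.X + p.γ * ((stateAfter p s₀ e n).Y - s₀.Y)
    + (markCount p s₀ e (.additional, true) n - markCount p s₀ e (.additional, false) n)

lemma regulator_zero (p : Params) (s₀ : State) (e : ℕ → Event) : regulator p s₀ e 0 = 0 := by
  simp [regulator, stateAfter, markCount]

/-- Without truncation the changes of `X`, `γ Y` and the signed additional count cancel. Truncation
adds `γ - min γ X ≥ 0` at an acceptance or a return, and 1 at an additional event with `X = 0` and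
`Y > 0`; in all these cases, if the addition is nonzero, the step ends with `X = 0`. -/
lemma regulator_succ {p : Params} {Λ : ℝ} {s₀ : State} {e : ℕ → Event}
    (he : ∀ k, 0 < eventRate p Λ (stateAfter p s₀ e k) (e k)) (n : ℕ) :
    regulator p s₀ e n ≤ regulator p s₀ e (n + 1) ∧
      (regulator p s₀ e (n + 1) = regulator p s₀ e n ∨ (stateAfter p s₀ e (n + 1)).X = 0) := by
  have hrate := he n
  have e1 : regulator p s₀ e (n + 1) = regulator p s₀ e n
      + (((stateAfter p s₀ e (n + 1)).X - (stateAfter p s₀ e n).X : ℝ)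
        + p.γ * ((stateAfter p s₀ e (n + 1)).Y - (stateAfter p s₀ e n).Y)
        + (mark (.additional, true) (stateAfter p s₀ e n) (e n)
          - mark (.additional, false) (stateAfter p s₀ e n) (e n))) := by
    simp only [regulator, markCount, Finset.sum_range_succ]
    ring
  rw [e1]
  simp only [stateAfter]
  generalize stateAfter p s₀ e n = s at *
  generalize e n = a at *
  generalize regulator p s₀ e n = R at *
  suffices h : 0 ≤ (((nextState p s a).X - s.X : ℝ) + p.γ * ((nextState p s a).Y - s.Y)
        + (mark (.additional, true) s a - mark (.additional, false) s a)) ∧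
      ((((nextState p s a).X - s.X : ℝ) + p.γ * ((nextState p s a).Y - s.Y)
        + (mark (.additional, true) s a - mark (.additional, false) s a)) = 0 ∨
        (nextState p s a).X = 0) by
    refine ⟨by linarith [h.1], h.2.imp (fun h => by rw [h]; ring) id⟩
  have hsub : ((s.X - min p.γ s.X : ℕ) : ℝ) - s.X + p.γ * ((s.Y + 1 : ℤ) - s.Y : ℝ)
      = p.γ - min p.γ s.X := by
    rw [Nat.cast_sub (min_le_right _ _)]
    push_cast
    ring
  have hreg : (0:ℝ) ≤ p.γ - (min p.γ s.X : ℕ) ∧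
      ((p.γ - (min p.γ s.X : ℕ) : ℝ) = 0 ∨ s.X - min p.γ s.X = 0) := by
    constructor
    · rw [sub_nonneg]; exact_mod_cast min_le_left _ _
    · rcases le_total p.γ s.X with h | h
      · left; rw [min_eq_left h, sub_self]
      · right; rw [min_eq_right h, Nat.sub_self]
  push_cast at hsub hreg
  cases a
  · simp [nextState, mark]
  · simp only [nextState, mark]
    simpa [hsub, neg_add_eq_sub] using hreg
  · have hY : s.Y ≠ 0 := by
      rintro h
      simp [eventRate, h] at hrate
    rcases lt_or_gt_of_ne hY with h | h
    · by_cases hX : 1 ≤ s.X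
      · simp [nextState, mark, hX, Int.sign_eq_neg_one_of_neg h, not_lt.2 h.le]

      · have hX0 : s.X = 0 := by omega
        simp [nextState, mark, hX0, h, not_lt.2 h.le]
    · by_cases hX : 1 ≤ s.X
      · simp only [nextState, mark, if_pos hX, Int.sign_eq_one_of_pos h]
        have : ((s.X : ℤ) - 1).toNat = s.X - 1 := by omega
        rw [this]
        simp [h, Nat.cast_sub hX]
      · have hX0 : s.X = 0 := by omega
        simp [nextState, mark, hX0, h, not_lt.2 h.le]
  · simp only [nextState, mark]
    simpa [hsub, neg_add_eq_sub] using hreg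
  · simp [nextState, mark]

lemma regulator_mono {p : Params} {Λ : ℝ} {s₀ : State} {e : ℕ → Event}
    (he : ∀ k, 0 < eventRate p Λ (stateAfter p s₀ e k) (e k)) : Monotone (regulator p s₀ e) :=
  monotone_nat_of_le_succ fun n => (regulator_succ he n).1

/-- Discrete complementarity: `i` is an index since which the regulator has not grown, either the
start or one with `X = 0`. It provides the near-maximiser in `reg_le`. -/
lemma exists_regulator_eq {p : Params} {Λ : ℝ} {s₀ : State} {e : ℕ → Event}
    (he : ∀ k, 0 < eventRate p Λ (stateAfter p s₀ e k) (e k)) (n : ℕ) :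
    ∃ i ≤ n, regulator p s₀ e n = regulator p s₀ e i ∧
      (regulator p s₀ e i = 0 ∨ (stateAfter p s₀ e i).X = 0) := by
  induction n with
  | zero => exact ⟨0, le_rfl, rfl, Or.inl (regulator_zero p s₀ e)⟩
  | succ n ih =>
    obtain ⟨i, hi, h1, h2⟩ := ih
    rcases (regulator_succ he n).2 with h | h
    · exact ⟨i, by omega, h.trans h1, h2⟩
    · exact ⟨n + 1, le_rfl, rfl, Or.inr h⟩

/-! ### Integrals along a sample path -/

namespace IsPath

variable {p : Params} {Λ : ℝ} {s₀ : State} {e : ℕ → Event} {τ : ℕ → ℝ} {S : ℝ → State}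

lemma strictMono (h : IsPath p Λ s₀ e τ S) : StrictMono fun n => ∑ k ∈ Finset.range n, τ k :=
  strictMono_nat_of_lt_succ fun n => by
    simp only [Finset.sum_range_succ]
    linarith [h.time_pos n]

lemma jumpTime_nonneg (h : IsPath p Λ s₀ e τ S) (n : ℕ) : 0 ≤ ∑ k ∈ Finset.range n, τ k :=
  Finset.sum_nonneg fun k _ => (h.time_pos k).le

lemma exists_index (h : IsPath p Λ s₀ e τ S) {t : ℝ} (ht : 0 ≤ t) :
    ∃ n, ∑ k ∈ Finset.range n, τ k ≤ t ∧ t < ∑ k ∈ Finset.range (n + 1), τ k := by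
  classical
  have hex : ∃ n, t < ∑ k ∈ Finset.range n, τ k := (h.tendsto.eventually_gt_atTop t).exists
  have h0 : Nat.find hex ≠ 0 := by
    intro h0
    have := Nat.find_spec hex
    rw [h0] at this
    simp at this
    linarith
  obtain ⟨n, hn⟩ := Nat.exists_eq_succ_of_ne_zero h0
  refine ⟨n, not_lt.1 (Nat.find_min hex (by omega)), ?_⟩
  have := Nat.find_spec hex
  rwa [hn] at this

lemma integral_step (h : IsPath p Λ s₀ e τ S) (f : State → ℝ) (n : ℕ) {t : ℝ}
    (h1 : ∑ k ∈ Finset.range n, τ k ≤ t) (h2 : t ≤ ∑ k ∈ Finset.range (n + 1), τ k) :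
    IntervalIntegrable (fun s => f (S s)) volume (∑ k ∈ Finset.range n, τ k) t ∧
      ∫ s in (∑ k ∈ Finset.range n, τ k)..t, f (S s) =
        f (stateAfter p s₀ e n) * (t - ∑ k ∈ Finset.range n, τ k) := by
  -- Only almost everywhere: when `t` is the next jump time, `S t` is already the next state.
  have hae : ∀ᵐ s : ℝ, s ∈ uIoc (∑ k ∈ Finset.range n, τ k) t →
      f (S s) = f (stateAfter p s₀ e n) := by
    have hne : ∀ᵐ s : ℝ, s ≠ t := by simp [ae_iff]
    filter_upwards [hne] with s hs hmem
    rw [uIoc_of_le h1] at hmem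
    rw [h.eq n s hmem.1.le ((lt_of_le_of_ne hmem.2 hs).trans_le h2)]
  constructor
  · refine (intervalIntegrable_const (c := f (stateAfter p s₀ e n))).congr_ae ?_
    rw [Filter.EventuallyEq, ae_restrict_iff' measurableSet_uIoc]
    filter_upwards [hae] with s hs hmem
    exact (hs hmem).symm
  · rw [intervalIntegral.integral_congr_ae hae, intervalIntegral.integral_const, smul_eq_mul,
      mul_comm]

lemma integral_jumpTime (h : IsPath p Λ s₀ e τ S) (f : State → ℝ) (n : ℕ) :
    IntervalIntegrable (fun s => f (S s)) volume 0 (∑ k ∈ Finset.range n, τ k) ∧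
      ∫ s in (0:ℝ)..(∑ k ∈ Finset.range n, τ k), f (S s) =
        ∑ i ∈ Finset.range n, f (stateAfter p s₀ e i) * τ i := by
  induction n with
  | zero => simp
  | succ n ih =>
    obtain ⟨a1, a2⟩ := h.integral_step f n (h.strictMono.monotone (Nat.le_succ n)) le_rfl
    refine ⟨ih.1.trans a1, ?_⟩
    rw [← intervalIntegral.integral_add_adjacent_intervals ih.1 a1, ih.2, a2,
      Finset.sum_range_succ (fun i => f (stateAfter p s₀ e i) * τ i), Finset.sum_range_succ τ]
    ring

lemma integral_eq (h : IsPath p Λ s₀ e τ S) (f : State → ℝ) (n : ℕ) {t : ℝ}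
    (h1 : ∑ k ∈ Finset.range n, τ k ≤ t) (h2 : t ≤ ∑ k ∈ Finset.range (n + 1), τ k) :
    IntervalIntegrable (fun s => f (S s)) volume 0 t ∧
      ∫ s in (0:ℝ)..t, f (S s) = ∑ i ∈ Finset.range n, f (stateAfter p s₀ e i) * τ i
        + f (stateAfter p s₀ e n) * (t - ∑ k ∈ Finset.range n, τ k) := by
  obtain ⟨a1, a2⟩ := h.integral_step f n h1 h2
  obtain ⟨b1, b2⟩ := h.integral_jumpTime f n
  refine ⟨b1.trans a1, ?_⟩
  rw [← intervalIntegral.integral_add_adjacent_intervals b1 a1, b2, a2]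

lemma intervalIntegrable (h : IsPath p Λ s₀ e τ S) (f : State → ℝ) {t : ℝ} (ht : 0 ≤ t) :
    IntervalIntegrable (fun s => f (S s)) volume 0 t := by
  obtain ⟨n, h1, h2⟩ := h.exists_index ht
  exact (h.integral_eq f n h1 h2.le).1

/-- Between jumps the integrated rate lies between its values at events `n` and `n + 1`. The noise
at `n` bounds the difference from above, the noise at `n + 1` from below up to one mark. -/
lemma abs_markCount_sub_integral_le (hp : p.Admissible) (hΛ : 0 < Λ) (h : IsPath p Λ s₀ e τ S)
    (c : Event × Bool) {n : ℕ} {t ρ : ℝ} (h1 : ∑ k ∈ Finset.range n, τ k ≤ t)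
    (h2 : t < ∑ k ∈ Finset.range (n + 1), τ k) (hn : |pathNoise p Λ s₀ e τ c n| ≤ ρ)
    (hn' : |pathNoise p Λ s₀ e τ c (n + 1)| ≤ ρ) :
    |markCount p s₀ e c n - ∫ s in (0:ℝ)..t, markRate p Λ c (S s)| ≤ ρ + 1 := by
  rw [(h.integral_eq (markRate p Λ c) n h1 h2.le).2]
  rw [Finset.sum_range_succ] at h2
  have hr := markRate_nonneg hp hΛ c (stateAfter p s₀ e n)
  have e1 : pathNoise p Λ s₀ e τ c n = markCount p s₀ e c n
      - ∑ i ∈ Finset.range n, markRate p Λ c (stateAfter p s₀ e i) * τ i := by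
    simp only [pathNoise, markCount, Finset.sum_sub_distrib]
  have e2 : pathNoise p Λ s₀ e τ c (n + 1) = pathNoise p Λ s₀ e τ c n
      + (mark c (stateAfter p s₀ e n) (e n) - markRate p Λ c (stateAfter p s₀ e n) * τ n) := by
    simp only [pathNoise, Finset.sum_range_succ]
  have h3 := mark_le_one c (stateAfter p s₀ e n) (e n)
  have h4 : 0 ≤ markRate p Λ c (stateAfter p s₀ e n) * (t - ∑ k ∈ Finset.range n, τ k) :=
    mul_nonneg hr (by linarith)
  have h5 : markRate p Λ c (stateAfter p s₀ e n) * (t - ∑ k ∈ Finset.range n, τ k) ≤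
      markRate p Λ c (stateAfter p s₀ e n) * τ n := mul_le_mul_of_nonneg_left (by linarith) hr
  rw [e2] at hn'
  rw [e1] at hn hn'
  rw [abs_le] at *
  constructor <;> linarith [hn.1, hn.2, hn'.1, hn'.2]

/-- A bound for the number of events before time `T`. -/
lemma lt_jumpTime (hp : p.Admissible) (hΛ : 0 < Λ) (h : IsPath p Λ s₀ e τ S) {r C ρ M T : ℝ}
    (hr : 0 < r) (hC : 0 < C) (hrate : ∀ k : ℕ, totalRate p Λ (stateAfter p s₀ e k) ≤ C * (r + k))
    (hnoise : ∀ c, ∀ k : ℕ, (k:ℝ) ≤ M → |pathNoise p Λ s₀ e τ c k| ≤ ρ)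
    (hρ : 10 * (ρ + 1) ≤ r) {n : ℕ} (hnM : (n:ℝ) + 1 ≤ M)
    (hn : 4 * Real.exp (2 * C * T) * r ≤ n) : T < ∑ k ∈ Finset.range n, τ k := by
  by_contra hlt
  rw [not_lt] at hlt
  set t' := ∑ k ∈ Finset.range n, τ k with ht'
  have ht'0 : 0 ≤ t' := h.jumpTime_nonneg n
  have hidx : ∀ t, ∃ j, 0 ≤ t → ∑ k ∈ Finset.range j, τ k ≤ t ∧ t < ∑ k ∈ Finset.range (j + 1), τ k := by
    intro t
    by_cases ht : 0 ≤ t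
    · obtain ⟨j, hj⟩ := h.exists_index ht
      exact ⟨j, fun _ => hj⟩
    · exact ⟨0, fun h => absurd h ht⟩
  choose idx hidx using hidx
  -- The contradiction hypothesis is used up to the jump time `t'` only, which keeps all indices in
  -- the range where the noise is controlled and bounds `idx` a priori.
  have hle : ∀ t ∈ Icc 0 t', idx t ≤ n := fun t ht =>
    h.strictMono.le_iff_le.1 ((hidx t ht.1).1.trans ht.2)
  have hκ : 0 < 2 * C := by positivity
  -- The event count is at most the integrated total rate, itself at most `C * r * D`, plus 10 noise
  -- terms totalling at most `r`. Hence `a = 1 + 1`, and `2 * a` is the 4 in `hn`.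
  have hmain := le_of_weighted_contraction (D := fun t => 1 + (idx t : ℝ) / r) (T := t')
    (κ := 2 * C) (a := 2) (by norm_num) hκ.le ?_ ?_
  · have h1 := hmain t' ⟨ht'0, le_rfl⟩
    have h2 : n ≤ idx t' := by
      have := (hidx t' ht'0).2
      exact Nat.lt_succ_iff.1 (h.strictMono.lt_iff_lt.1 this)
    have h3 : (n:ℝ) / r ≤ idx t' / r := by
      have : (n:ℝ) ≤ idx t' := by exact_mod_cast h2
      gcongr
    have h4 : Real.exp (2 * C * t') ≤ Real.exp (2 * C * T) := by gcongr
    have h5 : 4 * Real.exp (2 * C * T) ≤ n / r := by rwa [le_div_iff₀ hr]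
    linarith
  · refine ⟨1 + n / r, fun t ht => ?_⟩
    have : (idx t : ℝ) ≤ n := by exact_mod_cast hle t ht
    gcongr
  · intro A hA hD t ht
    obtain ⟨h1, h2⟩ := hidx t ht.1
    have hj : (idx t : ℝ) ≤ n := by exact_mod_cast hle t ht
    have hi := fun c => h.intervalIntegrable (markRate p Λ c) ht.1
    have hcount : (idx t : ℝ) ≤ (∫ s in (0:ℝ)..t, totalRate p Λ (S s)) + 10 * (ρ + 1) := by
      rw [← sum_markCount p s₀ e (idx t)]
      simp only [← sum_markRate]
      rw [intervalIntegral.integral_finsetSum (fun c _ => hi c)]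
      have hcard : (10 : ℝ) * (ρ + 1) = ∑ _c : Event × Bool, (ρ + 1) := by
        have hcard : Fintype.card (Event × Bool) = 10 := by
          rw [Fintype.card_prod, Fintype.card_bool]; rfl
        rw [Finset.sum_const, Finset.card_univ, hcard, nsmul_eq_mul]
        norm_num
      rw [hcard, ← Finset.sum_add_distrib]
      refine Finset.sum_le_sum fun c _ => ?_
      have := (abs_le.1 (h.abs_markCount_sub_integral_le hp hΛ c h1 h2
        (hnoise c _ (by linarith)) (hnoise c _ (by push_cast; linarith)))).2
      linarith
    have hint := integral_le_of_le_exp (f := fun s => totalRate p Λ (S s)) ht.1 hκ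
      (B := C * r * A) (by positivity) (fun s hs => by
        have hs' : s ∈ Icc 0 t' := ⟨hs.1, hs.2.trans ht.2⟩
        obtain ⟨b1, b2⟩ := hidx s hs.1
        rw [h.eq _ s b1 b2, abs_of_pos (totalRate_pos hp hΛ _)]
        refine (hrate _).trans ?_
        have := hD s hs'
        calc C * (r + idx s) = C * r * (1 + idx s / r) := by field_simp
          _ ≤ C * r * (A * Real.exp (2 * C * s)) := by gcongr
          _ = _ := by ring)
    have hint' := (abs_le.1 hint).2
    have e1 : C * r * A / (2 * C) * Real.exp (2 * C * t) = r * (A / 2 * Real.exp (2 * C * t)) := by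
      field_simp
    rw [e1] at hint'
    have h3 : (idx t : ℝ) / r ≤ A / 2 * Real.exp (2 * C * t) + 1 := by
      rw [div_le_iff₀ hr]
      linarith
    have h4 : 1 ≤ Real.exp (2 * C * t) := Real.one_le_exp (mul_nonneg hκ.le ht.1)
    rw [add_mul]
    linarith

lemma bounded (h : IsPath p Λ s₀ e τ S) (f : State → ℝ) (T : ℝ) :
    ∃ C, ∀ t ∈ Icc 0 T, |f (S t)| ≤ C := by
  obtain ⟨n, hn⟩ := (h.tendsto.eventually_gt_atTop T).exists
  refine ⟨∑ i ∈ Finset.range n, |f (stateAfter p s₀ e i)|, fun t ht => ?_⟩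
  obtain ⟨j, h1, h2⟩ := h.exists_index ht.1
  have hj : j < n := h.strictMono.lt_iff_lt.1 (h1.trans_lt (ht.2.trans_lt hn))
  rw [h.eq j t h1 h2]
  exact Finset.single_le_sum (f := fun i => |f (stateAfter p s₀ e i)|) (fun _ _ => abs_nonneg _)
    (Finset.mem_range.2 hj)

end IsPath

/-! ### Scaled sample paths as approximate solutions -/

namespace IsPath

variable {p : Params} {s₀ : State} {e : ℕ → Event} {τ : ℕ → ℝ} {S : ℝ → State}

/-- The scaled sample path approximately solves the reflected integral equations, provided that the
compensated counts of events are small compared with `r`. -/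
theorem approxSolution (hp : p.Admissible) {r C ρ M T : ℝ} (hr : 0 < r)
    (h : IsPath p (p.lam * r) s₀ e τ S) (hT : 0 ≤ T) (hC : 0 < C)
    (hrate : ∀ k : ℕ, totalRate p (p.lam * r) (stateAfter p s₀ e k) ≤ C * (r + k))
    (hnoise : ∀ c, ∀ k : ℕ, (k:ℝ) ≤ M → |pathNoise p (p.lam * r) s₀ e τ c k| ≤ ρ)
    (hρ : 10 * (ρ + 1) ≤ r) (hM : 4 * Real.exp (2 * C * T) * r + 2 ≤ M) :
    ApproxSolution p T (10 * ((ρ + 1) / r)) (fun t => fluidX p r (S t)) (fun t => fluidY r (S t))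
      (fun t => fluidW p r (S t)) := by
  have hΛ : 0 < p.lam * r := mul_pos hp.lam_pos hr
  have hβ := hp.β_pos
  have hμ := hp.μ_pos
  have hε := hp.ε_pos
  set Λ := p.lam * r with hΛdef
  -- `N` events outlast the time `T`; the 2 in `hM` pays for the ceiling and for the noise at index
  -- `n + 1`.
  set N := ⌈4 * Real.exp (2 * C * T) * r⌉₊ with hN
  have hN1 : 4 * Real.exp (2 * C * T) * r ≤ N := Nat.le_ceil _
  have hN2 : (N:ℝ) < 4 * Real.exp (2 * C * T) * r + 1 := Nat.ceil_lt_add_one (by positivity)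
  have hTN := h.lt_jumpTime hp hΛ hr hC hrate hnoise hρ (n := N) (by linarith) hN1
  have hM0 : 0 ≤ M := le_trans (by positivity) hM
  have hρ0 : 0 ≤ ρ := (abs_nonneg _).trans
    (hnoise (.arrival, true) 0 (by simpa using hM0))
  set q := (ρ + 1) / r with hq
  have hq0 : 0 ≤ q := by positivity
  have hqr : q * r = ρ + 1 := by rw [hq]; field_simp
  have hidx : ∀ t, ∃ j, t ∈ Icc 0 T → ∑ k ∈ Finset.range j, τ k ≤ t ∧
      t < ∑ k ∈ Finset.range (j + 1), τ k := by
    intro t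
    by_cases ht : t ∈ Icc 0 T
    · obtain ⟨j, hj⟩ := h.exists_index ht.1
      exact ⟨j, fun _ => hj⟩
    · exact ⟨0, fun h => absurd h ht⟩
  choose idx hidx using hidx
  have hS : ∀ t ∈ Icc 0 T, S t = stateAfter p s₀ e (idx t) := fun t ht =>
    h.eq _ t (hidx t ht).1 (hidx t ht).2
  have hcount : ∀ c, ∀ t ∈ Icc 0 T,
      |markCount p s₀ e c (idx t) - ∫ s in (0:ℝ)..t, markRate p Λ c (S s)| ≤ q * r := by
    intro c t ht
    obtain ⟨h1, h2⟩ := hidx t ht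
    have hj : idx t < N := h.strictMono.lt_iff_lt.1 (h1.trans_lt (ht.2.trans_lt hTN))
    have hj' : (idx t : ℝ) + 1 ≤ N := by exact_mod_cast hj
    rw [hqr]
    exact h.abs_markCount_sub_integral_le hp hΛ c h1 h2 (hnoise c _ (by linarith))
      (hnoise c _ (by push_cast; linarith))
  have hev : ∀ a, ∀ t ∈ Icc 0 T,
      |eventCount p s₀ e a (idx t) - ∫ s in (0:ℝ)..t, eventRate p Λ (S s) a| ≤ 2 * (q * r) := by
    intro a t ht
    simp only [← markRate_add_markRate]
    rw [intervalIntegral.integral_add (h.intervalIntegrable (markRate p Λ (a, true)) ht.1)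
      (h.intervalIntegrable (markRate p Λ (a, false)) ht.1), eventCount, add_sub_add_comm]
    exact (abs_add_le _ _).trans (by linarith [hcount (a, true) t ht, hcount (a, false) t ht])
  have hi := fun a {t : ℝ} (ht : 0 ≤ t) =>
    h.intervalIntegrable (fun s => eventRate p Λ s a) ht
  have h0T : (0:ℝ) ∈ Icc 0 T := ⟨le_rfl, hT⟩
  have hidx0 : ∀ i, ∑ k ∈ Finset.range i, τ k ∈ Icc 0 T → idx (∑ k ∈ Finset.range i, τ k) = i := by
    intro i hi
    obtain ⟨h1, h2⟩ := hidx _ hi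
    have := h.strictMono.le_iff_le.1 h1
    have := h.strictMono.lt_iff_lt.1 h2
    omega
  have hS0 : S 0 = s₀ := by
    have := hidx0 0 (by simpa using hT)
    rw [Finset.sum_range_zero] at this
    rw [hS 0 h0T, this]
    rfl
  have hY : ∀ s : State, fluidY r s = (s.Y : ℝ) / r := fun s => by unfold fluidY; ring
  set u := freeX p (fun t => fluidX p r (S t)) (fun t => fluidY r (S t)) with hu
  -- The sign of `Y` in the marks is needed here: `ε Y` is the rate of additional events with `Y >
  -- 0` minus the rate of those with `Y ≤ 0`. What remains is the compensated noise of these two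
  -- marks.
  have hfree : ∀ t ∈ Icc 0 T,
      |fluidX p r (S t) - u t - regulator p s₀ e (idx t) / r| ≤ 2 * q := by
    intro t ht
    have h1 := hcount (.additional, true) t ht
    have h2 := hcount (.additional, false) t ht
    have hint : p.ε * ∫ s in (0:ℝ)..t, fluidY r (S s) = 1 / r *
        ((∫ s in (0:ℝ)..t, markRate p Λ (.additional, true) (S s))
          - ∫ s in (0:ℝ)..t, markRate p Λ (.additional, false) (S s)) := by
      rw [← intervalIntegral.integral_sub (h.intervalIntegrable (markRate p Λ _) ht.1)
        (h.intervalIntegrable (markRate p Λ _) ht.1), ← intervalIntegral.integral_const_mul,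
        ← intervalIntegral.integral_const_mul]
      congr 1
      ext s
      have : p.ε * ((S s).Y : ℝ) = markRate p Λ (.additional, true) (S s)
          - markRate p Λ (.additional, false) (S s) := by
        unfold markRate
        by_cases hpos : 0 < (S s).Y
        · have : (0:ℝ) < (S s).Y := by exact_mod_cast hpos
          simp [hpos, eventRate, abs_of_pos this]
        · have : ((S s).Y : ℝ) ≤ 0 := by exact_mod_cast not_lt.1 hpos
          simp [hpos, eventRate, abs_of_nonpos this]
      rw [← this, hY]
      ring
    have e1 : fluidX p r (S t) - u t - regulator p s₀ e (idx t) / r = 1 / r *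
        ((markCount p s₀ e (.additional, false) (idx t)
            - ∫ s in (0:ℝ)..t, markRate p Λ (.additional, false) (S s))
          - (markCount p s₀ e (.additional, true) (idx t)
            - ∫ s in (0:ℝ)..t, markRate p Λ (.additional, true) (S s))) := by
      rw [hu, freeX, hint, regulator, ← hS t ht, hS0]
      unfold fluidX fluidY
      ring
    rw [e1, abs_mul, abs_of_pos (by positivity)]
    calc _ ≤ 1 / r * (2 * (q * r)) := by
          gcongr
          exact (abs_sub _ _).trans (by linarith)
      _ = 2 * q := by field_simp
  have hfluidX : ∀ s : State, fluidX p r s = (s.X : ℝ) / r + boundary p := by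
    intro s
    unfold fluidX boundary
    field_simp
    ring
  have hidx_mono : ∀ s t, s ∈ Icc 0 T → t ∈ Icc 0 T → s ≤ t → idx s ≤ idx t := by
    intro s t hs ht hst
    exact Nat.lt_succ_iff.1
      (h.strictMono.lt_iff_lt.1 ((hidx s hs).1.trans_lt (hst.trans_lt (hidx t ht).2)))
  refine ⟨h.intervalIntegrable _ hT, h.intervalIntegrable _ hT, h.intervalIntegrable _ hT,
    ?_, ?_, ?_, ?_, ?_, ?_⟩
  · obtain ⟨C1, h1⟩ := h.bounded (fluidX p r) T
    obtain ⟨C2, h2⟩ := h.bounded (fluidY r) T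
    obtain ⟨C3, h3⟩ := h.bounded (fluidW p r) T
    exact ⟨max C1 (max C2 C3), fun t ht => ⟨(h1 t ht).trans (le_max_left _ _),
      (h2 t ht).trans ((le_max_left _ _).trans (le_max_right _ _)),
      (h3 t ht).trans ((le_max_right _ _).trans (le_max_right _ _))⟩⟩
  · intro t ht
    have hint : ∫ s in (0:ℝ)..t, driftY p (fun t => fluidX p r (S t)) (fun t => fluidY r (S t))
        (fun t => fluidW p r (S t)) s = 1 / r * ((∫ s in (0:ℝ)..t, eventRate p Λ (S s) .acceptance)
          + (∫ s in (0:ℝ)..t, eventRate p Λ (S s) .completionReturn)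
          - ∫ s in (0:ℝ)..t, eventRate p Λ (S s) .arrival) := by
      rw [← intervalIntegral.integral_add (hi _ ht.1) (hi _ ht.1),
        ← intervalIntegral.integral_sub ((hi _ ht.1).add (hi _ ht.1)) (hi _ ht.1),
        ← intervalIntegral.integral_const_mul]
      congr 1
      ext s
      -- The centering constants contribute `-λ(1-α)` and `-αλ`, together the arrival term `-λ`.
      simp only [driftY, fluidX, fluidY, fluidW, eventRate, cast_W, hΛdef]
      rw [abs_mul, abs_of_pos (by positivity : 0 < 1 / r)]
      field_simp
      ring
    have e1 : fluidY r (S t) - fluidY r (S 0) = 1 / r * (eventCount p s₀ e .acceptance (idx t)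
        + eventCount p s₀ e .completionReturn (idx t) - eventCount p s₀ e .arrival (idx t)) := by
      rw [hS0, hS t ht]
      unfold fluidY
      rw [balance_Y]
      ring
    have h1 := abs_le.1 (hev .acceptance t ht)
    have h2 := abs_le.1 (hev .completionReturn t ht)
    have h3 := abs_le.1 (hev .arrival t ht)
    rw [hint, e1, ← mul_sub, abs_mul, abs_of_pos (by positivity)]
    have h10 : 1 / r * (10 * (q * r)) = 10 * q := by field_simp
    rw [← h10]
    have : 0 ≤ q * r := by positivity
    gcongr
    rw [abs_le]
    constructor <;> linarith [h1.1, h1.2, h2.1, h2.2, h3.1, h3.2]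
  · intro t ht
    have hint : ∫ s in (0:ℝ)..t, driftW p (fun t => fluidX p r (S t)) (fun t => fluidY r (S t))
        (fun t => fluidW p r (S t)) s = 1 / r * ((∫ s in (0:ℝ)..t, eventRate p Λ (S s) .acceptance)
          + (∫ s in (0:ℝ)..t, eventRate p Λ (S s) .arrival)
          - (∫ s in (0:ℝ)..t, eventRate p Λ (S s) .completionReturn)
          - 2 * ∫ s in (0:ℝ)..t, eventRate p Λ (S s) .completionLeave) := by
      rw [← intervalIntegral.integral_const_mul, ← intervalIntegral.integral_add (hi _ ht.1)
        (hi _ ht.1), ← intervalIntegral.integral_sub ((hi _ ht.1).add (hi _ ht.1)) (hi _ ht.1),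
        ← intervalIntegral.integral_sub (((hi _ ht.1).add (hi _ ht.1)).sub (hi _ ht.1))
          ((hi _ ht.1).const_mul _), ← intervalIntegral.integral_const_mul]
      congr 1
      ext s
      simp only [driftW, fluidX, fluidY, fluidW, eventRate, cast_W, hΛdef]
      rw [abs_mul, abs_of_pos (by positivity : 0 < 1 / r)]
      field_simp
      ring
    have e1 : fluidW p r (S t) - fluidW p r (S 0) = 1 / r * (eventCount p s₀ e .acceptance (idx t)
        + eventCount p s₀ e .arrival (idx t) - eventCount p s₀ e .completionReturn (idx t)
        - 2 * eventCount p s₀ e .completionLeave (idx t)) := by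
      rw [hS0, hS t ht]
      unfold fluidW
      rw [balance_W h.rate_pos]
      ring
    have h1 := abs_le.1 (hev .acceptance t ht)
    have h2 := abs_le.1 (hev .completionReturn t ht)
    have h3 := abs_le.1 (hev .arrival t ht)
    have h4 := abs_le.1 (hev .completionLeave t ht)
    rw [hint, e1, ← mul_sub, abs_mul, abs_of_pos (by positivity)]
    -- Three counts with coefficient 1 and one with coefficient 2, each with error `2 * q`, give the
    -- constant 10, the largest of all the errors.
    have h10 : 1 / r * (10 * (q * r)) = 10 * q := by field_simp
    rw [← h10]
    gcongr
    rw [abs_le]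
    constructor <;> linarith [h1.1, h1.2, h2.1, h2.2, h3.1, h3.2, h4.1, h4.2]
  · intro t _
    rw [hfluidX]
    have : 0 ≤ ((S t).X : ℝ) / r := by positivity
    linarith
  · intro t ht s hs
    have hs' : s ∈ Icc 0 T := ⟨hs.1, hs.2.trans ht.2⟩
    have h1 := abs_le.1 (hfree t ht)
    have h2 := abs_le.1 (hfree s hs')
    have h3 : regulator p s₀ e (idx s) / r ≤ regulator p s₀ e (idx t) / r := by
      have := regulator_mono h.rate_pos (hidx_mono s t hs' ht hs.2)
      gcongr
    have h4 : 0 ≤ regulator p s₀ e (idx t) / r := by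
      have := regulator_mono h.rate_pos (Nat.zero_le (idx t))
      rw [regulator_zero] at this
      positivity
    have h5 : 0 ≤ ((S s).X : ℝ) / r := by positivity
    have h6 := hfluidX (S s)
    refine max_le ?_ ?_ <;> linarith [h1.1, h1.2, h2.1, h2.2]
  · intro t ht
    -- The witness is the time of event `i`. If `X = 0` there, the scaled path is exactly at the
    -- boundary and the regulator is `boundary - freeX` up to noise; otherwise the regulator is zero
    -- and `max 0` covers it.
    obtain ⟨i, hit, hi1, hi2⟩ := exists_regulator_eq h.rate_pos (idx t)
    have hiT : ∑ k ∈ Finset.range i, τ k ∈ Icc 0 t :=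
      ⟨h.jumpTime_nonneg i, (h.strictMono.monotone hit).trans (hidx t ht).1⟩
    have hs' : ∑ k ∈ Finset.range i, τ k ∈ Icc 0 T := ⟨hiT.1, hiT.2.trans ht.2⟩
    refine ⟨∑ k ∈ Finset.range i, τ k, hiT, ?_⟩
    have hidxi := hidx0 i hs'
    generalize ∑ k ∈ Finset.range i, τ k = s at *
    have h1 := abs_le.1 (hfree t ht)
    have h2 := abs_le.1 (hfree s hs')
    rw [hidxi] at h2
    rw [hi1] at h1
    rcases hi2 with h3 | h3
    · rw [h3, zero_div] at h1
      have := le_max_left 0 (boundary p - u s)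
      linarith [h1.2]
    · have h4 := hfluidX (S s)
      rw [hS s hs', hidxi, h3, Nat.cast_zero, zero_div, ← hidxi, ← hS s hs'] at h4
      have := le_max_right 0 (boundary p - u s)
      linarith [h1.2, h2.1]

end IsPath

/-! ### Convergence -/

/-- Undoing the scaling, the initial total rate is `r` times a convergent sequence, and each later
event adds at most a constant. -/
lemma exists_rate_bound {p : Params} (hp : p.Admissible) {r : ℕ → ℝ} (hr : ∀ n, 0 < r n)
    {s₀ : ℕ → State} {x₀ y₀ w₀ : ℝ}
    (hX : Tendsto (fun n => fluidX p (r n) (s₀ n)) atTop (𝓝 x₀))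
    (hY : Tendsto (fun n => fluidY (r n) (s₀ n)) atTop (𝓝 y₀))
    (hW : Tendsto (fun n => fluidW p (r n) (s₀ n)) atTop (𝓝 w₀)) :
    ∃ C : ℝ, 0 < C ∧ ∀ᶠ n in atTop, ∀ (e : ℕ → Event) (k : ℕ),
      totalRate p (p.lam * r n) (stateAfter p (s₀ n) e k) ≤ C * (r n + k) := by
  have hβ := hp.β_pos
  have hμ := hp.μ_pos
  have hε := hp.ε_pos
  have hlam := hp.lam_pos
  have hlim : Tendsto (fun n => p.lam + p.β * (fluidX p (r n) (s₀ n) + p.lam * (1 - p.α) / p.β)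
      + p.ε * |fluidY (r n) (s₀ n)| + p.μ * ((fluidW p (r n) (s₀ n) + 2 * p.lam / p.μ
        - |fluidY (r n) (s₀ n)|) / 2)) atTop (𝓝 (p.lam + p.β * (x₀ + p.lam * (1 - p.α) / p.β)
      + p.ε * |y₀| + p.μ * ((w₀ + 2 * p.lam / p.μ - |y₀|) / 2))) :=
    (((hX.add_const _).const_mul _).const_add _ |>.add (hY.abs.const_mul _)).add
      ((((hW.add_const _).sub hY.abs).div_const _).const_mul _)
  set B := p.lam + p.β * (x₀ + p.lam * (1 - p.α) / p.β)
      + p.ε * |y₀| + p.μ * ((w₀ + 2 * p.lam / p.μ - |y₀|) / 2)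
  refine ⟨|B| + 1 + (p.β * p.γ + p.ε + p.μ), by positivity, ?_⟩
  filter_upwards [hlim.eventually_le_const (lt_add_one B)] with n hn e k
  have hrn := hr n
  refine (totalRate_stateAfter_le hp (s₀ n) e k).trans ?_
  have e1 : p.lam * r n + p.β * (s₀ n).X + p.ε * |((s₀ n).Y : ℝ)| + p.μ * (s₀ n).Z =
      r n * (p.lam + p.β * (fluidX p (r n) (s₀ n) + p.lam * (1 - p.α) / p.β)
      + p.ε * |fluidY (r n) (s₀ n)| + p.μ * ((fluidW p (r n) (s₀ n) + 2 * p.lam / p.μ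
        - |fluidY (r n) (s₀ n)|) / 2)) := by
    simp only [fluidX, fluidY, fluidW, cast_W]
    rw [abs_mul, abs_of_pos (by positivity : 0 < 1 / r n)]
    field_simp
    ring
  rw [e1]
  have h1 := mul_le_mul_of_nonneg_left hn hrn.le
  have h2 : r n * (B + 1) ≤ r n * (|B| + 1) := by
    have := le_abs_self B
    gcongr
  have h3 : 0 ≤ p.β * p.γ + p.ε + p.μ := by positivity
  have h4 : 0 ≤ (|B| + 1) * (k:ℝ) := by positivity
  have h5 : 0 ≤ (p.β * p.γ + p.ε + p.μ) * r n := by positivity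
  linarith

end

/-! ### The fluid limit theorem -/

theorem theorem1 (p : Params)
    (hlam : 0 < p.lam) (hα0 : 0 ≤ p.α) (hα1 : p.α < 1) (hβ : 0 < p.β) (hμ : 0 < p.μ)
    (hε : 0 < p.ε) (hγ : 0 < p.γ)
    (r : ℕ → ℝ) (hr : ∀ n, 0 < r n) (hr_tendsto : Tendsto r atTop atTop)
    (s₀ : ℕ → State) (x₀ y₀ w₀ : ℝ) (hx₀ : boundary p ≤ x₀)
    (hX : Tendsto (fun n => fluidX p (r n) (s₀ n)) atTop (𝓝 x₀))
    (hY : Tendsto (fun n => fluidY (r n) (s₀ n)) atTop (𝓝 y₀))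
    (hW : Tendsto (fun n => fluidW p (r n) (s₀ n)) atTop (𝓝 w₀)) :
    ∃ (Ω : Type) (_ : MeasurableSpace Ω) (P : Measure Ω) (S : ℕ → ℝ → Ω → State),
      IsProbabilityMeasure P ∧
      (∀ n, IsInvitationProcess P p (p.lam * r n) (s₀ n) (S n)) ∧
      ∀ᵐ ω ∂P, ∀ φ : ℕ → ℕ, StrictMono φ →
        ∃ ψ : ℕ → ℕ, StrictMono ψ ∧
        ∃ x y w : ℝ → ℝ,
          TendstoUOC (fun n t => fluidX p (r (φ (ψ n))) (S (φ (ψ n)) t ω)) x ∧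
          TendstoUOC (fun n t => fluidY (r (φ (ψ n))) (S (φ (ψ n)) t ω)) y ∧
          TendstoUOC (fun n t => fluidW p (r (φ (ψ n))) (S (φ (ψ n)) t ω)) w ∧
          LocallyLipschitzOn (Ici 0) x ∧
          LocallyLipschitzOn (Ici 0) y ∧
          LocallyLipschitzOn (Ici 0) w ∧
          x 0 = x₀ ∧ y 0 = y₀ ∧ w 0 = w₀ ∧
          (∀ t, 0 ≤ t → boundary p ≤ x t) ∧
          ∀ t, IsRegularPoint ![x, y, w] t → FluidSystemAt p x y w t := by
  have hp : p.Admissible := ⟨hlam, hα0, hα1, hβ, hμ, hε, hγ⟩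
  obtain ⟨Ω, hΩ, P, S, m, hP, hm, hproc, hgood⟩ := exists_coupled_processes hp r hr hr_tendsto s₀
  refine ⟨Ω, hΩ, P, S, hP, hproc, ?_⟩
  filter_upwards [hgood] with ω hω φ hφ
  obtain ⟨e, τ, hpath, hnoise⟩ := hω
  obtain ⟨C, hC0, hC⟩ := exists_rate_bound hp hr hX hY hW
  have hm' : Tendsto (fun n => (m n : ℝ)) atTop atTop := tendsto_natCast_atTop_atTop.comp hm
  have herr : Tendsto (fun n => 2 * (2 / (m n : ℝ) + 2 / r n)) atTop (𝓝 0) := by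
    have := ((hm'.const_div_atTop 2).add (hr_tendsto.const_div_atTop 2)).const_mul 2
    simpa using this
  have happrox : ∀ T, 0 ≤ T → ∀ δ, 0 < δ → ∀ᶠ n in atTop, ApproxSolution p T δ
      (fun t => fluidX p (r n) (S n t ω)) (fun t => fluidY (r n) (S n t ω))
      (fun t => fluidW p (r n) (S n t ω)) := by
    intro T hT δ hδ
    have hsmall : ∀ᶠ n in atTop, 10 * (2 / (m n : ℝ) + 2 / r n) < min δ 1 := by
      have := herr.const_mul 5
      rw [mul_zero] at this
      filter_upwards [this.eventually_lt_const (lt_min hδ one_pos)] with n hn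
      linarith
    -- With `r ≥ 1`, the bound on `m` gives `m * r ≥ 4 * exp (2 * C * T) * r + 2`, the range of
    -- noise control that `approxSolution` asks for.
    filter_upwards [hC, hnoise, hsmall, hr_tendsto.eventually_ge_atTop 1,
      hm'.eventually_ge_atTop (4 * Real.exp (2 * C * T) + 2)] with n h1 h2 h3 h4 h5
    have hrn := hr n
    have hq : ((2 * (r n / m n) + 1 + 1) / r n : ℝ) = 2 / (m n : ℝ) + 2 / r n := by
      field_simp
      ring
    have h6 := (hpath n).approxSolution hp hrn hT hC0 (h1 (e n)) h2 (by
      have h7 : (10 * ((2 * (r n / m n) + 1 + 1) / r n) : ℝ) ≤ 1 := by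
        rw [hq]; exact h3.le.trans (min_le_right _ _)
      rw [← mul_div_assoc, div_le_one hrn] at h7
      exact h7) (by nlinarith)
    rw [hq] at h6
    have h7 := h3.le.trans (min_le_left _ _)
    exact ⟨h6.int_x, h6.int_y, h6.int_w, h6.bdd, fun t ht => (h6.y_eq t ht).trans h7,
      fun t ht => (h6.w_eq t ht).trans h7, h6.x_ge,
      fun t ht s hs => (h6.reg_ge t ht s hs).trans (by linarith), fun t ht => by
        obtain ⟨s, hs, hle⟩ := h6.reg_le t ht
        exact ⟨s, hs, hle.trans (by linarith)⟩⟩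
  have hS0 : ∀ n, S n 0 ω = s₀ n := fun n =>
    (hpath n).eq 0 0 (by simp) (by simpa using (hpath n).time_pos 0)
  have hφ' := hφ.tendsto_atTop
  obtain ⟨x, y, w, hx, hy, hw, hx0, hy0, hw0, hsol⟩ := exists_limit hp
    (fun T hT δ hδ => hφ'.eventually (happrox T hT δ hδ))
    (x₀ := x₀) (y₀ := y₀) (w₀ := w₀)
    (by simpa only [hS0, Function.comp_def] using hX.comp hφ')
    (by simpa only [hS0, Function.comp_def] using hY.comp hφ')
    (by simpa only [hS0, Function.comp_def] using hW.comp hφ')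
  have hexact : IsExactSolution p x y w := hsol
  -- No further extraction is needed, since stability already gives convergence along `φ`.
  exact ⟨id, strictMono_id, x, y, w, hx, hy, hw, (hexact.lipschitz_x hp).locallyLipschitzOn,
    (hexact.lipschitz_y hp).locallyLipschitzOn, (hexact.lipschitz_w hp).locallyLipschitzOn,
    hx0, hy0, hw0, fun t ht => hexact.x_ge ht, fun t ht => hexact.fluidSystemAt hp ht⟩
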